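/- Let $N$ be the number of degrees of freedom, $\mathcal H=L^2(\mathbb R^N)$, $X=\mathbb R^{2N}$ the phase space of pairs $x=(q,p)$ with symplectic form $\{(q,p),(q',p')\}=q'\cdot p-q\cdot p'$ and measure $dx=(2\pi)^{-N}dq\,dp$, and let $W(x)$ be the Weyl operators $(W(q,p)\psi)(s)=e^{-\frac i2 q\cdot p}e^{ip\cdot s}\psi(s-q)$. Write $Q_i$ for multiplication by $q_i$, $P_i=-i\,\partial/\partial q_i$, and $|\alpha\rangle$, $\alpha\in\mathbb N_0^N$, for the normalised Hermite basis of $\mathcal H$. Let $\mathfrak S(\mathcal H)$ be the space of Schwartz operators, i.e. of those bounded operators $T$ on $\mathcal H$ for which $$\|T\|_{\alpha,\alpha',\beta,\beta'}=\sup\{|\langle P^\beta Q^\alpha\psi|TP^{\beta'}Q^{\alpha'}\varphi\rangle| : \psi,\varphi\in\mathfrak S(\mathbb R^N),\ \|\psi\|\le1,\ \|\varphi\|\le 1\}<\infty$$ for all multi-indices, with the topology given by these seminorms, and let $\mathfrak s_{2N}$ be the space of multisequences $(a_\gamma)_{\gamma\in\mathbb N_0^{2N}}$ with $\|a\|_\delta^2=\sum_\gamma(\gamma+1)^{2\delta}|a_\gamma|^2<\infty$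 for all $\delta\in\mathbb N_0^{2N}$, with the topology given by the norms $\|\cdot\|_\delta$. Topological duals, denoted by a prime, carry the weak-* topology. The following maps are well-defined topological (linear) isomorphisms: * $\mathfrak S(\mathcal H)\to\mathfrak S(\mathbb R^{2N})$, $T\mapsto K^T$ (the integral kernel of $T$); * $\mathfrak S(\mathcal H)\to\mathfrak s_{2N}$, $T\mapsto a^T$, $a^T_{(\alpha,\alpha')}=\langle\alpha|T|\alpha'\rangle$; * the symplectic Fourier transform $\mathfrak S(X)\to\mathfrak S(X)$, $\widehat f(x)=\int e^{-i\{x,y\}}f(y)\,dy$; * the Weyl transform $\mathfrak S(\mathcal H)\to\mathfrak S(X)$, $\widehat T(x)=\operatorname{Tr}[W(x)T]$, with inverse $\check f=\int W(-y)f(y)\,dy$ (weak integral). Moreover: 1. The transposes $\mathfrak S'(\mathbb R^{2N})\to\mathfrak S'(\mathcal H)$, $\phi\mapsto(T\mapsto\phi(K^T))$, and $\mathfrak s'_{2N}\to\mathfrak S'(\mathcal H)$, $a\mapsto(T\mapsto a(a^T))$, are linear homeomorphisms. 2. Put $f_-(x)=f(-x)$ and $\phi_-(f)=\phi(f_-)$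 for $f\in\mathfrak S(X)$ and $\phi\in\mathfrak S'(X)$. The Fourier transform $\phi\mapsto\widehat\phi$, $\widehat\phi(f)=\phi(\widehat f_-)$, is a topological isomorphism of $\mathfrak S'(X)$ onto itself. The Weyl transform $\mathfrak S'(\mathcal H)\to\mathfrak S'(X)$, $\widehat\Phi(f)=\Phi((f_-)^{\vee})$, is a topological isomorphism, with inverse $\phi\mapsto\check\phi$, $\check\phi(T)=\phi(\widehat T_-)$; and the Weyl quantisation $\mathfrak S'(X)\to\mathfrak S'(\mathcal H)$, $\phi\mapsto(\widehat\phi_-)^{\vee}$, is a topological isomorphism. -/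

import Mathlib

open MeasureTheory SchwartzMap
open scoped InnerProductSpace LineDeriv

namespace QuantumSchwartz

noncomputable section

/-! ### Configuration space, phase space, Hilbert space -/

/-- The configuration space `ℝ^N`. -/
abbrev Config (N : ℕ) := EuclideanSpace ℝ (Fin N)

/-- The phase space `X = ℝ^N × ℝ^N` of pairs `x = (q, p)`. The same type also models the product
`ℝ^{2N}` of two copies of the configuration space on which integral kernels live. -/
abbrev Phase (N : ℕ) := Config N × Config N

/-- The Hilbert space `L²(ℝ^N, dq)`; its inner product is conjugate linear in the first slot. -/
abbrev Hilb (N : ℕ) := Lp ℂ 2 (volume : Measure (Config N))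

/-- The inclusion of Schwartz functions into `L²(ℝ^N)`. -/
abbrev toHilb {N : ℕ} (ψ : 𝓢(Config N, ℂ)) : Hilb N := ψ.toLp 2 volume

/-- The normalised measure `dx = (2π)^{-N} dq dp` on phase space. -/
def phaseMeasure (N : ℕ) : Measure (Phase N) :=
  ENNReal.ofReal (((2 * Real.pi) ^ N)⁻¹) • (volume : Measure (Phase N))

/-- The symplectic form `{(q, p), (q', p')} = q' · p - q · p'`. -/
def sympForm {N : ℕ} (x y : Phase N) : ℝ := ⟪y.1, x.2⟫_ℝ - ⟪x.1, y.2⟫_ℝ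

/-! ### Position and momentum operators on Schwartz functions -/

/-- `Q_i`: multiplication by the `i`-th coordinate. -/
def posOp {N : ℕ} (i : Fin N) : 𝓢(Config N, ℂ) →L[ℂ] 𝓢(Config N, ℂ) :=
  smulLeftCLM ℂ (fun q : Config N => ((q i : ℝ) : ℂ))

theorem posOp_apply {N : ℕ} (i : Fin N) (ψ : 𝓢(Config N, ℂ)) (q : Config N) :
    posOp i ψ q = ((q i : ℝ) : ℂ) * ψ q := by
  have h : Function.HasTemperateGrowth (fun q : Config N => ((q i : ℝ) : ℂ)) :=
    (Complex.ofRealCLM.comp (EuclideanSpace.proj (𝕜 := ℝ) i)).hasTemperateGrowth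
  simp [posOp, smulLeftCLM_apply_apply h]

/-- `P_i = -i ∂/∂q_i`. -/
def momOp {N : ℕ} (i : Fin N) : 𝓢(Config N, ℂ) →L[ℂ] 𝓢(Config N, ℂ) :=
  (-Complex.I) •
    LineDeriv.lineDerivOpCLM ℂ 𝓢(Config N, ℂ) (EuclideanSpace.single i (1 : ℝ) : Config N)

/-- `Q^α = Q_1^{α_1} ⋯ Q_N^{α_N}`. -/
def posPow {N : ℕ} (α : Fin N → ℕ) : 𝓢(Config N, ℂ) →L[ℂ] 𝓢(Config N, ℂ) :=
  (List.ofFn fun i => posOp i ^ α i).prod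

/-- `P^β = P_1^{β_1} ⋯ P_N^{β_N}`. -/
def momPow {N : ℕ} (β : Fin N → ℕ) : 𝓢(Config N, ℂ) →L[ℂ] 𝓢(Config N, ℂ) :=
  (List.ofFn fun i => momOp i ^ β i).prod

/-- The vector `P^β Q^α ψ ∈ L²(ℝ^N)` for a Schwartz function `ψ`. -/
def pqVec {N : ℕ} (α β : Fin N → ℕ) (ψ : 𝓢(Config N, ℂ)) : Hilb N :=
  toHilb (momPow β (posPow α ψ))

/-! ### Schwartz operators -/

/-- The index set of the quadruples `(α, α', β, β')` of multi-indices. -/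
abbrev QuadIndex (N : ℕ) := (Fin N → ℕ) × (Fin N → ℕ) × (Fin N → ℕ) × (Fin N → ℕ)

/-- The values `|⟨P^β Q^α ψ | T P^{β'} Q^{α'} φ⟩|`, where `ψ`, `φ` range over the Schwartz functions
in the unit ball of `L²`; here `k = (α, α', β, β')`. -/
def formValues {N : ℕ} (k : QuadIndex N) (T : Hilb N →L[ℂ] Hilb N) : Set ℝ :=
  {r | ∃ ψ φ : 𝓢(Config N, ℂ), ‖toHilb ψ‖ ≤ 1 ∧ ‖toHilb φ‖ ≤ 1 ∧
    r = ‖⟪pqVec k.1 k.2.2.1 ψ, T (pqVec k.2.1 k.2.2.2 φ)⟫_ℂ‖}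

/-- The number `‖T‖_{α,α',β,β'}`, with `k = (α, α', β, β')`. -/
def formNorm {N : ℕ} (k : QuadIndex N) (T : Hilb N →L[ℂ] Hilb N) : ℝ := sSup (formValues k T)

/-- `T` is a Schwartz operator if `‖T‖_{α,α',β,β'} < ∞` for all `α, α', β, β'`. -/
def IsSchwartzOperator {N : ℕ} (T : Hilb N →L[ℂ] Hilb N) : Prop :=
  ∀ k : QuadIndex N, BddAbove (formValues k T)

theorem formValues_nonempty {N : ℕ} (k : QuadIndex N) (T : Hilb N →L[ℂ] Hilb N) :
    (formValues k T).Nonempty := by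
  have h : ‖toHilb (0 : 𝓢(Config N, ℂ))‖ ≤ 1 := by
    have : toHilb (0 : 𝓢(Config N, ℂ)) = 0 := map_zero (toLpCLM ℂ ℂ 2 volume)
    simp [this]
  exact ⟨_, 0, 0, h, h, rfl⟩

theorem formNorm_nonneg {N : ℕ} (k : QuadIndex N) (T : Hilb N →L[ℂ] Hilb N) :
    0 ≤ formNorm k T := by
  refine Real.sSup_nonneg ?_
  rintro r ⟨ψ, φ, -, -, rfl⟩
  exact norm_nonneg _

theorem formValues_add_le {N : ℕ} {k : QuadIndex N} {S T : Hilb N →L[ℂ] Hilb N}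
    (hS : BddAbove (formValues k S)) (hT : BddAbove (formValues k T)) :
    ∀ r ∈ formValues k (S + T), r ≤ formNorm k S + formNorm k T := by
  rintro r ⟨ψ, φ, hψ, hφ, rfl⟩
  rw [add_apply, inner_add_right]
  exact (norm_add_le _ _).trans
    (add_le_add (le_csSup hS ⟨ψ, φ, hψ, hφ, rfl⟩) (le_csSup hT ⟨ψ, φ, hψ, hφ, rfl⟩))

theorem formValues_smul_le {N : ℕ} {k : QuadIndex N} {T : Hilb N →L[ℂ] Hilb N} (c : ℂ)
    (hT : BddAbove (formValues k T)) :
    ∀ r ∈ formValues k (c • T), r ≤ ‖c‖ * formNorm k T := by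
  rintro r ⟨ψ, φ, hψ, hφ, rfl⟩
  rw [smul_apply, inner_smul_right, norm_mul]
  exact mul_le_mul_of_nonneg_left (le_csSup hT ⟨ψ, φ, hψ, hφ, rfl⟩) (norm_nonneg c)

theorem formNorm_zero {N : ℕ} (k : QuadIndex N) :
    formNorm k (0 : Hilb N →L[ℂ] Hilb N) = 0 := by
  refine le_antisymm (csSup_le (formValues_nonempty k 0) ?_) (formNorm_nonneg k 0)
  rintro r ⟨ψ, φ, -, -, rfl⟩
  simp

/-- The Schwartz operators as a subspace of the bounded operators. -/
def schwartzOperatorSubmodule (N : ℕ) : Submodule ℂ (Hilb N →L[ℂ] Hilb N) where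
  carrier := {T | IsSchwartzOperator T}
  add_mem' hS hT k := ⟨_, formValues_add_le (hS k) (hT k)⟩
  zero_mem' k := by
    refine ⟨0, ?_⟩
    rintro r ⟨ψ, φ, -, -, rfl⟩
    simp
  smul_mem' c _ hT k := ⟨_, formValues_smul_le c (hT k)⟩

/-- The space `𝔖(H)` of Schwartz operators. It is a type of its own, so that it carries the topology
defined below and not the one inherited from the operator norm. -/
def SchwartzOperator (N : ℕ) : Type := schwartzOperatorSubmodule N

instance (N : ℕ) : AddCommGroup (SchwartzOperator N) :=
  inferInstanceAs (AddCommGroup (schwartzOperatorSubmodule N))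

instance (N : ℕ) : Module ℂ (SchwartzOperator N) :=
  inferInstanceAs (Module ℂ (schwartzOperatorSubmodule N))

/-- The bounded operator underlying a Schwartz operator. -/
def SchwartzOperator.op {N : ℕ} : SchwartzOperator N →ₗ[ℂ] (Hilb N →L[ℂ] Hilb N) :=
  (schwartzOperatorSubmodule N).subtype

theorem SchwartzOperator.isSchwartz {N : ℕ} (T : SchwartzOperator N) :
    IsSchwartzOperator T.op := T.2

/-- The seminorms `T ↦ ‖T‖_{α,α',β,β'}` on `𝔖(H)`. -/
def schwartzOperatorSeminorm (N : ℕ) : SeminormFamily ℂ (SchwartzOperator N) (QuadIndex N) :=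
  fun k => Seminorm.ofSMulLE (fun T => formNorm k T.op)
    (by simp only [map_zero]; exact formNorm_zero k)
    (fun S T => by
      simp only [map_add]
      exact csSup_le (formValues_nonempty k _)
        (formValues_add_le (S.isSchwartz k) (T.isSchwartz k)))
    (fun c T => by
      simp only [map_smul]
      exact csSup_le (formValues_nonempty k _) (formValues_smul_le c (T.isSchwartz k)))

/-- The locally convex topology of `𝔖(H)`, generated by the seminorms `‖·‖_{α,α',β,β'}`. -/
instance (N : ℕ) : TopologicalSpace (SchwartzOperator N) :=
  (schwartzOperatorSeminorm N).moduleFilterBasis.topology'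

theorem schwartzOperator_withSeminorms (N : ℕ) : WithSeminorms (schwartzOperatorSeminorm N) :=
  ⟨rfl⟩

/-- The dual `𝔖'(H)`: continuous linear functionals on `𝔖(H)`, with the topology of pointwise
convergence, that is, the weak-* topology. -/
abbrev OperatorDistribution (N : ℕ) := SchwartzOperator N →Lₚₜ[ℂ] ℂ

/-! ### Schwartz multisequences -/

/-- The weight `(β + 1)^α = ∏ i, (β_i + 1)^{α_i}`. -/
def seqWeight {n : ℕ} (α β : Fin n → ℕ) : ℂ := ∏ i, ((β i : ℂ) + 1) ^ α i

/-- The multisequence `β ↦ (β + 1)^α a_β`. -/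
def weightedSeq {n : ℕ} (α : Fin n → ℕ) :
    ((Fin n → ℕ) → ℂ) →ₗ[ℂ] PreLp (fun _ : Fin n → ℕ => ℂ) where
  toFun a := fun β => seqWeight α β * a β
  map_add' a b := by funext β; exact mul_add _ _ _
  map_smul' c a := by funext β; exact mul_left_comm _ _ _

/-- The Schwartz multisequences: those `a` for which `∑_β (β + 1)^{2α} |a_β|² < ∞` for all `α`. -/
def schwartzSeqSubmodule (n : ℕ) : Submodule ℂ ((Fin n → ℕ) → ℂ) where
  carrier := {a | ∀ α : Fin n → ℕ, Memℓp (weightedSeq α a) 2}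
  add_mem' ha hb α := by rw [map_add]; exact (ha α).add (hb α)
  zero_mem' α := by rw [map_zero]; exact zero_memℓp
  smul_mem' c a ha α := by rw [map_smul]; exact (ha α).const_smul c

/-- The space `𝔰_n` of Schwartz multisequences indexed by `n`-multi-indices. -/
def SchwartzSeq (n : ℕ) : Type := schwartzSeqSubmodule n

instance (n : ℕ) : AddCommGroup (SchwartzSeq n) :=
  inferInstanceAs (AddCommGroup (schwartzSeqSubmodule n))

instance (n : ℕ) : Module ℂ (SchwartzSeq n) :=
  inferInstanceAs (Module ℂ (schwartzSeqSubmodule n))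

/-- The multisequence underlying an element of `𝔰_n`. -/
def SchwartzSeq.coeff {n : ℕ} : SchwartzSeq n →ₗ[ℂ] ((Fin n → ℕ) → ℂ) :=
  (schwartzSeqSubmodule n).subtype

/-- The element `β ↦ (β + 1)^α a_β` of `ℓ²`. -/
def SchwartzSeq.toL2 {n : ℕ} (α : Fin n → ℕ) :
    SchwartzSeq n →ₗ[ℂ] lp (fun _ : Fin n → ℕ => ℂ) 2 where
  toFun a := ⟨weightedSeq α a.coeff, a.2 α⟩
  map_add' a b := by ext β; simp
  map_smul' c a := Subtype.ext (by simp only [map_smul]; rfl)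

/-- The seminorms `‖a‖_α = (∑_β (β + 1)^{2α} |a_β|²)^{1/2}` on `𝔰_n`. -/
def schwartzSeqSeminorm (n : ℕ) : SeminormFamily ℂ (SchwartzSeq n) (Fin n → ℕ) :=
  fun α => (normSeminorm ℂ (lp (fun _ : Fin n → ℕ => ℂ) 2)).comp (SchwartzSeq.toL2 α)

/-- The locally convex topology of `𝔰_n`. -/
instance (n : ℕ) : TopologicalSpace (SchwartzSeq n) :=
  (schwartzSeqSeminorm n).moduleFilterBasis.topology'

theorem schwartzSeq_withSeminorms (n : ℕ) : WithSeminorms (schwartzSeqSeminorm n) :=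
  ⟨rfl⟩

/-- The dual `𝔰'_n` with the weak-* topology. -/
abbrev SeqDistribution (n : ℕ) := SchwartzSeq n →Lₚₜ[ℂ] ℂ

/-! ### The number basis, kernels and matrices -/

/-- The `n`-th normalised Hermite function on `ℝ`,
`h_n(t) = (n! √π)^{-1/2} He_n(√2 t) e^{-t²/2}`, where `He_n` is the probabilists' Hermite polynomial;
equivalently `(2^n n! √π)^{-1/2} H_n(t) e^{-t²/2}` with the physicists' `H_n`. -/
def hermiteFun (n : ℕ) (t : ℝ) : ℝ :=
  (Real.sqrt (n.factorial * Real.sqrt Real.pi))⁻¹ *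
    Polynomial.aeval (Real.sqrt 2 * t) (Polynomial.hermite n) * Real.exp (-t ^ 2 / 2)

/-- `|α⟩(q) = h_{α_1}(q_1) ⋯ h_{α_N}(q_N)`. -/
def numberFun {N : ℕ} (α : Fin N → ℕ) (q : Config N) : ℂ := ∏ i, ((hermiteFun (α i) (q i) : ℝ) : ℂ)

theorem continuous_hermiteFun (n : ℕ) : Continuous (hermiteFun n) := by
  unfold hermiteFun
  fun_prop

theorem memLp_hermiteFun (n : ℕ) : MemLp (hermiteFun n) 2 volume := by
  rw [memLp_two_iff_integrable_sq (continuous_hermiteFun n).aestronglyMeasurable]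
  have key : ∀ p : Polynomial ℝ, Integrable fun t : ℝ => p.eval t * Real.exp (-1 * t ^ 2) := by
    intro p
    induction p using Polynomial.induction_on' with
    | add p q hp hq =>
      refine (hp.add hq).congr (Filter.Eventually.of_forall fun t => ?_)
      simp only [Pi.add_apply, Polynomial.eval_add, add_mul]
    | monomial k a =>
      have h := integrable_rpow_mul_exp_neg_mul_sq (b := 1) one_pos (s := (k : ℝ))
        (lt_of_lt_of_le (by norm_num) (Nat.cast_nonneg k))
      simpa only [Polynomial.eval_monomial, Real.rpow_natCast, mul_assoc] using h.const_mul a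
  have h := (key ((((Polynomial.hermite n).map (Int.castRingHom ℝ)).comp
    (Polynomial.C (Real.sqrt 2) * Polynomial.X)) ^ 2)).const_mul
      ((Real.sqrt (n.factorial * Real.sqrt Real.pi))⁻¹ ^ 2)
  refine h.congr (Filter.Eventually.of_forall fun t => ?_)
  have e : Real.exp (-1 * t ^ 2) = Real.exp (-t ^ 2 / 2) ^ 2 := by
    rw [← Real.exp_nat_mul]; congr 1; push_cast; ring
  simp only [hermiteFun, e, Polynomial.eval_pow, Polynomial.eval_comp, Polynomial.eval_mul,
    Polynomial.eval_C, Polynomial.eval_X, Polynomial.eval_map, Polynomial.aeval_def,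
    algebraMap_int_eq]
  ring

theorem memLp_numberFun {N : ℕ} (α : Fin N → ℕ) :
    MemLp (numberFun α) 2 (volume : Measure (Config N)) := by
  have hc : Continuous (numberFun α) := by
    unfold numberFun
    refine continuous_finsetProd _ fun i _ => ?_
    have := continuous_hermiteFun (α i)
    fun_prop
  rw [memLp_two_iff_integrable_sq_norm hc.aestronglyMeasurable]
  have h : Integrable (fun x : Fin N → ℝ => ∏ i, hermiteFun (α i) (x i) ^ 2) volume :=
    Integrable.fintype_prod (f := fun i t => hermiteFun (α i) t ^ 2)
      fun i => (memLp_hermiteFun (α i)).integrable_sq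
  have h' := (EuclideanSpace.volume_preserving_symm_measurableEquiv_toLp
    (Fin N)).integrable_comp_of_integrable h
  refine h'.congr (Filter.Eventually.of_forall fun q => ?_)
  simp [numberFun, ← Finset.prod_pow]

/-- The number basis vector `|α⟩ ∈ L²(ℝ^N)`. -/
def numberVec {N : ℕ} (α : Fin N → ℕ) : Hilb N := (memLp_numberFun α).toLp

/-- The matrix element `⟨α | T | α'⟩`. -/
def matrixElem {N : ℕ} (T : Hilb N →L[ℂ] Hilb N) (α α' : Fin N → ℕ) : ℂ :=
  ⟪numberVec α, T (numberVec α')⟫_ℂ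

/-- `K` is the kernel of `T`: `⟨ψ | T φ⟩ = ∫ conj(ψ(q)) K(q, q') φ(q') dq dq'` for all `ψ, φ ∈ L²`. -/
def IsKernel {N : ℕ} (T : Hilb N →L[ℂ] Hilb N) (K : 𝓢(Config N × Config N, ℂ)) : Prop :=
  ∀ ψ φ : Hilb N,
    ⟪ψ, T φ⟫_ℂ = ∫ z : Config N × Config N, (starRingEnd ℂ) (ψ z.1) * K z * φ z.2

/-! ### Weyl operators, trace, Weyl transform, symplectic Fourier transform -/

/-- The function `s ↦ e^{-i q·p/2} e^{i p·s} ψ(s - q)`, where `x = (q, p)`. -/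
def weylFun {N : ℕ} (x : Phase N) (ψ : Config N → ℂ) (s : Config N) : ℂ :=
  Complex.exp (-(Complex.I / 2) * (⟪x.1, x.2⟫_ℝ : ℝ)) * Complex.exp (Complex.I * (⟪x.2, s⟫_ℝ : ℝ)) *
    ψ (s - x.1)

theorem norm_weylFun {N : ℕ} (x : Phase N) (ψ : Config N → ℂ) (s : Config N) :
    ‖weylFun x ψ s‖ = ‖ψ (s - x.1)‖ := by
  simp [weylFun, Complex.norm_exp]

theorem memLp_weylFun {N : ℕ} (x : Phase N) (ψ : Hilb N) :
    MemLp (weylFun x ψ) 2 (volume : Measure (Config N)) := by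
  have h : MemLp (fun s => ψ (s - x.1)) 2 (volume : Measure (Config N)) :=
    (Lp.memLp ψ).comp_measurePreserving (measurePreserving_sub_right volume x.1)
  refine h.of_le ?_ (Filter.Eventually.of_forall fun s => (norm_weylFun x ψ s).le)
  have hc : Continuous fun s : Config N =>
      Complex.exp (-(Complex.I / 2) * (⟪x.1, x.2⟫_ℝ : ℝ)) *
        Complex.exp (Complex.I * (⟪x.2, s⟫_ℝ : ℝ)) := by fun_prop
  exact hc.aestronglyMeasurable.mul h.aestronglyMeasurable

/-- The Weyl operator `W(x)`, `(W(q, p) ψ)(s) = e^{-i q·p/2} e^{i p·s} ψ(s - q)`. -/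
def weylOp {N : ℕ} (x : Phase N) : Hilb N →ₗᵢ[ℂ] Hilb N where
  toFun ψ := (memLp_weylFun x ψ).toLp
  map_add' ψ φ := by
    rw [← MemLp.toLp_add, MemLp.toLp_eq_toLp_iff]
    filter_upwards [(measurePreserving_sub_right volume x.1).quasiMeasurePreserving.ae_eq_comp
      (Lp.coeFn_add ψ φ)] with s hs
    simp only [Function.comp_apply, Pi.add_apply] at hs
    simp only [weylFun, Pi.add_apply, hs, mul_add]
  map_smul' c ψ := by
    rw [RingHom.id_apply, ← MemLp.toLp_const_smul, MemLp.toLp_eq_toLp_iff]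
    filter_upwards [(measurePreserving_sub_right volume x.1).quasiMeasurePreserving.ae_eq_comp
      (Lp.coeFn_smul c ψ)] with s hs
    simp only [Function.comp_apply, Pi.smul_apply, smul_eq_mul] at hs
    simp only [weylFun, Pi.smul_apply, smul_eq_mul, hs]
    ring
  norm_map' ψ := by
    change ‖(memLp_weylFun x ψ).toLp‖ = ‖ψ‖
    rw [Lp.norm_toLp, Lp.norm_def]
    congr 1
    rw [← eLpNorm_comp_measurePreserving (Lp.aestronglyMeasurable ψ)
      (measurePreserving_sub_right volume x.1)]
    exact eLpNorm_congr_norm_ae (Filter.Eventually.of_forall fun s => norm_weylFun x ψ s)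

/-- `A` is of trace class with trace `c`: for every orthonormal basis, the diagonal matrix elements
are summable with sum `c`. -/
def HasTrace {N : ℕ} (A : Hilb N →L[ℂ] Hilb N) (c : ℂ) : Prop :=
  ∀ (ι : Type) (b : HilbertBasis ι ℂ (Hilb N)), HasSum (fun i => ⟪b i, A (b i)⟫_ℂ) c

/-- `g` is the Weyl transform of `T`: `g(x) = Tr[W(x) T]`. -/
def IsWeylTransform {N : ℕ} (T : Hilb N →L[ℂ] Hilb N) (g : Phase N → ℂ) : Prop :=
  ∀ x : Phase N, HasTrace ((weylOp x).toContinuousLinearMap.comp T) (g x)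

/-- `T` is the inverse Weyl transform of `f`: `T = ∫ W(-y) f(y) dy` in the weak sense. -/
def IsInverseWeylTransform {N : ℕ} (f : Phase N → ℂ) (T : Hilb N →L[ℂ] Hilb N) : Prop :=
  ∀ ψ φ : Hilb N, ⟪ψ, T φ⟫_ℂ = ∫ y, f y * ⟪ψ, weylOp (-y) φ⟫_ℂ ∂(phaseMeasure N)

/-- The symplectic Fourier transform `f̂(x) = ∫ e^{-i{x,y}} f(y) dy`. -/
def symplecticFourier {N : ℕ} (f : Phase N → ℂ) (x : Phase N) : ℂ :=
  ∫ y, Complex.exp (-Complex.I * (sympForm x y : ℝ)) * f y ∂(phaseMeasure N)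

/-- Parity on `𝔖(X)`: `f₋(x) = f(-x)`. -/
def parity {N : ℕ} : 𝓢(Phase N, ℂ) →L[ℂ] 𝓢(Phase N, ℂ) :=
  compCLMOfContinuousLinearEquiv ℂ (ContinuousLinearEquiv.neg ℝ)

/-- Parity on `𝔖'(X)`: `φ₋(f) = φ(f₋)`. -/
def parityDist {N : ℕ} : 𝓢'(Phase N, ℂ) →L[ℂ] 𝓢'(Phase N, ℂ) :=
  PointwiseConvergenceCLM.precomp ℂ parity

end

end QuantumSchwartz

open QuantumSchwartz

namespace QuantumSchwartz

noncomputable section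

/-! ### Hermite functions on the line -/

/-! All four spaces are read in Hermite coordinates, where they become the same space of rapidly
decreasing multisequences, and every transform is assembled from a few elementary isomorphisms
there.

Two expansions carry the argument: `hermiteEquiv`, from Schwartz functions to their Hermite
coefficients, and `matrixEquiv`, from Schwartz operators to their matrices. Both rest on the same
pair of estimates. For decay of coefficients, the weight `∏ (α_i + 1)^r` is an eigenvalue on `|α⟩`
of a polynomial in the `Q_i` and `P_i` (`exists_pqAlg_idxWeight`). For functions, this polynomial is
moved to the other side of the inner product by `exists_formalAdjoint`. For operators, the seminorms
only involve `P^β Q^α`, so it is first normally ordered (`mem_normalSpan_of_mem_pqAlg`). For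
convergence of the expansions, the ladder relations make Schwartz seminorms and words in `Q`, `P`
grow at most polynomially along the Hermite functions (`hermiteBounded_seminorm`,
`HermiteBounded.mul_of_mem_pqAlg`). Since `∑ ∏ (α_i + 1)⁻²` converges, rapidly decreasing
coefficients then give absolutely convergent series in every seminorm. Injectivity is completeness
of the number basis, `eq_zero_of_inner_numberVec_eq_zero`.

Hermite functions are real, so `|α⟩⟨α'|` has kernel `h_α(q) h_α'(q')`. The kernel map is therefore
the matrix map followed by Hermite synthesis on the doubled space, and `isKernel_kernelEquiv` is an
exchange of sum and integral.

Hermite functions diagonalise the Fourier transform with eigenvalues `(± i)^|α|`. A partial Fourier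
transform thus multiplies coefficients by unimodular numbers, and its inverse carries the opposite
sign; no separate inversion theorem is needed. The symplectic Fourier transform is two partial
transforms with a swap of variables between them. The Weyl transform is `Tr[W(q,p) T] = ∫ e^{i p·u}
K(u - q/2, u + q/2) du`: kernel, linear change of variables, partial transform, scalar. The trace in
an arbitrary orthonormal basis comes from `hasSum_trace_of_hasSum`, and the weak inversion formula
from partial Fourier inversion and Fubini. The statements on distributions are transposes of these
isomorphisms. -/

theorem derivative_hermite_succ (n : ℕ) :
    Polynomial.derivative (Polynomial.hermite (n + 1)) =
      ((n : Polynomial ℤ) + 1) * Polynomial.hermite n := by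
  induction n with
  | zero => simp
  | succ n ih =>
    rw [Polynomial.hermite_succ (n + 1)]
    simp only [Polynomial.derivative_sub, Polynomial.derivative_mul, Polynomial.derivative_X, ih,
      one_mul, Polynomial.derivative_add, Polynomial.derivative_natCast, Polynomial.derivative_one]
    rw [Polynomial.hermite_succ n]
    push_cast
    ring

theorem hermiteFun_zero (t : ℝ) :
    hermiteFun 0 t = (Real.sqrt (Real.sqrt Real.pi))⁻¹ * Real.exp (-t ^ 2 / 2) := by
  simp [hermiteFun]

/-- Expressing the constant of level `n` through that of level `n + 1` gives both sides of a ladder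
relation a common factor, leaving a polynomial identity. -/
theorem inv_sqrt_factorial_succ (n : ℕ) :
    (Real.sqrt (n.factorial * Real.sqrt Real.pi))⁻¹ =
      Real.sqrt (n + 1) * (Real.sqrt ((n + 1).factorial * Real.sqrt Real.pi))⁻¹ := by
  have h : Real.sqrt ((n : ℝ) + 1) ≠ 0 := by positivity
  have e : (((n + 1).factorial : ℕ) : ℝ) * Real.sqrt Real.pi =
      ((n : ℝ) + 1) * (n.factorial * Real.sqrt Real.pi) := by
    rw [Nat.factorial_succ]; push_cast; ring
  rw [e, Real.sqrt_mul (by positivity) (n.factorial * Real.sqrt Real.pi), mul_inv, ← mul_assoc,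
    mul_inv_cancel₀ h, one_mul]

theorem hasDerivAt_hermiteFun_raw (n : ℕ) (t : ℝ) :
    HasDerivAt (hermiteFun n)
      ((Real.sqrt (n.factorial * Real.sqrt Real.pi))⁻¹ *
        (Real.sqrt 2 * Polynomial.aeval (Real.sqrt 2 * t)
          (Polynomial.derivative (Polynomial.hermite n)) -
          t * Polynomial.aeval (Real.sqrt 2 * t) (Polynomial.hermite n)) *
        Real.exp (-t ^ 2 / 2)) t := by
  have h1 : HasDerivAt (fun t : ℝ => Real.sqrt 2 * t) (Real.sqrt 2) t := by
    simpa using (hasDerivAt_id t).const_mul (Real.sqrt 2)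
  have h2 := ((Polynomial.hermite n).hasDerivAt_aeval (Real.sqrt 2 * t)).comp t h1
  have h3 : HasDerivAt (fun t : ℝ => Real.exp (-t ^ 2 / 2)) (Real.exp (-t ^ 2 / 2) * -t) t := by
    have h := ((hasDerivAt_pow 2 t).fun_neg.div_const 2).exp
    refine h.congr_deriv ?_
    push_cast
    ring
  have := (h2.const_mul (Real.sqrt (n.factorial * Real.sqrt Real.pi))⁻¹).mul h3
  refine this.congr_deriv ?_
  simp only [Function.comp_apply]
  ring

/-- This is the recursion `He_{n+1} = X He_n - He_n'` at `√2 t`. The derivative of the Gaussian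
supplies a second `t`, so the left side is `√2` times the recursion. -/
theorem hermiteFun_raise (n : ℕ) (t : ℝ) :
    t * hermiteFun n t - deriv (hermiteFun n) t =
      Real.sqrt 2 * (Real.sqrt (n + 1) * hermiteFun (n + 1) t) := by
  rw [(hasDerivAt_hermiteFun_raw n t).deriv]
  have h2 : Real.sqrt 2 ^ 2 = 2 := Real.sq_sqrt (by norm_num)
  simp only [hermiteFun, inv_sqrt_factorial_succ n, Polynomial.hermite_succ, map_sub, map_mul,
    Polynomial.aeval_X]
  linear_combination (-(t * Real.sqrt (n + 1) *
    (Real.sqrt ((n + 1).factorial * Real.sqrt Real.pi))⁻¹ *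
    Polynomial.aeval (Real.sqrt 2 * t) (Polynomial.hermite n) * Real.exp (-t ^ 2 / 2))) * h2

/-- The Gaussian term cancels `t h_n`, and `He_n' = n He_{n-1}` remains. At `n = 0` the truncated
index `n - 1` is harmless because its coefficient `√n` vanishes; the same convention is used for
every ladder relation below. -/
theorem hermiteFun_lower (n : ℕ) (t : ℝ) :
    t * hermiteFun n t + deriv (hermiteFun n) t =
      Real.sqrt 2 * (Real.sqrt n * hermiteFun (n - 1) t) := by
  rw [(hasDerivAt_hermiteFun_raw n t).deriv]
  cases n with
  | zero => simp [hermiteFun]; ring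
  | succ n =>
    have h2 : Real.sqrt ((n : ℝ) + 1) ^ 2 = n + 1 := Real.sq_sqrt (by positivity)
    simp only [hermiteFun, derivative_hermite_succ, inv_sqrt_factorial_succ n, Nat.add_sub_cancel]
    push_cast
    simp only [map_mul, map_add, map_natCast, map_one]
    linear_combination (-(1 : ℝ)) * (Real.sqrt 2 * (Real.sqrt ((n + 1).factorial * Real.sqrt Real.pi))⁻¹ *
      Polynomial.aeval (Real.sqrt 2 * t) (Polynomial.hermite n) * Real.exp (-t ^ 2 / 2)) * h2

theorem mul_hermiteFun (n : ℕ) (t : ℝ) :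
    t * hermiteFun n t =
      (Real.sqrt n * hermiteFun (n - 1) t + Real.sqrt (n + 1) * hermiteFun (n + 1) t) /
        Real.sqrt 2 := by
  have h2 : Real.sqrt 2 ^ 2 = 2 := Real.sq_sqrt (by norm_num)
  rw [eq_div_iff (by positivity)]
  linear_combination (Real.sqrt 2 / 2) * (hermiteFun_lower n t + hermiteFun_raise n t) +
    ((Real.sqrt n * hermiteFun (n - 1) t + Real.sqrt (n + 1) * hermiteFun (n + 1) t)) / 2 * h2

theorem hasDerivAt_hermiteFun (n : ℕ) (t : ℝ) :
    HasDerivAt (hermiteFun n)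
      ((Real.sqrt n * hermiteFun (n - 1) t - Real.sqrt (n + 1) * hermiteFun (n + 1) t) /
        Real.sqrt 2) t := by
  have h2 : Real.sqrt 2 ^ 2 = 2 := Real.sq_sqrt (by norm_num)
  refine ((hasDerivAt_hermiteFun_raw n t).differentiableAt.hasDerivAt).congr_deriv ?_
  rw [eq_div_iff (by positivity)]
  linear_combination (Real.sqrt 2 / 2) * (hermiteFun_lower n t - hermiteFun_raise n t) +
    ((Real.sqrt n * hermiteFun (n - 1) t - Real.sqrt (n + 1) * hermiteFun (n + 1) t)) / 2 * h2

/-! ### Orthonormality and pointwise bounds on the line. -/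

theorem integrable_hermiteFun_mul (m n : ℕ) :
    Integrable fun t => hermiteFun m t * hermiteFun n t :=
  (memLp_hermiteFun m).integrable_mul (memLp_hermiteFun n)

theorem integrable_hermiteFun_mul_deriv (m n : ℕ) :
    Integrable fun t => hermiteFun m t *
      ((Real.sqrt n * hermiteFun (n - 1) t - Real.sqrt (n + 1) * hermiteFun (n + 1) t) /
        Real.sqrt 2) := by
  refine ((((integrable_hermiteFun_mul m (n - 1)).const_mul (Real.sqrt n)).sub
    ((integrable_hermiteFun_mul m (n + 1)).const_mul (Real.sqrt (n + 1)))).div_const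
      (Real.sqrt 2)).congr (Filter.Eventually.of_forall fun t => ?_)
  simp only [Pi.sub_apply]
  ring

/-- Integration by parts: the annihilation operator, which sends `h_m` to `√m h_{m-1}`, is adjoint
to the creation operator, which sends `h_n` to `√(n+1) h_{n+1}`. -/
theorem integral_hermiteFun_ladder (m n : ℕ) :
    Real.sqrt m * ∫ t, hermiteFun (m - 1) t * hermiteFun n t =
      Real.sqrt (n + 1) * ∫ t, hermiteFun m t * hermiteFun (n + 1) t := by
  have h := integral_mul_deriv_eq_deriv_mul_of_integrable
    (u := hermiteFun m) (v := hermiteFun n)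
    (fun t _ => hasDerivAt_hermiteFun m t) (fun t _ => hasDerivAt_hermiteFun n t)
    (integrable_hermiteFun_mul_deriv m n)
    ((integrable_hermiteFun_mul_deriv n m).congr
      (Filter.Eventually.of_forall fun t => mul_comm _ _))
    (integrable_hermiteFun_mul m n)
  -- The product `t h_m h_n` can be expanded by the three-term relation in either factor. Comparing
  -- the two expressions writes `(h_m h_n)'` as `√2` times the difference of the two ladder
  -- integrands.
  have e : ∀ t, hermiteFun m t * ((Real.sqrt n * hermiteFun (n - 1) t -
        Real.sqrt (n + 1) * hermiteFun (n + 1) t) / Real.sqrt 2) =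
      Real.sqrt 2 * (Real.sqrt m * (hermiteFun (m - 1) t * hermiteFun n t) -
        Real.sqrt (n + 1) * (hermiteFun m t * hermiteFun (n + 1) t)) -
      (Real.sqrt m * hermiteFun (m - 1) t - Real.sqrt (m + 1) * hermiteFun (m + 1) t) /
        Real.sqrt 2 * hermiteFun n t := fun t => by
    have h2 : Real.sqrt 2 ^ 2 = 2 := Real.sq_sqrt (by norm_num)
    have h3 : Real.sqrt 2 ≠ 0 := by positivity
    have em := mul_hermiteFun m t
    have en := mul_hermiteFun n t
    field_simp at em en ⊢
    linear_combination hermiteFun n t * em - hermiteFun m t * en -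
      (Real.sqrt m * (hermiteFun (m - 1) t * hermiteFun n t) -
        Real.sqrt (n + 1) * (hermiteFun m t * hermiteFun (n + 1) t)) * h2
  have hI : Integrable fun t =>
      Real.sqrt 2 * (Real.sqrt m * (hermiteFun (m - 1) t * hermiteFun n t) -
        Real.sqrt (n + 1) * (hermiteFun m t * hermiteFun (n + 1) t)) :=
    (((integrable_hermiteFun_mul _ _).const_mul _).sub
      ((integrable_hermiteFun_mul _ _).const_mul _)).const_mul _
  simp only [e] at h
  rw [integral_sub hI ((integrable_hermiteFun_mul_deriv n m).congr
      (Filter.Eventually.of_forall fun t => mul_comm _ _)), sub_eq_neg_self,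
    integral_const_mul, mul_eq_zero, or_iff_right (by positivity),
    integral_sub ((integrable_hermiteFun_mul _ _).const_mul _)
      ((integrable_hermiteFun_mul _ _).const_mul _), integral_const_mul, integral_const_mul,
    sub_eq_zero] at h
  exact h

/-- The ladder identity moves down the diagonals of the Gram matrix. On the border it has a zero
coefficient on one side, and the corner entry is the Gaussian integral. -/
theorem integral_hermiteFun_mul (m n : ℕ) :
    ∫ t, hermiteFun m t * hermiteFun n t = if m = n then 1 else 0 := by
  induction m generalizing n with
  | zero =>
    cases n with
    | zero =>
      have h : ∀ t, hermiteFun 0 t * hermiteFun 0 t =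
          (Real.sqrt Real.pi)⁻¹ * Real.exp (-1 * t ^ 2) := fun t => by
        rw [hermiteFun_zero, mul_mul_mul_comm, ← mul_inv, Real.mul_self_sqrt (by positivity),
          ← Real.exp_add]
        ring_nf
      simp only [h, integral_const_mul, integral_gaussian, div_one, if_true]
      exact inv_mul_cancel₀ (by positivity)
    | succ n =>
      have h := integral_hermiteFun_ladder 0 n
      simp only [Nat.cast_zero, Real.sqrt_zero, zero_mul, zero_eq_mul] at h
      rw [h.resolve_left (by positivity), if_neg (by omega)]
  | succ m ih =>
    cases n with
    | zero =>
      have h := integral_hermiteFun_ladder 0 m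
      simp only [Nat.cast_zero, Real.sqrt_zero, zero_mul, zero_eq_mul] at h
      simp only [mul_comm (hermiteFun (m + 1) _)]
      rw [h.resolve_left (by positivity), if_neg (by omega)]
    | succ n =>
      have h := integral_hermiteFun_ladder (m + 1) n
      rw [Nat.add_sub_cancel, ih n] at h
      rcases eq_or_ne m n with rfl | hmn
      · push_cast at h
        rw [if_pos rfl] at h ⊢
        exact (mul_left_cancel₀ (by positivity) h).symm
      · rw [if_neg hmn, mul_zero, zero_eq_mul] at h
        rw [h.resolve_left (by positivity), if_neg (by omega)]

theorem integral_hermiteFun_sq (n : ℕ) : ∫ t, hermiteFun n t ^ 2 = 1 := by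
  simpa [sq] using integral_hermiteFun_mul n n

/-- By the fundamental theorem of calculus `h_n(t)²` is the integral of `2 h_n h_n'` up to `t`,
hence at most `‖h_n‖² + ‖h_n'‖²`. The bound is far from sharp, but only polynomial growth in `n`
matters. -/
theorem abs_hermiteFun_sq_le (n : ℕ) (t : ℝ) : hermiteFun n t ^ 2 ≤ 4 * ((n : ℝ) + 1) := by
  set d : ℝ → ℝ := fun t => (Real.sqrt n * hermiteFun (n - 1) t -
    Real.sqrt (n + 1) * hermiteFun (n + 1) t) / Real.sqrt 2 with hd
  have hi : ∀ k, Integrable fun t => hermiteFun k t ^ 2 := fun k => (memLp_hermiteFun k).integrable_sq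
  have hder : ∀ x ∈ Set.Iic t, HasDerivAt (fun t => hermiteFun n t ^ 2)
      (2 * (hermiteFun n x * d x)) x := fun x _ => by
    refine ((hasDerivAt_hermiteFun n x).pow 2).congr_deriv ?_
    simp [hd]
    ring
  have hint : Integrable fun x => 2 * (hermiteFun n x * d x) :=
    (integrable_hermiteFun_mul_deriv n n).const_mul 2
  have h := integral_Iic_of_hasDerivAt_of_tendsto' hder hint.integrableOn
    (tendsto_zero_of_hasDerivAt_of_integrableOn_Iic (a := t) hder hint.integrableOn
      (hi n).integrableOn)
  rw [sub_zero] at h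
  rw [← h]
  have hb : ∀ x, |2 * (hermiteFun n x * d x)| ≤ hermiteFun n x ^ 2 +
      (n * hermiteFun (n - 1) x ^ 2 + (n + 1) * hermiteFun (n + 1) x ^ 2) := fun x => by
    have e1 : Real.sqrt n ^ 2 = n := Real.sq_sqrt (by positivity)
    have e2 : Real.sqrt ((n : ℝ) + 1) ^ 2 = n + 1 := Real.sq_sqrt (by positivity)
    have e3 : Real.sqrt 2 ^ 2 = 2 := Real.sq_sqrt (by norm_num)
    have e4 : d x ^ 2 ≤ n * hermiteFun (n - 1) x ^ 2 + (n + 1) * hermiteFun (n + 1) x ^ 2 := by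
      have e5 : (n : ℝ) * hermiteFun (n - 1) x ^ 2 + (n + 1) * hermiteFun (n + 1) x ^ 2 =
          (Real.sqrt n * hermiteFun (n - 1) x) ^ 2 +
            (Real.sqrt (n + 1) * hermiteFun (n + 1) x) ^ 2 := by rw [mul_pow, mul_pow, e1, e2]
      rw [e5, hd]
      simp only [div_pow, e3]
      rw [div_le_iff₀ (by norm_num)]
      nlinarith [sq_nonneg (Real.sqrt n * hermiteFun (n - 1) x +
        Real.sqrt (n + 1) * hermiteFun (n + 1) x)]
    rw [abs_le]
    constructor <;> nlinarith [sq_nonneg (hermiteFun n x + d x), sq_nonneg (hermiteFun n x - d x)]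
  have hI' : Integrable fun x =>
      (n * hermiteFun (n - 1) x ^ 2 + (n + 1) * hermiteFun (n + 1) x ^ 2 : ℝ) :=
    ((hi _).const_mul _).add ((hi _).const_mul _)
  have hI : Integrable fun x => hermiteFun n x ^ 2 +
      (n * hermiteFun (n - 1) x ^ 2 + (n + 1) * hermiteFun (n + 1) x ^ 2) := (hi _).add hI'
  calc ∫ x in Set.Iic t, 2 * (hermiteFun n x * d x)
      ≤ ∫ x in Set.Iic t, |2 * (hermiteFun n x * d x)| :=
        setIntegral_mono hint.integrableOn hint.abs.integrableOn fun x => le_abs_self _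
    _ ≤ ∫ x, |2 * (hermiteFun n x * d x)| :=
        setIntegral_le_integral hint.abs (Filter.Eventually.of_forall fun x => abs_nonneg _)
    _ ≤ _ := integral_mono hint.abs hI hb
    _ = 1 + (n * 1 + (n + 1) * 1) := by
        rw [integral_add (hi _) hI',
          integral_add ((hi _).const_mul _) ((hi _).const_mul _), integral_const_mul,
          integral_const_mul]
        simp only [integral_hermiteFun_sq]
    _ ≤ _ := by linarith [(Nat.cast_nonneg n : (0 : ℝ) ≤ n)]

theorem abs_hermiteFun_le (n : ℕ) (t : ℝ) : |hermiteFun n t| ≤ 2 * ((n : ℝ) + 1) := by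
  refine abs_le_of_sq_le_sq ?_ (by positivity)
  have := abs_hermiteFun_sq_le n t
  nlinarith [(Nat.cast_nonneg n : (0 : ℝ) ≤ n)]

theorem integrable_hermiteFun (n : ℕ) : Integrable (hermiteFun n) := by
  have key : ∀ p : Polynomial ℝ, Integrable fun t : ℝ => p.eval t * Real.exp (-(1 / 2) * t ^ 2) := by
    intro p
    induction p using Polynomial.induction_on' with
    | add p q hp hq =>
      refine (hp.add hq).congr (Filter.Eventually.of_forall fun t => ?_)
      simp only [Pi.add_apply, Polynomial.eval_add, add_mul]
    | monomial k a =>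
      have h := integrable_rpow_mul_exp_neg_mul_sq (b := 1 / 2) (by norm_num) (s := (k : ℝ))
        (lt_of_lt_of_le (by norm_num) (Nat.cast_nonneg k))
      simpa only [Polynomial.eval_monomial, Real.rpow_natCast, mul_assoc] using h.const_mul a
  refine ((key (((Polynomial.hermite n).map (Int.castRingHom ℝ)).comp
    (Polynomial.C (Real.sqrt 2) * Polynomial.X))).const_mul
      (Real.sqrt (n.factorial * Real.sqrt Real.pi))⁻¹).congr
        (Filter.Eventually.of_forall fun t => ?_)
  have e : -(1 / 2) * t ^ 2 = -t ^ 2 / 2 := by ring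
  simp only [hermiteFun, e, Polynomial.eval_comp, Polynomial.eval_mul,
    Polynomial.eval_C, Polynomial.eval_X, Polynomial.eval_map, Polynomial.aeval_def,
    algebraMap_int_eq]
  ring

/-! ### Hermite functions as eigenfunctions of the Fourier transform. -/

/-- The Fourier integral of a Hermite function, with the sign `s` in the exponent. -/
def hermiteFourier (s : ℝ) (n : ℕ) (p : ℝ) : ℂ :=
  ∫ u : ℝ, Complex.exp (Complex.I * (s * p : ℝ) * u) * (hermiteFun n u : ℂ)

theorem integrable_exp_mul_hermiteFun (c : ℝ) (n : ℕ) :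
    Integrable fun u : ℝ => Complex.exp (Complex.I * (c : ℂ) * u) * (hermiteFun n u : ℂ) := by
  refine (integrable_hermiteFun n).ofReal.bdd_mul (c := 1) (by fun_prop)
    (Filter.Eventually.of_forall fun u => ?_)
  simp [Complex.norm_exp]

/-- Integrate `e^{ispu} h_n'(u)` by parts: the derivative of `h_n` is a ladder combination, that of
the exponential is a factor `isp`. The result is a three-term recursion in `n`. -/
theorem hermiteFourier_step (s : ℝ) (n : ℕ) (p : ℝ) :
    (Real.sqrt (n + 1) : ℂ) * hermiteFourier s (n + 1) p =
      Real.sqrt n * hermiteFourier s (n - 1) p +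
        Complex.I * Real.sqrt 2 * (s * p : ℝ) * hermiteFourier s n p := by
  have hu : ∀ u : ℝ, HasDerivAt (fun u : ℝ => Complex.exp (Complex.I * (s * p : ℝ) * u))
      (Complex.I * (s * p : ℝ) * Complex.exp (Complex.I * (s * p : ℝ) * u)) u := fun u => by
    have h := ((Complex.ofRealCLM.hasDerivAt (x := u)).const_mul (Complex.I * (s * p : ℝ))).cexp
    refine h.congr_deriv ?_
    simp [mul_comm]
  have hi : ∀ k, Integrable fun u : ℝ =>
      Complex.exp (Complex.I * (s * p : ℝ) * u) * (hermiteFun k u : ℂ) :=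
    integrable_exp_mul_hermiteFun (s * p)
  have e1 : ∀ u : ℝ, Complex.exp (Complex.I * (s * p : ℝ) * u) *
      (((Real.sqrt n * hermiteFun (n - 1) u - Real.sqrt (n + 1) * hermiteFun (n + 1) u) /
        Real.sqrt 2 : ℝ) : ℂ) =
      (Real.sqrt 2 : ℂ)⁻¹ * (Real.sqrt n * (Complex.exp (Complex.I * (s * p : ℝ) * u) *
          (hermiteFun (n - 1) u : ℂ)) -
        Real.sqrt (n + 1) * (Complex.exp (Complex.I * (s * p : ℝ) * u) *
          (hermiteFun (n + 1) u : ℂ))) := fun u => by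
    push_cast
    ring
  have hiv : Integrable fun u : ℝ => (Real.sqrt 2 : ℂ)⁻¹ *
      (Real.sqrt n * (Complex.exp (Complex.I * (s * p : ℝ) * u) * (hermiteFun (n - 1) u : ℂ)) -
        Real.sqrt (n + 1) * (Complex.exp (Complex.I * (s * p : ℝ) * u) *
          (hermiteFun (n + 1) u : ℂ))) :=
    (((hi _).const_mul _).sub ((hi _).const_mul _)).const_mul _
  have h := integral_mul_deriv_eq_deriv_mul_of_integrable
    (fun u _ => hu u) (fun u _ => (hasDerivAt_hermiteFun n u).ofReal_comp)
    (hiv.congr (Filter.Eventually.of_forall fun u => (e1 u).symm))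
    (((hi n).const_mul (Complex.I * (s * p : ℝ))).congr
      (Filter.Eventually.of_forall fun u => (mul_assoc _ _ _).symm)) (hi n)
  simp only [e1, integral_const_mul, mul_assoc (Complex.I * ((s * p : ℝ) : ℂ))] at h
  rw [integral_sub ((hi _).const_mul _) ((hi _).const_mul _), integral_const_mul,
    integral_const_mul] at h
  have h2 : (Real.sqrt 2 : ℂ) ≠ 0 := by
    rw [Complex.ofReal_ne_zero]; positivity
  rw [inv_mul_eq_iff_eq_mul₀ h2] at h
  simp only [hermiteFourier]
  linear_combination -h

/-- Up to the powers of `s i`, the Hermite functions obey the same three-term recursion as their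
transforms, and both start from the Gaussian. -/
theorem hermiteFourier_eq {s : ℝ} (hs : s ^ 2 = 1) (n : ℕ) (p : ℝ) :
    hermiteFourier s n p = Real.sqrt (2 * Real.pi) * (s * Complex.I) ^ n * hermiteFun n p := by
  have hsC : (s : ℂ) ^ 2 = 1 := by exact_mod_cast hs
  have h0 : hermiteFourier s 0 p =
      Real.sqrt (2 * Real.pi) * (s * Complex.I) ^ 0 * hermiteFun 0 p := by
    have h := fourierIntegral_gaussian (b := 1 / 2) (by norm_num) ((s * p : ℝ) : ℂ)
    have e : ∀ u : ℝ, Complex.exp (Complex.I * (s * p : ℝ) * u) * (hermiteFun 0 u : ℂ) =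
        ((Real.sqrt (Real.sqrt Real.pi))⁻¹ : ℝ) * (Complex.exp (Complex.I * (s * p : ℝ) * u) *
          Complex.exp (-(1 / 2) * u ^ 2)) := fun u => by
      rw [hermiteFun_zero]
      push_cast
      rw [show (-(u : ℂ) ^ 2 / 2) = -(1 / 2) * (u : ℂ) ^ 2 by ring]
      ring
    simp only [hermiteFourier, e]
    rw [integral_const_mul, h, hermiteFun_zero, Real.sqrt_eq_rpow (2 * Real.pi),
      Complex.ofReal_cpow (by positivity)]
    have e2 : -((s * p : ℝ) : ℂ) ^ 2 / (4 * (1 / 2)) = -(p : ℂ) ^ 2 / 2 := by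
      push_cast
      rw [mul_pow, hsC]
      ring
    rw [e2]
    push_cast
    rw [show (Real.pi : ℂ) / (1 / 2) = 2 * Real.pi by ring]
    ring
  induction n using Nat.strong_induction_on with
  | _ n ih =>
    cases n with
    | zero => exact h0
    | succ n =>
      have h1 : (Real.sqrt ((n : ℝ) + 1) : ℂ) ≠ 0 := by
        rw [Complex.ofReal_ne_zero]; positivity
      have h2 : (Real.sqrt 2 : ℂ) ≠ 0 := by
        rw [Complex.ofReal_ne_zero]; positivity
      rw [← mul_right_inj' h1, hermiteFourier_step, ih n (by omega)]
      have hm : (p : ℂ) * hermiteFun n p * Real.sqrt 2 = (Real.sqrt n * hermiteFun (n - 1) p +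
          Real.sqrt (n + 1) * hermiteFun (n + 1) p) := by
        have := mul_hermiteFun n p
        rw [eq_div_iff (by positivity)] at this
        exact_mod_cast congrArg (fun r : ℝ => (r : ℂ)) this
      -- The index `n - 1` lies two levels below `n + 1`, so the sign is `(s i)² = -1`.
      have h3 : Real.sqrt n * hermiteFourier s (n - 1) p =
          - (Real.sqrt n * (Real.sqrt (2 * Real.pi) * (s * Complex.I) ^ (n + 1) *
            hermiteFun (n - 1) p)) := by
        cases n with
        | zero => simp
        | succ n =>
          rw [Nat.add_sub_cancel, ih n (by omega), pow_succ _ (n + 1), pow_succ _ n]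
          linear_combination (-(Real.sqrt ((n + 1 : ℕ) : ℝ) * (Real.sqrt (2 * Real.pi) *
            (s * Complex.I) ^ n * hermiteFun n p))) * hsC + (Real.sqrt ((n + 1 : ℕ) : ℝ) *
            (Real.sqrt (2 * Real.pi) * (s * Complex.I) ^ n * hermiteFun n p)) * s ^ 2 * Complex.I_sq
      rw [h3, pow_succ]
      push_cast
      linear_combination (Complex.I * s * Real.sqrt (2 * Real.pi) * (s * Complex.I) ^ n) * hm

end

end QuantumSchwartz

namespace QuantumSchwartz

noncomputable section

/-! ### Hermite functions as Schwartz functions -/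

/-- The power is absorbed in `M! e^{1+r}`, and `1 + r - r²/2` has its maximum `3/2` at `r = 1`. -/
theorem one_add_pow_mul_exp_neg_sq_le (M : ℕ) {r : ℝ} (hr : 0 ≤ r) :
    (1 + r) ^ M * Real.exp (-(r ^ 2 / 2)) ≤ M.factorial * Real.exp (3 / 2) := by
  have h1 : (1 + r) ^ M ≤ M.factorial * Real.exp (1 + r) := by
    have := Real.pow_div_factorial_le_exp (1 + r) (by positivity) M
    rwa [div_le_iff₀' (by positivity)] at this
  calc (1 + r) ^ M * Real.exp (-(r ^ 2 / 2))
      ≤ M.factorial * Real.exp (1 + r) * Real.exp (-(r ^ 2 / 2)) := by gcongr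
    _ = M.factorial * Real.exp (1 + r + -(r ^ 2 / 2)) := by rw [mul_assoc, ← Real.exp_add]
    _ ≤ M.factorial * Real.exp (3 / 2) := by
        gcongr
        nlinarith [sq_nonneg (r - 1)]

/-- The Gaussian `x ↦ exp (-‖x‖² / 2)` as a real valued Schwartz function. -/
def gaussianSchwartz (E : Type*) [NormedAddCommGroup E] [InnerProductSpace ℝ E] : 𝓢(E, ℝ) where
  toFun x := Real.exp (-(‖x‖ ^ 2 / 2))
  smooth' := ((contDiff_norm_sq ℝ).div_const 2).neg.exp
  decay' a n := by
    have hφ : (fun x : E => ‖x‖ ^ 2 / 2).HasTemperateGrowth := by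
      simp only [div_eq_mul_inv]
      exact (Function.hasTemperateGrowth_norm_sq E).mul (.const _)
    obtain ⟨k, C, hC, h⟩ := hφ.norm_iteratedFDeriv_le_uniform n
    refine ⟨(n.factorial * (1 + C) ^ n) * ((a + k * n).factorial * Real.exp (3 / 2)), fun x => ?_⟩
    have hg : ContDiff ℝ n fun t : ℝ => Real.exp (-1 * t) := by fun_prop
    have hf : ContDiff ℝ n fun x : E => ‖x‖ ^ 2 / 2 := (contDiff_norm_sq ℝ).div_const 2
    -- Every derivative of `t ↦ e^{-t}` has modulus `e^{-t}`, so the composition bound reproduces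
    -- the Gaussian. Using `1 + C` rather than `C` makes the base at least one, so that it is
    -- bounded by its positive powers.
    have key := norm_iteratedFDeriv_comp_le hg hf le_rfl x
      (C := Real.exp (-(‖x‖ ^ 2 / 2))) (D := (1 + C) * (1 + ‖x‖) ^ k) (fun i _ => by
        rw [norm_iteratedFDeriv_eq_norm_iteratedDeriv, iteratedDeriv_exp_const_mul]
        simp) (fun i hi hin => by
        have h1 : (1 : ℝ) ≤ (1 + ‖x‖) ^ k := one_le_pow₀ (by linarith [norm_nonneg x])
        have h2 : C * (1 + ‖x‖) ^ k ≤ (1 + C) * (1 + ‖x‖) ^ k := by gcongr; linarith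
        refine ((h i hin x).trans h2).trans (le_self_pow₀ ?_ (by omega))
        nlinarith)
    have e : ((fun t : ℝ => Real.exp (-1 * t)) ∘ fun x : E => ‖x‖ ^ 2 / 2) =
        fun x : E => Real.exp (-(‖x‖ ^ 2 / 2)) := by
      funext x; simp
    rw [e] at key
    calc ‖x‖ ^ a * ‖iteratedFDeriv ℝ n (fun x : E => Real.exp (-(‖x‖ ^ 2 / 2))) x‖
        ≤ (1 + ‖x‖) ^ a *
          (n.factorial * Real.exp (-(‖x‖ ^ 2 / 2)) * ((1 + C) * (1 + ‖x‖) ^ k) ^ n) := by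
          gcongr
          linarith
      _ = (n.factorial * (1 + C) ^ n) *
          ((1 + ‖x‖) ^ (a + k * n) * Real.exp (-(‖x‖ ^ 2 / 2))) := by
          rw [mul_pow, ← pow_mul, pow_add]; ring
      _ ≤ _ := mul_le_mul_of_nonneg_left (one_add_pow_mul_exp_neg_sq_le _ (norm_nonneg x))
          (by positivity)

theorem gaussianSchwartz_apply {E : Type*} [NormedAddCommGroup E] [InnerProductSpace ℝ E] (x : E) :
    gaussianSchwartz E x = Real.exp (-(‖x‖ ^ 2 / 2)) := rfl

theorem hasTemperateGrowth_aeval {E : Type*} [NormedAddCommGroup E] [NormedSpace ℝ E]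
    {f : E → ℝ} (hf : f.HasTemperateGrowth) (p : Polynomial ℤ) :
    (fun x => Polynomial.aeval (f x) p).HasTemperateGrowth := by
  induction p using Polynomial.induction_on' with
  | add p q hp hq =>
    simp only [map_add]
    exact hp.add hq
  | monomial k a =>
    simp only [Polynomial.aeval_monomial]
    exact (Function.HasTemperateGrowth.const _).mul (hf.pow k)

theorem hasTemperateGrowth_prod {ι E : Type*} [NormedAddCommGroup E] [NormedSpace ℝ E]
    (s : Finset ι) {f : ι → E → ℝ} (hf : ∀ i, (f i).HasTemperateGrowth) :
    (fun x => ∏ i ∈ s, f i x).HasTemperateGrowth := by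
  classical
  induction s using Finset.induction_on with
  | empty => simp
  | insert i s hi ih =>
    simp only [Finset.prod_insert hi]
    exact (hf i).mul ih

variable {n : ℕ}

theorem hasTemperateGrowth_coord (i : Fin n) :
    (fun q : Config n => q i).HasTemperateGrowth :=
  (EuclideanSpace.proj i : Config n →L[ℝ] ℝ).hasTemperateGrowth

/-- The polynomial factor of the Hermite function `|α⟩`. -/
def hermitePoly (α : Fin n → ℕ) (q : Config n) : ℝ :=
  ∏ i, ((Real.sqrt ((α i).factorial * Real.sqrt Real.pi))⁻¹ *
    Polynomial.aeval (Real.sqrt 2 * q i) (Polynomial.hermite (α i)))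

theorem hasTemperateGrowth_hermitePoly (α : Fin n → ℕ) : (hermitePoly α).HasTemperateGrowth :=
  hasTemperateGrowth_prod _ fun i => (Function.HasTemperateGrowth.const _).mul
    (hasTemperateGrowth_aeval ((Function.HasTemperateGrowth.const _).mul
      (hasTemperateGrowth_coord i)) _)

theorem prod_exp_neg_sq (q : Config n) :
    ∏ i, Real.exp (-(q i) ^ 2 / 2) = Real.exp (-(‖q‖ ^ 2 / 2)) := by
  rw [← Real.exp_sum, EuclideanSpace.real_norm_sq_eq]
  congr 1
  rw [Finset.sum_div, ← Finset.sum_neg_distrib]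
  exact Finset.sum_congr rfl fun i _ => by ring

/-- The Hermite function `|α⟩` as a Schwartz function. -/
def numberSchwartz (α : Fin n → ℕ) : 𝓢(Config n, ℂ) :=
  postcompCLM (𝕜 := ℝ) Complex.ofRealCLM (smulLeftCLM ℝ (hermitePoly α) (gaussianSchwartz (Config n)))

theorem numberSchwartz_apply_eq_ofReal (α : Fin n → ℕ) (q : Config n) :
    numberSchwartz α q = ((∏ i, hermiteFun (α i) (q i) : ℝ) : ℂ) := by
  rw [numberSchwartz, postcompCLM_apply,
    smulLeftCLM_apply_apply (hasTemperateGrowth_hermitePoly α), gaussianSchwartz_apply,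
    ← prod_exp_neg_sq, hermitePoly, smul_eq_mul, ← Finset.prod_mul_distrib]
  rfl

theorem numberSchwartz_apply (α : Fin n → ℕ) (q : Config n) :
    numberSchwartz α q = numberFun α q := by
  rw [numberSchwartz_apply_eq_ofReal, numberFun, Complex.ofReal_prod]

theorem conj_numberFun (α : Fin n → ℕ) (q : Config n) :
    (starRingEnd ℂ) (numberFun α q) = numberFun α q := by
  simp [numberFun]

theorem toHilb_numberSchwartz (α : Fin n → ℕ) : toHilb (numberSchwartz α) = numberVec α := by
  rw [numberVec, toHilb, SchwartzMap.toLp, MemLp.toLp_eq_toLp_iff]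
  exact Filter.Eventually.of_forall fun q => numberSchwartz_apply α q

/-! ### Orthonormality and ladder relations in several variables. -/

theorem integral_config_prod (f : Fin n → ℝ → ℂ) :
    ∫ q : Config n, ∏ i, f i (q i) = ∏ i, ∫ t, f i t := by
  rw [← integral_fintype_prod_volume_eq_prod,
    ← (EuclideanSpace.volume_preserving_symm_measurableEquiv_toLp (Fin n)).integral_comp
      (MeasurableEquiv.measurableEmbedding _)]
  rfl

theorem inner_numberVec (α β : Fin n → ℕ) :
    ⟪numberVec α, numberVec β⟫_ℂ = if α = β then 1 else 0 := by
  rw [← toHilb_numberSchwartz, ← toHilb_numberSchwartz]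
  refine (SchwartzMap.inner_toL2_toL2_eq _ _ volume).trans ?_
  have h : ∀ q : Config n, ⟪numberSchwartz α q, numberSchwartz β q⟫_ℂ =
      ∏ i, ((hermiteFun (α i) (q i) * hermiteFun (β i) (q i) : ℝ) : ℂ) := fun q => by
    rw [RCLike.inner_apply, numberSchwartz_apply, numberSchwartz_apply, conj_numberFun, mul_comm,
      numberFun, numberFun, ← Finset.prod_mul_distrib]
    exact Finset.prod_congr rfl fun i _ => (Complex.ofReal_mul _ _).symm
  simp only [h]
  rw [integral_config_prod fun i t => ((hermiteFun (α i) t * hermiteFun (β i) t : ℝ) : ℂ)]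
  simp only [integral_complex_ofReal, integral_hermiteFun_mul, funext_iff]
  split_ifs with h'
  · simp [h']
  · push Not at h'
    obtain ⟨i, hi⟩ := h'
    exact Finset.prod_eq_zero (Finset.mem_univ i) (by simp [hi])

theorem orthonormal_numberVec : Orthonormal ℂ (numberVec : (Fin n → ℕ) → Hilb n) :=
  orthonormal_iff_ite.2 inner_numberVec

theorem norm_numberVec (α : Fin n → ℕ) : ‖numberVec α‖ = 1 := orthonormal_numberVec.1 α

/-- The product of the one-dimensional Hermite functions over the coordinates other than `i`. -/
def numberRest (α : Fin n → ℕ) (i : Fin n) (q : Config n) : ℂ :=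
  ∏ j ∈ Finset.univ.erase i, ((hermiteFun (α j) (q j) : ℝ) : ℂ)

theorem numberFun_update (α : Fin n → ℕ) (i : Fin n) (k : ℕ) (q : Config n) :
    numberFun (Function.update α i k) q = hermiteFun k (q i) * numberRest α i q := by
  rw [numberFun, ← Finset.mul_prod_erase _ _ (Finset.mem_univ i), Function.update_self,
    numberRest]
  congr 1
  exact Finset.prod_congr rfl fun j hj => by rw [Function.update_of_ne (Finset.ne_of_mem_erase hj)]

theorem numberFun_eq_mul_rest (α : Fin n → ℕ) (i : Fin n) (q : Config n) :
    numberFun α q = hermiteFun (α i) (q i) * numberRest α i q := by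
  rw [← numberFun_update, Function.update_eq_self]

/-- Lowering the `i`-th entry of a multi-index by one. -/
def lowerIdx (i : Fin n) (α : Fin n → ℕ) : Fin n → ℕ := Function.update α i (α i - 1)

/-- Raising the `i`-th entry of a multi-index by one. -/
def raiseIdx (i : Fin n) (α : Fin n → ℕ) : Fin n → ℕ := Function.update α i (α i + 1)

/-- The one-dimensional relation in coordinate `i`; the other factors are inert. When `α i = 0`,
`lowerIdx i α` is `α` itself, but with coefficient zero. -/
theorem posOp_numberSchwartz (i : Fin n) (α : Fin n → ℕ) :
    posOp i (numberSchwartz α) = (((Real.sqrt 2)⁻¹ * Real.sqrt (α i) : ℝ) : ℂ) • numberSchwartz (lowerIdx i α) +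
      (((Real.sqrt 2)⁻¹ * Real.sqrt (α i + 1) : ℝ) : ℂ) • numberSchwartz (raiseIdx i α) := by
  ext q
  have h := congrArg (fun r : ℝ => (r : ℂ)) (mul_hermiteFun (α i) (q i))
  push_cast at h
  simp only [posOp_apply, add_apply, smul_apply, smul_eq_mul, numberSchwartz_apply, lowerIdx,
    raiseIdx, numberFun_update, numberFun_eq_mul_rest α i]
  push_cast
  linear_combination numberRest α i q * h

theorem lineDeriv_numberSchwartz (i : Fin n) (α : Fin n → ℕ) :
    ∂_{(EuclideanSpace.single i (1 : ℝ) : Config n)} (numberSchwartz α) =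
      (((Real.sqrt 2)⁻¹ * Real.sqrt (α i) : ℝ) : ℂ) • numberSchwartz (lowerIdx i α) -
      (((Real.sqrt 2)⁻¹ * Real.sqrt (α i + 1) : ℝ) : ℂ) • numberSchwartz (raiseIdx i α) := by
  ext q
  rw [lineDerivOp_apply]
  have hcoord : ∀ t : ℝ, (q + t • (EuclideanSpace.single i (1 : ℝ) : Config n)) i = q i + t :=
    fun t => by simp
  have hrest : ∀ t : ℝ, numberRest α i (q + t • (EuclideanSpace.single i (1 : ℝ) : Config n)) =
      numberRest α i q := fun t => Finset.prod_congr rfl fun j hj => by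
    simp [Finset.ne_of_mem_erase hj]
  have h1 : HasDerivAt (fun t : ℝ => hermiteFun (α i) (q i + t))
      ((Real.sqrt (α i) * hermiteFun (α i - 1) (q i) -
        Real.sqrt (α i + 1) * hermiteFun (α i + 1) (q i)) / Real.sqrt 2) 0 := by
    have h := hasDerivAt_hermiteFun (α i) (q i + 0)
    simpa using h.comp_const_add (q i) 0
  have h2 : HasLineDerivAt ℝ (numberSchwartz α)
      (((Real.sqrt (α i) * hermiteFun (α i - 1) (q i) -
        Real.sqrt (α i + 1) * hermiteFun (α i + 1) (q i)) / Real.sqrt 2 : ℝ) * numberRest α i q) q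
      (EuclideanSpace.single i (1 : ℝ) : Config n) := by
    have h := h1.ofReal_comp.mul_const (numberRest α i q)
    unfold HasLineDerivAt
    refine h.congr_of_eventuallyEq (Filter.Eventually.of_forall fun t => ?_)
    simp only [numberSchwartz_apply, numberFun_eq_mul_rest α i, hcoord, hrest]
  rw [h2.lineDeriv]
  simp only [sub_apply, smul_apply, smul_eq_mul, numberSchwartz_apply, lowerIdx,
    raiseIdx, numberFun_update]
  push_cast
  ring

/-! ### Polynomial bounds -/

/-- The weight `∏ i, (α_i + 1)` of a multi-index. -/
def idxWeight (α : Fin n → ℕ) : ℝ := ∏ i, ((α i : ℝ) + 1)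

theorem one_le_idxWeight (α : Fin n → ℕ) : 1 ≤ idxWeight α :=
  Finset.one_le_prod fun i _ => by linarith [(Nat.cast_nonneg (α i) : (0 : ℝ) ≤ α i)]

theorem idxWeight_pos (α : Fin n → ℕ) : 0 < idxWeight α := one_pos.trans_le (one_le_idxWeight α)

theorem idxWeight_update (α : Fin n → ℕ) (i : Fin n) (k : ℕ) :
    idxWeight (Function.update α i k) =
      ((k : ℝ) + 1) * ∏ j ∈ Finset.univ.erase i, ((α j : ℝ) + 1) := by
  rw [idxWeight, ← Finset.mul_prod_erase _ _ (Finset.mem_univ i), Function.update_self]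
  congr 1
  exact Finset.prod_congr rfl fun j hj => by rw [Function.update_of_ne (Finset.ne_of_mem_erase hj)]

theorem idxWeight_update_le (α : Fin n → ℕ) (i : Fin n) {k : ℕ} (hk : k ≤ α i + 1) :
    idxWeight (Function.update α i k) ≤ 2 * idxWeight α := by
  have h := idxWeight_update α i (α i)
  rw [Function.update_eq_self] at h
  have h0 : 0 ≤ ∏ j ∈ Finset.univ.erase i, ((α j : ℝ) + 1) := by positivity
  rw [h, idxWeight_update, ← mul_assoc]
  have : (k : ℝ) ≤ α i + 1 := by exact_mod_cast hk
  gcongr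
  linarith [(Nat.cast_nonneg (α i) : (0 : ℝ) ≤ α i)]

theorem idxWeight_lower_le (i : Fin n) (α : Fin n → ℕ) :
    idxWeight (lowerIdx i α) ≤ 2 * idxWeight α := idxWeight_update_le α i (by omega)

theorem idxWeight_raise_le (i : Fin n) (α : Fin n → ℕ) :
    idxWeight (raiseIdx i α) ≤ 2 * idxWeight α := idxWeight_update_le α i le_rfl

theorem coord_le_idxWeight (i : Fin n) (α : Fin n → ℕ) : (α i : ℝ) + 1 ≤ idxWeight α := by
  rw [idxWeight, ← Finset.mul_prod_erase _ _ (Finset.mem_univ i)]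
  refine le_mul_of_one_le_right (by positivity) (Finset.one_le_prod fun j _ => ?_)
  linarith [(Nat.cast_nonneg (α j) : (0 : ℝ) ≤ α j)]

theorem inv_sqrt_two_mul_sqrt_le (i : Fin n) (α : Fin n → ℕ) {x : ℝ} (hx : x ≤ α i + 1) :
    ‖(((Real.sqrt 2)⁻¹ * Real.sqrt x : ℝ) : ℂ)‖ ≤ idxWeight α := by
  have h1 : (Real.sqrt 2)⁻¹ ≤ 1 := inv_le_one_of_one_le₀ (Real.one_le_sqrt.2 (by norm_num))
  have h2 : Real.sqrt x ≤ α i + 1 := by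
    refine (Real.sqrt_le_sqrt hx).trans ((Real.sqrt_le_iff).2 ⟨by positivity, ?_⟩)
    nlinarith [(Nat.cast_nonneg (α i) : (0 : ℝ) ≤ α i)]
  rw [Complex.norm_real, Real.norm_of_nonneg (by positivity)]
  calc _ ≤ 1 * ((α i : ℝ) + 1) := by gcongr
    _ ≤ _ := by rw [one_mul]; exact coord_le_idxWeight i α

/-- A seminorm is polynomially bounded along the Hermite functions. -/
def HermiteBounded (p : Seminorm ℂ 𝓢(Config n, ℂ)) (A : 𝓢(Config n, ℂ) →L[ℂ] 𝓢(Config n, ℂ)) : Prop :=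
  ∃ C : ℝ, 0 ≤ C ∧ ∃ r : ℕ, ∀ α, p (A (numberSchwartz α)) ≤ C * idxWeight α ^ r

/-- A ladder step costs one factor of the weight, from the square roots, and a factor `2 ^ r`, from
the shifted index. The new operator stands on the right, so it acts on the Hermite function itself.
The constants `ε` and `c` let one lemma serve `Q_i`, `∂_i` and `P_i`. -/
theorem HermiteBounded.of_ladder {p : Seminorm ℂ 𝓢(Config n, ℂ)}
    {B A : 𝓢(Config n, ℂ) →L[ℂ] 𝓢(Config n, ℂ)} (hB : HermiteBounded p B) (i : Fin n)
    (ε : ℂ) (hε : ‖ε‖ ≤ 1) (c : ℂ) (hc : ‖c‖ ≤ 1)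
    (hA : ∀ α, A (numberSchwartz α) = c •
      ((((Real.sqrt 2)⁻¹ * Real.sqrt (α i) : ℝ) : ℂ) • numberSchwartz (lowerIdx i α) +
      ε • (((Real.sqrt 2)⁻¹ * Real.sqrt (α i + 1) : ℝ) : ℂ) • numberSchwartz (raiseIdx i α))) :
    HermiteBounded p (B * A) := by
  obtain ⟨C, hC, r, h⟩ := hB
  refine ⟨2 * (C * 2 ^ r), by positivity, r + 1, fun α => ?_⟩
  have hw := idxWeight_pos α
  have b1 : p (B ((((Real.sqrt 2)⁻¹ * Real.sqrt (α i) : ℝ) : ℂ) • numberSchwartz (lowerIdx i α))) ≤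
      idxWeight α * (C * (2 * idxWeight α) ^ r) := by
    rw [map_smul, map_smul_eq_mul]
    refine mul_le_mul (inv_sqrt_two_mul_sqrt_le i α (by linarith)) ((h _).trans ?_)
      (apply_nonneg _ _) hw.le
    have := idxWeight_pos (lowerIdx i α)
    gcongr
    exact idxWeight_lower_le i α
  have b2 : p (B (ε • (((Real.sqrt 2)⁻¹ * Real.sqrt (α i + 1) : ℝ) : ℂ) • numberSchwartz (raiseIdx i α))) ≤
      idxWeight α * (C * (2 * idxWeight α) ^ r) := by
    rw [map_smul B, map_smul B, map_smul_eq_mul, map_smul_eq_mul]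
    refine (mul_le_of_le_one_left (by positivity) hε).trans
      (mul_le_mul ?_ ((h _).trans ?_) (apply_nonneg _ _) hw.le)
    · exact_mod_cast inv_sqrt_two_mul_sqrt_le i α (le_refl ((α i : ℝ) + 1))
    · have := idxWeight_pos (raiseIdx i α)
      gcongr
      exact idxWeight_raise_le i α
  rw [mul_apply_eq_comp, hA, map_smul, map_smul_eq_mul, map_add]
  calc _ ≤ _ := mul_le_of_le_one_left (apply_nonneg _ _) hc
    _ ≤ _ := map_add_le_add p _ _
    _ ≤ _ := add_le_add b1 b2
    _ = _ := by ring

theorem HermiteBounded.mul_posOp {p : Seminorm ℂ 𝓢(Config n, ℂ)}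
    {B : 𝓢(Config n, ℂ) →L[ℂ] 𝓢(Config n, ℂ)} (hB : HermiteBounded p B) (i : Fin n) :
    HermiteBounded p (B * posOp i) :=
  hB.of_ladder i 1 (by simp) 1 (by simp) fun α => by
    rw [posOp_numberSchwartz, one_smul, one_smul]

theorem HermiteBounded.mul_lineDeriv {p : Seminorm ℂ 𝓢(Config n, ℂ)}
    {B : 𝓢(Config n, ℂ) →L[ℂ] 𝓢(Config n, ℂ)} (hB : HermiteBounded p B) (i : Fin n) :
    HermiteBounded p (B * LineDeriv.lineDerivOpCLM ℂ 𝓢(Config n, ℂ)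
      (EuclideanSpace.single i (1 : ℝ) : Config n)) :=
  hB.of_ladder i (-1) (by simp) 1 (by simp) fun α => by
    rw [LineDeriv.lineDerivOpCLM_apply, lineDeriv_numberSchwartz, one_smul, neg_one_smul,
      sub_eq_add_neg]

theorem HermiteBounded.mul_momOp {p : Seminorm ℂ 𝓢(Config n, ℂ)}
    {B : 𝓢(Config n, ℂ) →L[ℂ] 𝓢(Config n, ℂ)} (hB : HermiteBounded p B) (i : Fin n) :
    HermiteBounded p (B * momOp i) :=
  hB.of_ladder i (-1) (by simp) (-Complex.I) (by simp) fun α => by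
    rw [momOp, smul_apply, LineDeriv.lineDerivOpCLM_apply, lineDeriv_numberSchwartz, neg_one_smul,
      ← sub_eq_add_neg]

/-! ### Reduction of Schwartz seminorms to the sup norm. -/

theorem norm_config_le_sum (q : Config n) : ‖q‖ ≤ ∑ i, ‖q i‖ := by
  have h := (EuclideanSpace.basisFun (Fin n) ℝ).sum_repr q
  calc ‖q‖ = ‖∑ i, (EuclideanSpace.basisFun (Fin n) ℝ).repr q i • EuclideanSpace.basisFun (Fin n) ℝ i‖ := by
        rw [h]
    _ ≤ _ := norm_sum_le _ _
    _ = _ := Finset.sum_congr rfl fun i _ => by simp [norm_smul]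

theorem seminorm_succ_zero_le (k : ℕ) (f : 𝓢(Config n, ℂ)) :
    SchwartzMap.seminorm ℂ (k + 1) 0 f ≤ ∑ i, SchwartzMap.seminorm ℂ k 0 (posOp i f) := by
  refine SchwartzMap.seminorm_le_bound ℂ _ _ _ (Finset.sum_nonneg fun i _ => apply_nonneg _ _)
    fun x => ?_
  rw [norm_iteratedFDeriv_zero, pow_succ, mul_assoc]
  calc ‖x‖ ^ k * (‖x‖ * ‖f x‖) ≤ ‖x‖ ^ k * ((∑ i, ‖x i‖) * ‖f x‖) := by
        gcongr; exact norm_config_le_sum x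
    _ = ∑ i, ‖x‖ ^ k * ‖posOp i f x‖ := by
        rw [Finset.sum_mul, Finset.mul_sum]
        exact Finset.sum_congr rfl fun i _ => by rw [posOp_apply]; simp
    _ ≤ _ := Finset.sum_le_sum fun i _ => SchwartzMap.norm_pow_mul_le_seminorm ℂ _ k x

theorem fderiv_eq_sum_lineDeriv (f : 𝓢(Config n, ℂ)) (x : Config n) :
    fderiv ℝ f x = ∑ i, ContinuousLinearMap.smulRightL ℝ (Config n) ℂ
      (EuclideanSpace.proj i : Config n →L[ℝ] ℝ)
      ((∂_{(EuclideanSpace.single i (1 : ℝ) : Config n)} f) x) := by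
  ext v
  conv_lhs => rw [← (EuclideanSpace.basisFun (Fin n) ℝ).sum_repr v, map_sum]
  rw [sum_apply]
  refine Finset.sum_congr rfl fun i _ => ?_
  simp [lineDerivOp_apply_eq_fderiv]

theorem norm_iteratedFDeriv_sum_le {ι E F : Type*} [NormedAddCommGroup E] [NormedSpace ℝ E]
    [NormedAddCommGroup F] [NormedSpace ℝ F] (s : Finset ι) {f : ι → E → F} {m : ℕ}
    (hf : ∀ i ∈ s, ContDiff ℝ m (f i)) (x : E) :
    ‖iteratedFDeriv ℝ m (fun x => ∑ i ∈ s, f i x) x‖ ≤ ∑ i ∈ s, ‖iteratedFDeriv ℝ m (f i) x‖ := by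
  rw [iteratedFDeriv_sum hf, Finset.sum_apply]
  exact norm_sum_le _ _

/-- The differential is `∑ dq_i ⊗ ∂_i f`, and tensoring with `dq_i` has norm at most one. One order
of differentiation is thus traded for the partial derivatives of `f`. -/
theorem seminorm_succ_le (k m : ℕ) (f : 𝓢(Config n, ℂ)) :
    SchwartzMap.seminorm ℂ k (m + 1) f ≤
      ∑ i, SchwartzMap.seminorm ℂ k m (∂_{(EuclideanSpace.single i (1 : ℝ) : Config n)} f) := by
  refine SchwartzMap.seminorm_le_bound ℂ _ _ _ (Finset.sum_nonneg fun i _ => apply_nonneg _ _)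
    fun x => ?_
  set L : Fin n → ℂ →L[ℝ] (Config n →L[ℝ] ℂ) := fun i =>
    ContinuousLinearMap.smulRightL ℝ (Config n) ℂ
      (EuclideanSpace.proj i : Config n →L[ℝ] ℝ) with hL
  have hL1 : ∀ i, ‖L i‖ ≤ 1 := fun i => by
    refine ContinuousLinearMap.opNorm_le_bound _ zero_le_one fun z => ?_
    refine ContinuousLinearMap.opNorm_le_bound _ (by positivity) fun v => ?_
    have e : L i z v = v i • z := rfl
    rw [e, norm_smul, one_mul, mul_comm]
    gcongr
    exact PiLp.norm_apply_le v i
  rw [← norm_iteratedFDeriv_fderiv]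
  have e : fderiv ℝ f = fun x => ∑ i ∈ Finset.univ,
      (L i ∘ (∂_{(EuclideanSpace.single i (1 : ℝ) : Config n)} f : 𝓢(Config n, ℂ))) x :=
    funext fun x => fderiv_eq_sum_lineDeriv f x
  rw [e]
  calc _ ≤ ‖x‖ ^ k * ∑ i, ‖iteratedFDeriv ℝ m
        (L i ∘ (∂_{(EuclideanSpace.single i (1 : ℝ) : Config n)} f : 𝓢(Config n, ℂ))) x‖ := by
        gcongr
        exact norm_iteratedFDeriv_sum_le _
          (fun i _ => (L i).contDiff.comp (SchwartzMap.smooth _ _)) x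
    _ = ∑ i, ‖x‖ ^ k * ‖iteratedFDeriv ℝ m
        (L i ∘ (∂_{(EuclideanSpace.single i (1 : ℝ) : Config n)} f : 𝓢(Config n, ℂ))) x‖ := Finset.mul_sum _ _ _
    _ ≤ _ := Finset.sum_le_sum fun i _ => ?_
  refine le_trans ?_ (SchwartzMap.le_seminorm ℂ k m _ x)
  gcongr
  refine ((L i).norm_iteratedFDeriv_comp_left
    (SchwartzMap.contDiffAt _ (m : ℕ∞)) le_rfl).trans ?_
  exact mul_le_of_le_one_left (norm_nonneg _) (hL1 i)

/-- Derivatives are removed first and powers of `‖x‖` afterwards, so no commutators arise. What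
remains is the sup norm of `|α⟩`, bounded by the product of the one-dimensional bounds. -/
theorem hermiteBounded_seminorm (k m : ℕ) :
    HermiteBounded (SchwartzMap.seminorm ℂ k m) (1 : 𝓢(Config n, ℂ) →L[ℂ] 𝓢(Config n, ℂ)) := by
  -- The finitely many bounds are merged by adding both constants and exponents, which is permitted
  -- because the weight is at least one.
  have comb : ∀ (p q : Seminorm ℂ 𝓢(Config n, ℂ))
      (A : Fin n → 𝓢(Config n, ℂ) →L[ℂ] 𝓢(Config n, ℂ)),
      (∀ f, q f ≤ ∑ i, p (A i f)) → (∀ i, HermiteBounded p (1 * A i)) → HermiteBounded q 1 := by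
    intro p q A hq hA
    choose C hC r hr using hA
    refine ⟨∑ i, C i, Finset.sum_nonneg fun i _ => hC i, ∑ i, r i, fun α => ?_⟩
    rw [one_apply_eq_self, Finset.sum_mul]
    refine (hq _).trans (Finset.sum_le_sum fun i _ => (hr i α).trans ?_)
    gcongr
    · exact hC i
    · exact one_le_idxWeight α
    · exact Finset.single_le_sum (f := r) (fun _ _ => Nat.zero_le _) (Finset.mem_univ i)
  induction m with
  | zero =>
    induction k with
    | zero =>
      refine ⟨2 ^ n, by positivity, 1, fun α => ?_⟩
      refine SchwartzMap.seminorm_le_bound ℂ _ _ _ (by have := idxWeight_pos α; positivity)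
        fun x => ?_
      rw [pow_zero, one_mul, norm_iteratedFDeriv_zero, one_apply_eq_self,
        numberSchwartz_apply_eq_ofReal, Complex.norm_real, norm_prod, pow_one]
      calc _ ≤ ∏ i, (2 * ((α i : ℝ) + 1)) :=
            Finset.prod_le_prod (fun _ _ => norm_nonneg _) fun i _ => abs_hermiteFun_le _ _
        _ = _ := by rw [Finset.prod_mul_distrib]; simp [idxWeight]
    | succ k ih =>
      exact comb _ _ (fun i => posOp i) (seminorm_succ_zero_le k) fun i => ih.mul_posOp i
  | succ m ih => exact comb _ _ _ (seminorm_succ_le k m) fun i => ih.mul_lineDeriv i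

end

end QuantumSchwartz

namespace QuantumSchwartz

noncomputable section

/-! ### Completeness of the number basis -/

/-- Each Schwartz test function is a Fourier transform. Moving the transform across the pairing
gives `∫ ψ ĝ = 0`, so `g` vanishes as a tempered distribution, and `L¹` embeds injectively. -/
theorem ae_eq_zero_of_fourier_eq_zero {V : Type*} [NormedAddCommGroup V] [InnerProductSpace ℝ V]
    [FiniteDimensional ℝ V] [MeasurableSpace V] [BorelSpace V] {g : V → ℂ} (hg : Integrable g)
    (h : ∀ ξ, FourierTransform.fourier g ξ = 0) : g =ᵐ[volume] 0 := by
  have h1 : Lp.toTemperedDistributionCLM ℂ volume 1 (memLp_one_iff_integrable.2 hg).toLp = 0 := by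
    ext φ
    rw [Lp.toTemperedDistributionCLM_apply, Lp.toTemperedDistribution_apply]
    have e1 : ∫ x, φ x • ((memLp_one_iff_integrable.2 hg).toLp : V → ℂ) x = ∫ x, φ x • g x := by
      refine integral_congr_ae ?_
      filter_upwards [(memLp_one_iff_integrable.2 hg).coeFn_toLp] with x hx
      rw [hx]
    rw [e1]
    set ψ : 𝓢(V, ℂ) := FourierTransformInv.fourierInv φ with hψ
    have e2 : φ = FourierTransform.fourier ψ := (FourierTransform.fourier_fourierInv_eq φ).symm
    have e3 := VectorFourier.integral_fourierIntegral_smul_eq_flip (L := innerₗ V)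
      (μ := volume) (ν := volume) Real.continuous_fourierChar continuous_inner ψ.integrable hg
    have e4 : ∀ x, VectorFourier.fourierIntegral Real.fourierChar volume (innerₗ V).flip g x = 0 :=
      fun x => by
        rw [flip_innerₗ]
        exact h x
    simp only [e4, smul_zero, integral_zero] at e3
    rw [e2]
    exact e3
  have h2 : (memLp_one_iff_integrable.2 hg).toLp ∈
      (Lp.toTemperedDistributionCLM ℂ (volume : Measure V) 1).ker := h1
  rw [Lp.ker_toTemperedDistributionCLM_eq_bot, Submodule.mem_bot, Lp.eq_zero_iff_ae_eq_zero] at h2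
  exact (memLp_one_iff_integrable.2 hg).coeFn_toLp.symm.trans h2

variable {n : ℕ}

/-- The linear span of the Hermite functions, as functions. -/
def hermiteSpan (n : ℕ) : Submodule ℂ (Config n → ℂ) := Submodule.span ℂ (Set.range numberFun)

theorem numberFun_mem_hermiteSpan (α : Fin n → ℕ) : numberFun α ∈ hermiteSpan n :=
  Submodule.subset_span ⟨α, rfl⟩

/-- Stability under coordinate multiplication turns orthogonality to all `|α⟩` into the vanishing of
every moment of `|0⟩ f`. -/
theorem coord_mul_mem_hermiteSpan (i : Fin n) {v : Config n → ℂ} (hv : v ∈ hermiteSpan n) :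
    (fun q => ((q i : ℝ) : ℂ) * v q) ∈ hermiteSpan n := by
  induction hv using Submodule.span_induction with
  | mem v hv =>
    obtain ⟨α, rfl⟩ := hv
    have h : (fun q : Config n => ((q i : ℝ) : ℂ) * numberFun α q) =
        (((Real.sqrt 2)⁻¹ * Real.sqrt (α i) : ℝ) : ℂ) • numberFun (lowerIdx i α) +
        (((Real.sqrt 2)⁻¹ * Real.sqrt (α i + 1) : ℝ) : ℂ) • numberFun (raiseIdx i α) := by
      funext q
      have := congrArg (fun f : 𝓢(Config n, ℂ) => f q) (posOp_numberSchwartz i α)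
      simpa only [posOp_apply, numberSchwartz_apply, add_apply, smul_apply, Pi.add_apply, Pi.smul_apply] using this
    rw [h]
    exact Submodule.add_mem _ (Submodule.smul_mem _ _ (numberFun_mem_hermiteSpan _))
      (Submodule.smul_mem _ _ (numberFun_mem_hermiteSpan _))
  | zero =>
    simp only [Pi.zero_apply, mul_zero]
    exact (hermiteSpan n).zero_mem
  | add v w _ _ hv hw =>
    simp only [Pi.add_apply, mul_add]
    exact Submodule.add_mem _ hv hw
  | smul c v _ hv =>
    simp only [Pi.smul_apply, smul_eq_mul, mul_left_comm _ c]
    exact Submodule.smul_mem _ c hv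

theorem inner_mul_mem_hermiteSpan (y : Config n) {v : Config n → ℂ} (hv : v ∈ hermiteSpan n) :
    (fun q => ((⟪q, y⟫_ℝ : ℝ) : ℂ) * v q) ∈ hermiteSpan n := by
  have h : (fun q => ((⟪q, y⟫_ℝ : ℝ) : ℂ) * v q) =
      ∑ i, ((y i : ℝ) : ℂ) • fun q => ((q i : ℝ) : ℂ) * v q := by
    funext q
    rw [PiLp.inner_apply, Finset.sum_apply]
    push_cast
    rw [Finset.sum_mul]
    refine Finset.sum_congr rfl fun i _ => ?_
    simp
    ring
  rw [h]
  exact Submodule.sum_mem _ fun i _ => Submodule.smul_mem _ _ (coord_mul_mem_hermiteSpan i hv)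

theorem inner_pow_mul_mem_hermiteSpan (y : Config n) (k : ℕ) {v : Config n → ℂ}
    (hv : v ∈ hermiteSpan n) : (fun q => ((⟪q, y⟫_ℝ : ℝ) : ℂ) ^ k * v q) ∈ hermiteSpan n := by
  induction k with
  | zero => simpa using hv
  | succ k ih =>
    have := inner_mul_mem_hermiteSpan y ih
    simpa only [pow_succ', mul_assoc] using this

theorem inner_numberVec_eq_integral (α : Fin n → ℕ) (f : Hilb n) :
    ⟪numberVec α, f⟫_ℂ = ∫ q, numberFun α q * f q := by
  rw [L2.inner_def]
  refine integral_congr_ae ?_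
  filter_upwards [(memLp_numberFun α).coeFn_toLp] with q hq
  rw [RCLike.inner_apply, numberVec, hq, conj_numberFun, mul_comm]

theorem integral_hermiteSpan_mul_eq_zero {f : Hilb n} (h : ∀ α, ⟪numberVec α, f⟫_ℂ = 0)
    {v : Config n → ℂ} (hv : v ∈ hermiteSpan n) :
    Integrable (fun q => v q * f q) ∧ ∫ q, v q * f q = 0 := by
  induction hv using Submodule.span_induction with
  | mem v hv =>
    obtain ⟨α, rfl⟩ := hv
    exact ⟨(memLp_numberFun α).integrable_mul (Lp.memLp f),
      by rw [← inner_numberVec_eq_integral, h α]⟩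
  | zero => simp
  | add v w _ _ hv hw =>
    simp only [Pi.add_apply, add_mul]
    exact ⟨hv.1.add hw.1, by rw [integral_add hv.1 hw.1, hv.2, hw.2, add_zero]⟩
  | smul c v _ hv =>
    simp only [Pi.smul_apply, smul_eq_mul, mul_assoc]
    exact ⟨hv.1.const_mul c, by rw [integral_const_mul, hv.2, mul_zero]⟩

theorem norm_numberFun_zero (q : Config n) :
    ‖numberFun 0 q‖ = (Real.sqrt (Real.sqrt Real.pi))⁻¹ ^ n * Real.exp (-(‖q‖ ^ 2 / 2)) := by
  have h : numberFun 0 q = ((∏ i : Fin n, hermiteFun 0 (q i) : ℝ) : ℂ) := by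
    simp [numberFun]
  rw [h, Complex.norm_real, ← prod_exp_neg_sq]
  simp only [hermiteFun_zero, Finset.prod_mul_distrib, Finset.prod_const, Finset.card_univ,
    Fintype.card_fin]
  exact Real.norm_of_nonneg (by positivity)

theorem continuous_numberFun (α : Fin n → ℕ) : Continuous (numberFun α) := by
  have : numberFun α = numberSchwartz α := funext fun q => (numberSchwartz_apply α q).symm
  rw [this]
  exact (numberSchwartz α).continuous

/-- From `|q·y| ≤ ‖q‖²/4 + ‖y‖²` half of the Gaussian exponent survives. This is the majorant for
the exponential series in the completeness proof. -/
theorem memLp_exp_inner_mul_numberFun (y : Config n) :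
    MemLp (fun q => Real.exp |⟪q, y⟫_ℝ| * ‖numberFun 0 q‖) 2 (volume : Measure (Config n)) := by
  have hG : MemLp (fun q : Config n => Real.exp (-(‖q‖ ^ 2 / 4))) 2 volume := by
    have hc : Continuous fun q : Config n => Real.exp (-(‖q‖ ^ 2 / 4)) := by fun_prop
    rw [memLp_two_iff_integrable_sq hc.aestronglyMeasurable]
    refine (gaussianSchwartz (Config n)).integrable.congr (Filter.Eventually.of_forall fun q => ?_)
    simp only [gaussianSchwartz_apply]
    rw [← Real.exp_nat_mul]
    congr 1
    push_cast
    ring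
  refine (hG.const_mul ((Real.sqrt (Real.sqrt Real.pi))⁻¹ ^ n * Real.exp (‖y‖ ^ 2))).of_le ?_
    (Filter.Eventually.of_forall fun q => ?_)
  · have := continuous_numberFun (0 : Fin n → ℕ)
    exact Continuous.aestronglyMeasurable (by fun_prop)
  · rw [Real.norm_of_nonneg (by positivity), Real.norm_of_nonneg (by positivity),
      norm_numberFun_zero, mul_left_comm, mul_assoc]
    refine mul_le_mul_of_nonneg_left ?_ (by positivity)
    rw [← Real.exp_add, ← Real.exp_add, Real.exp_le_exp]
    have := abs_real_inner_le_norm q y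
    nlinarith [sq_nonneg (‖q‖ / 2 - ‖y‖)]

/-- Expanding the exponential in the Fourier transform of `|0⟩ f` leaves only moments, which are all
zero. Hence `|0⟩ f = 0`, and `|0⟩` has no zeros. -/
theorem eq_zero_of_inner_numberVec_eq_zero {f : Hilb n} (h : ∀ α, ⟪numberVec α, f⟫_ℂ = 0) :
    f = 0 := by
  have hint : Integrable fun q => numberFun 0 q * f q :=
    (memLp_numberFun 0).integrable_mul (Lp.memLp f)
  have hF : ∀ ξ, FourierTransform.fourier (fun q => numberFun 0 q * f q) ξ = 0 := by
    intro ξ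
    rw [Real.fourier_eq']
    -- Absorbs the `-2π` of the Fourier kernel, so that the exponent is `i q·y`.
    set y : Config n := (-2 * Real.pi) • ξ with hy
    have key := hasSum_integral_of_dominated_convergence (μ := (volume : Measure (Config n)))
      (F := fun (k : ℕ) q => (((⟪q, y⟫_ℝ : ℝ) : ℂ) * Complex.I) ^ k / k.factorial *
        (numberFun 0 q * f q))
      (f := fun q => Complex.exp (((⟪q, y⟫_ℝ : ℝ) : ℂ) * Complex.I) * (numberFun 0 q * f q))
      (fun (k : ℕ) q => |⟪q, y⟫_ℝ| ^ k / k.factorial * (‖numberFun 0 q‖ * ‖f q‖))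
      (fun k => (Continuous.aestronglyMeasurable (by fun_prop)).mul hint.aestronglyMeasurable)
      (fun k => Filter.Eventually.of_forall fun q => by simp)
      (Filter.Eventually.of_forall fun q => (Real.summable_pow_div_factorial _).mul_right _) ?_
      (Filter.Eventually.of_forall fun q => by
        have := NormedSpace.expSeries_div_hasSum_exp (((⟪q, y⟫_ℝ : ℝ) : ℂ) * Complex.I)
        rw [← Complex.exp_eq_exp_ℂ] at this
        exact this.mul_right _)
    · have hz : ∀ k : ℕ, ∫ q, (((⟪q, y⟫_ℝ : ℝ) : ℂ) * Complex.I) ^ k / k.factorial *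
          (numberFun 0 q * f q) = 0 := fun k => by
        have := (integral_hermiteSpan_mul_eq_zero h
          (inner_pow_mul_mem_hermiteSpan y k (numberFun_mem_hermiteSpan 0))).2
        have e : ∀ q, (((⟪q, y⟫_ℝ : ℝ) : ℂ) * Complex.I) ^ k / k.factorial *
          (numberFun 0 q * f q) = Complex.I ^ k / k.factorial *
            (((⟪q, y⟫_ℝ : ℝ) : ℂ) ^ k * numberFun 0 q * f q) := fun q => by
          rw [mul_pow]; ring
        simp only [e, integral_const_mul, this, mul_zero]
      simp only [hz] at key
      rw [hasSum_zero.unique key]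
      refine integral_congr_ae (Filter.Eventually.of_forall fun q => ?_)
      simp only [hy, inner_smul_right, smul_eq_mul]
    · have e : ∀ q, ∑' k : ℕ, |⟪q, y⟫_ℝ| ^ k / k.factorial * (‖numberFun 0 q‖ * ‖f q‖) =
          Real.exp |⟪q, y⟫_ℝ| * ‖numberFun 0 q‖ * ‖f q‖ := fun q => by
        rw [tsum_mul_right, Real.exp_eq_exp_ℝ, NormedSpace.exp_eq_tsum_div, mul_assoc]
      simp only [e]
      exact (memLp_exp_inner_mul_numberFun y).integrable_mul (Lp.memLp f).norm
  have h0 := ae_eq_zero_of_fourier_eq_zero hint hF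
  rw [Lp.eq_zero_iff_ae_eq_zero]
  filter_upwards [h0] with q hq
  have : numberFun 0 q ≠ 0 := by
    rw [← norm_ne_zero_iff, norm_numberFun_zero]
    positivity
  exact (mul_eq_zero.1 hq).resolve_left this

/-- The number basis as a Hilbert basis. -/
def numberBasis (n : ℕ) : HilbertBasis (Fin n → ℕ) ℂ (Hilb n) :=
  HilbertBasis.mkOfOrthogonalEqBot orthonormal_numberVec <| by
    rw [Submodule.eq_bot_iff]
    intro f hf
    refine eq_zero_of_inner_numberVec_eq_zero fun α => ?_
    exact (Submodule.mem_orthogonal _ f).1 hf _ (Submodule.subset_span ⟨α, rfl⟩)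

theorem numberBasis_apply (α : Fin n → ℕ) : numberBasis n α = numberVec α := by
  rw [numberBasis, HilbertBasis.coe_mkOfOrthogonalEqBot]

end

end QuantumSchwartz

namespace QuantumSchwartz

noncomputable section

variable {n : ℕ}

/-! ### Weighted estimates for multisequences -/

/-- A finite set of multi-indices lies in a box, where the sum of products is the product of the
sums. -/
theorem summable_prod_of_summable {f : ℕ → ℝ} (hf0 : ∀ k, 0 ≤ f k) (hs : Summable f) (n : ℕ) :
    Summable fun α : Fin n → ℕ => ∏ i, f (α i) := by
  classical
  refine summable_of_sum_le (c := ∏ _i : Fin n, ∑' k, f k)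
    (fun α => Finset.prod_nonneg fun i _ => hf0 _) fun u => ?_
  obtain ⟨t, ht⟩ : ∃ t : Fin n → Finset ℕ, u ⊆ Fintype.piFinset t :=
    ⟨fun i => u.image fun α => α i, fun α hα => Fintype.mem_piFinset.2 fun i =>
      Finset.mem_image_of_mem (fun α : Fin n → ℕ => α i) hα⟩
  have h1 : ∑ α ∈ u, ∏ i, f (α i) ≤ ∑ α ∈ Fintype.piFinset t, ∏ i, f (α i) :=
    Finset.sum_le_sum_of_subset_of_nonneg ht fun α _ _ => Finset.prod_nonneg fun i _ => hf0 _
  rw [← Finset.prod_univ_sum t fun _ k => f k] at h1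
  exact h1.trans (Finset.prod_le_prod (fun i _ => Finset.sum_nonneg fun k _ => hf0 k)
    fun i _ => hs.sum_le_tsum _ fun k _ => hf0 k)

theorem summable_idxWeight_inv_sq (n : ℕ) :
    Summable fun α : Fin n → ℕ => (idxWeight α ^ 2)⁻¹ := by
  have hs : Summable fun k : ℕ => (((k : ℝ) + 1) ^ 2)⁻¹ := by
    have := (summable_nat_add_iff 1).2 (Real.summable_nat_pow_inv.2 one_lt_two)
    simpa only [Nat.cast_add, Nat.cast_one] using this
  refine (summable_prod_of_summable (fun k => by positivity) hs n).congr fun α => ?_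
  rw [idxWeight, ← Finset.prod_pow, Finset.prod_inv_distrib]

/-- The constant `∑ α, ∏ i, (α_i + 1)⁻²`. -/
def weightSum (n : ℕ) : ℝ := ∑' α : Fin n → ℕ, (idxWeight α ^ 2)⁻¹

theorem weightSum_nonneg (n : ℕ) : 0 ≤ weightSum n :=
  tsum_nonneg fun α => by have := idxWeight_pos α; positivity

theorem norm_seqWeight (δ γ : Fin n → ℕ) : ‖seqWeight δ γ‖ = ∏ i, ((γ i : ℝ) + 1) ^ δ i := by
  rw [seqWeight, norm_prod]
  refine Finset.prod_congr rfl fun i _ => ?_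
  rw [norm_pow]
  congr 1
  have : ((γ i : ℂ) + 1) = (((γ i : ℝ) + 1 : ℝ) : ℂ) := by push_cast; rfl
  rw [this, Complex.norm_real, Real.norm_of_nonneg (by positivity)]

theorem norm_seqWeight_const (r : ℕ) (γ : Fin n → ℕ) :
    ‖seqWeight (fun _ => r) γ‖ = idxWeight γ ^ r := by
  rw [norm_seqWeight, idxWeight, Finset.prod_pow]

theorem norm_seqWeight_le (δ γ : Fin n → ℕ) : ‖seqWeight δ γ‖ ≤ idxWeight γ ^ ∑ i, δ i := by
  rw [norm_seqWeight, idxWeight, ← Finset.prod_pow]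
  refine Finset.prod_le_prod (fun i _ => by positivity) fun i _ => ?_
  exact pow_le_pow_right₀ (by linarith [(Nat.cast_nonneg (γ i) : (0 : ℝ) ≤ γ i)])
    (Finset.single_le_sum (f := δ) (fun _ _ => Nat.zero_le _) (Finset.mem_univ i))

/-- The one extra power of the weight becomes, after squaring, the summable factor `idxWeight⁻²`.
Sup bounds for all powers are therefore equivalent to the weighted `ℓ²` conditions. -/
theorem norm_weightedSeq_sq_le {a : (Fin n → ℕ) → ℂ} {δ : Fin n → ℕ} {B : ℝ}
    (h : ∀ γ, idxWeight γ ^ ((∑ i, δ i) + 1) * ‖a γ‖ ≤ B) (γ : Fin n → ℕ) :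
    ‖weightedSeq δ a γ‖ ^ (2 : ENNReal).toReal ≤ B ^ 2 * (idxWeight γ ^ 2)⁻¹ := by
  have hw := idxWeight_pos γ
  have h1 : ‖weightedSeq δ a γ‖ ≤ idxWeight γ ^ (∑ i, δ i) * ‖a γ‖ := by
    change ‖seqWeight δ γ * a γ‖ ≤ _
    rw [norm_mul]
    gcongr
    exact norm_seqWeight_le δ γ
  have h2 : idxWeight γ * ‖weightedSeq δ a γ‖ ≤ B := by
    refine le_trans ?_ (h γ)
    rw [pow_succ', mul_assoc]
    gcongr
  rw [ENNReal.toReal_ofNat, Real.rpow_ofNat, ← div_eq_mul_inv, le_div_iff₀ (by positivity),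
    ← mul_pow, mul_comm]
  gcongr

theorem mem_schwartzSeqSubmodule {a : (Fin n → ℕ) → ℂ}
    (h : ∀ r : ℕ, ∃ B, ∀ γ, idxWeight γ ^ r * ‖a γ‖ ≤ B) : a ∈ schwartzSeqSubmodule n := by
  intro δ
  obtain ⟨B, hB⟩ := h ((∑ i, δ i) + 1)
  refine memℓp_gen (((summable_idxWeight_inv_sq n).mul_left (B ^ 2)).of_nonneg_of_le
    (fun γ => by positivity) (norm_weightedSeq_sq_le hB))

theorem schwartzSeqSeminorm_le (a : SchwartzSeq n) {δ : Fin n → ℕ} {B : ℝ}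
    (h : ∀ γ, idxWeight γ ^ ((∑ i, δ i) + 1) * ‖a.coeff γ‖ ≤ B) :
    schwartzSeqSeminorm n δ a ≤ Real.sqrt (weightSum n) * B := by
  have hB : 0 ≤ B := le_trans (by have := idxWeight_pos (0 : Fin n → ℕ); positivity) (h 0)
  change ‖SchwartzSeq.toL2 δ a‖ ≤ _
  refine lp.norm_le_of_tsum_le (by simp) (by positivity) ?_
  have hs := (summable_idxWeight_inv_sq n).mul_left (B ^ 2)
  calc _ ≤ ∑' γ : Fin n → ℕ, B ^ 2 * (idxWeight γ ^ 2)⁻¹ :=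
        (hs.of_nonneg_of_le (fun γ => by positivity) (norm_weightedSeq_sq_le h)).tsum_le_tsum
          (norm_weightedSeq_sq_le h) hs
    _ = _ := by
        rw [tsum_mul_left, ENNReal.toReal_ofNat, Real.rpow_ofNat, mul_pow,
          Real.sq_sqrt (weightSum_nonneg n), mul_comm, weightSum]

theorem idxWeight_pow_mul_norm_coeff_le (a : SchwartzSeq n) (r : ℕ) (γ : Fin n → ℕ) :
    idxWeight γ ^ r * ‖a.coeff γ‖ ≤ schwartzSeqSeminorm n (fun _ => r) a := by
  have h := lp.norm_apply_le_norm two_ne_zero (SchwartzSeq.toL2 (fun _ => r) a) γ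
  have e : ‖SchwartzSeq.toL2 (fun _ => r) a γ‖ = idxWeight γ ^ r * ‖a.coeff γ‖ := by
    change ‖seqWeight (fun _ => r) γ * a.coeff γ‖ = _
    rw [norm_mul, norm_seqWeight_const]
  rw [e] at h
  exact h

theorem idxWeight_pow_mul_norm_coeff_le_inv_sq (a : SchwartzSeq n) (r : ℕ) (γ : Fin n → ℕ) :
    idxWeight γ ^ r * ‖a.coeff γ‖ ≤
      schwartzSeqSeminorm n (fun _ => r + 2) a * (idxWeight γ ^ 2)⁻¹ := by
  have hw := idxWeight_pos γ
  rw [← div_eq_mul_inv, le_div_iff₀ (by positivity)]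
  refine le_trans (le_of_eq ?_) (idxWeight_pow_mul_norm_coeff_le a (r + 2) γ)
  ring

theorem summable_idxWeight_pow_mul_norm_coeff (a : SchwartzSeq n) (r : ℕ) :
    Summable fun γ => idxWeight γ ^ r * ‖a.coeff γ‖ :=
  ((summable_idxWeight_inv_sq n).mul_left _).of_nonneg_of_le
    (fun γ => by have := idxWeight_pos γ; positivity) (idxWeight_pow_mul_norm_coeff_le_inv_sq a r)

theorem summable_norm_coeff (a : SchwartzSeq n) : Summable fun γ => ‖a.coeff γ‖ := by
  simpa using summable_idxWeight_pow_mul_norm_coeff a 0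

theorem tsum_idxWeight_pow_mul_norm_coeff_le (a : SchwartzSeq n) (r : ℕ) :
    ∑' γ, idxWeight γ ^ r * ‖a.coeff γ‖ ≤
      weightSum n * schwartzSeqSeminorm n (fun _ => r + 2) a := by
  refine ((summable_idxWeight_pow_mul_norm_coeff a r).tsum_le_tsum
    (idxWeight_pow_mul_norm_coeff_le_inv_sq a r)
    ((summable_idxWeight_inv_sq n).mul_left _)).trans (le_of_eq ?_)
  rw [tsum_mul_left, mul_comm, weightSum]

theorem SchwartzSeq.ext {a b : SchwartzSeq n} (h : ∀ γ, a.coeff γ = b.coeff γ) : a = b :=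
  Subtype.ext (funext h)

/-- A linear map into `𝔰_n` whose coefficients are polynomially bounded by continuous seminorms
is continuous. -/
theorem continuous_to_schwartzSeq {E : Type*} [AddCommGroup E] [Module ℂ E] [TopologicalSpace E]
    [IsTopologicalAddGroup E] [ContinuousSMul ℂ E]
    (L : E →ₗ[ℂ] SchwartzSeq n)
    (h : ∀ r : ℕ, ∃ p : Seminorm ℂ E, Continuous p ∧
      ∀ x γ, idxWeight γ ^ r * ‖(L x).coeff γ‖ ≤ p x) : Continuous L := by
  refine WithSeminorms.continuous_of_continuous_comp (schwartzSeq_withSeminorms n) L fun δ => ?_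
  obtain ⟨p, hp, hb⟩ := h ((∑ i, δ i) + 1)
  let c : NNReal := ⟨Real.sqrt (weightSum n), Real.sqrt_nonneg _⟩
  have hcont : Continuous (c • p : Seminorm ℂ E) := by
    change Continuous fun x => (c : ℝ) * p x
    fun_prop
  refine Seminorm.continuous_of_le hcont fun x => ?_
  exact schwartzSeqSeminorm_le (L x) (hb x)

/-! ### Sums of Schwartz functions -/

section Sums

variable {ι E : Type*} [NormedAddCommGroup E] [NormedSpace ℝ E]

theorem norm_iteratedFDeriv_le_seminorm_zero (f : 𝓢(E, ℂ)) (m : ℕ) (x : E) :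
    ‖iteratedFDeriv ℝ m f x‖ ≤ SchwartzMap.seminorm ℂ 0 m f := by
  simpa using SchwartzMap.le_seminorm ℂ 0 m f x

theorem iteratedFDeriv_tsum_schwartz {F : ι → 𝓢(E, ℂ)}
    (hF : ∀ k m : ℕ, Summable fun i => SchwartzMap.seminorm ℂ k m (F i)) (m : ℕ) (x : E) :
    iteratedFDeriv ℝ m (fun y => ∑' i, F i y) x = ∑' i, iteratedFDeriv ℝ m (F i) x :=
  iteratedFDeriv_tsum_apply (N := ⊤) (v := fun m i => SchwartzMap.seminorm ℂ 0 m (F i))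
    (fun i => (F i).smooth ⊤) (fun m _ => hF 0 m)
    (fun m i x _ => norm_iteratedFDeriv_le_seminorm_zero (F i) m x) le_top x

theorem norm_pow_mul_iteratedFDeriv_tsum_le {F : ι → 𝓢(E, ℂ)}
    (hF : ∀ k m : ℕ, Summable fun i => SchwartzMap.seminorm ℂ k m (F i)) (k m : ℕ) (x : E) :
    ‖x‖ ^ k * ‖iteratedFDeriv ℝ m (fun y => ∑' i, F i y) x‖ ≤
      ∑' i, SchwartzMap.seminorm ℂ k m (F i) := by
  have h0 : Summable fun i => ‖iteratedFDeriv ℝ m (F i) x‖ :=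
    (hF 0 m).of_nonneg_of_le (fun i => norm_nonneg _)
      fun i => norm_iteratedFDeriv_le_seminorm_zero (F i) m x
  rw [iteratedFDeriv_tsum_schwartz hF]
  calc _ ≤ ‖x‖ ^ k * ∑' i, ‖iteratedFDeriv ℝ m (F i) x‖ := by
        gcongr; exact norm_tsum_le_tsum_norm h0
    _ = ∑' i, ‖x‖ ^ k * ‖iteratedFDeriv ℝ m (F i) x‖ := tsum_mul_left.symm
    _ ≤ _ := (h0.mul_left _).tsum_le_tsum (fun i => SchwartzMap.le_seminorm ℂ k m (F i) x) (hF k m)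

/-- The sum of a family of Schwartz functions that is absolutely summable in every seminorm. -/
def schwartzTsum (F : ι → 𝓢(E, ℂ))
    (hF : ∀ k m : ℕ, Summable fun i => SchwartzMap.seminorm ℂ k m (F i)) : 𝓢(E, ℂ) where
  toFun x := ∑' i, F i x
  smooth' := contDiff_tsum (N := ⊤) (v := fun m i => SchwartzMap.seminorm ℂ 0 m (F i))
    (fun i => (F i).smooth ⊤) (fun m _ => hF 0 m)
    (fun m i x _ => norm_iteratedFDeriv_le_seminorm_zero (F i) m x)
  decay' k m := ⟨_, norm_pow_mul_iteratedFDeriv_tsum_le hF k m⟩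

theorem schwartzTsum_apply {F : ι → 𝓢(E, ℂ)}
    (hF : ∀ k m : ℕ, Summable fun i => SchwartzMap.seminorm ℂ k m (F i)) (x : E) :
    schwartzTsum F hF x = ∑' i, F i x := rfl

theorem seminorm_schwartzTsum_le {F : ι → 𝓢(E, ℂ)}
    (hF : ∀ k m : ℕ, Summable fun i => SchwartzMap.seminorm ℂ k m (F i)) (k m : ℕ) :
    SchwartzMap.seminorm ℂ k m (schwartzTsum F hF) ≤ ∑' i, SchwartzMap.seminorm ℂ k m (F i) :=
  SchwartzMap.seminorm_le_bound ℂ _ _ _ (tsum_nonneg fun _ => apply_nonneg _ _)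
    (norm_pow_mul_iteratedFDeriv_tsum_le hF k m)

theorem summable_schwartz_apply {F : ι → 𝓢(E, ℂ)}
    (hF : ∀ k m : ℕ, Summable fun i => SchwartzMap.seminorm ℂ k m (F i)) (x : E) :
    Summable fun i => F i x :=
  Summable.of_norm_bounded (hF 0 0) fun i => SchwartzMap.norm_le_seminorm ℂ (F i) x

/-- The remainder after a finite set `s` is itself the sum of a Schwartz family, namely `F` put to
zero on `s`. Its seminorms are therefore bounded by the tails of the scalar series. -/
theorem hasSum_schwartzTsum {F : ι → 𝓢(E, ℂ)}
    (hF : ∀ k m : ℕ, Summable fun i => SchwartzMap.seminorm ℂ k m (F i)) :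
    HasSum F (schwartzTsum F hF) := by
  classical
  rw [HasSum, (schwartz_withSeminorms ℂ E ℂ).tendsto_nhds]
  rintro ⟨k, m⟩ ε hε
  have ht := (hF k m).hasSum
  rw [HasSum, Metric.tendsto_nhds] at ht
  filter_upwards [ht ε hε] with s hs
  set G : ι → 𝓢(E, ℂ) := fun i => if i ∈ s then 0 else F i with hG
  have hle : ∀ k m i, SchwartzMap.seminorm ℂ k m (G i) ≤ SchwartzMap.seminorm ℂ k m (F i) :=
    fun k m i => by
      simp only [hG]
      split_ifs
      · rw [map_zero]; exact apply_nonneg _ _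
      · exact le_rfl
  have hGs : ∀ k m : ℕ, Summable fun i => SchwartzMap.seminorm ℂ k m (G i) := fun k m =>
    (hF k m).of_nonneg_of_le (fun i => apply_nonneg _ _) (hle k m)
  have e1 : schwartzTsum F hF - ∑ i ∈ s, F i = schwartzTsum G hGs := by
    ext x
    have hsum : (∑ i ∈ s, F i) x = ∑ i ∈ s, F i x := sum_apply ..
    rw [sub_apply, hsum, schwartzTsum_apply, schwartzTsum_apply, sub_eq_iff_eq_add',
      ← (summable_schwartz_apply hF x).sum_add_tsum_compl (s := s), add_right_inj,
      tsum_subtype ((s : Set ι)ᶜ) (fun i => F i x)]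
    refine tsum_congr fun i => ?_
    by_cases hi : i ∈ s <;> simp [hG, hi]
  have e2 : ∑' i, SchwartzMap.seminorm ℂ k m (G i) =
      ∑' i, SchwartzMap.seminorm ℂ k m (F i) - ∑ i ∈ s, SchwartzMap.seminorm ℂ k m (F i) := by
    rw [eq_sub_iff_add_eq', ← (hF k m).sum_add_tsum_compl (s := s), add_right_inj,
      tsum_subtype ((s : Set ι)ᶜ) (fun i => SchwartzMap.seminorm ℂ k m (F i))]
    refine tsum_congr fun i => ?_
    by_cases hi : i ∈ s <;> simp [hG, hi]
  rw [schwartzSeminormFamily_apply, map_sub_rev, e1]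
  refine (seminorm_schwartzTsum_le hGs k m).trans_lt ?_
  rw [e2]
  rw [Real.dist_eq, abs_sub_comm] at hs
  exact (le_abs_self _).trans_lt hs

end Sums

end

end QuantumSchwartz

namespace QuantumSchwartz

noncomputable section

variable {n : ℕ}

/-! ### The algebra generated by position and momentum operators -/

/-- The algebra of operators on Schwartz functions generated by the positions and momenta. -/
def pqAlg (n : ℕ) : Subalgebra ℂ (𝓢(Config n, ℂ) →L[ℂ] 𝓢(Config n, ℂ)) :=
  Algebra.adjoin ℂ (Set.range posOp ∪ Set.range momOp)

theorem posOp_mem_pqAlg (i : Fin n) : posOp i ∈ pqAlg n :=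
  Algebra.subset_adjoin (Or.inl ⟨i, rfl⟩)

theorem momOp_mem_pqAlg (i : Fin n) : momOp i ∈ pqAlg n :=
  Algebra.subset_adjoin (Or.inr ⟨i, rfl⟩)

theorem posPow_mem_pqAlg (α : Fin n → ℕ) : posPow α ∈ pqAlg n := by
  refine list_prod_mem fun x hx => ?_
  obtain ⟨i, rfl⟩ := List.mem_ofFn.1 hx
  exact pow_mem (posOp_mem_pqAlg i) _

theorem momPow_mem_pqAlg (α : Fin n → ℕ) : momPow α ∈ pqAlg n := by
  refine list_prod_mem fun x hx => ?_
  obtain ⟨i, rfl⟩ := List.mem_ofFn.1 hx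
  exact pow_mem (momOp_mem_pqAlg i) _

/-- The operator `B` stays arbitrary in the induction: for a product `A₁ * A₂`, the bound on `B *
A₁` is the input for `A₂`. -/
theorem HermiteBounded.mul_of_mem_pqAlg {p : Seminorm ℂ 𝓢(Config n, ℂ)}
    {A B : 𝓢(Config n, ℂ) →L[ℂ] 𝓢(Config n, ℂ)} (hA : A ∈ pqAlg n) (hB : HermiteBounded p B) :
    HermiteBounded p (B * A) := by
  induction hA using Algebra.adjoin_induction generalizing B with
  | mem A hA =>
    rcases hA with ⟨i, rfl⟩ | ⟨i, rfl⟩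
    · exact hB.mul_posOp i
    · exact hB.mul_momOp i
  | algebraMap c =>
    obtain ⟨C, hC, r, h⟩ := hB
    refine ⟨‖c‖ * C, by positivity, r, fun α => ?_⟩
    have e : (B * algebraMap ℂ (𝓢(Config n, ℂ) →L[ℂ] 𝓢(Config n, ℂ)) c) (numberSchwartz α) =
        c • B (numberSchwartz α) := by
      rw [mul_apply_eq_comp, Algebra.algebraMap_eq_smul_one, smul_apply, one_apply_eq_self,
        map_smul]
    rw [e, map_smul_eq_mul, mul_assoc]
    gcongr
    exact h α
  | add A₁ A₂ _ _ h₁ h₂ =>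
    obtain ⟨C₁, hC₁, r₁, h₁⟩ := h₁ hB
    obtain ⟨C₂, hC₂, r₂, h₂⟩ := h₂ hB
    refine ⟨C₁ + C₂, by positivity, r₁ + r₂, fun α => ?_⟩
    have hw := one_le_idxWeight α
    rw [mul_add, add_apply, add_mul]
    refine (map_add_le_add p _ _).trans (add_le_add ((h₁ α).trans ?_) ((h₂ α).trans ?_))
    · gcongr
      omega
    · gcongr
      omega
  | mul A₁ A₂ _ _ h₁ h₂ =>
    rw [← mul_assoc]
    exact h₂ (h₁ hB)

/-- The inclusion of Schwartz functions into `L²` as a continuous linear map. -/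
def hilbCLM (n : ℕ) : 𝓢(Config n, ℂ) →L[ℂ] Hilb n := toLpCLM ℂ ℂ 2 volume

theorem hilbCLM_apply (f : 𝓢(Config n, ℂ)) : hilbCLM n f = toHilb f := rfl

/-- The norm of `L²` as a seminorm on Schwartz functions. -/
def l2Seminorm (n : ℕ) : Seminorm ℂ 𝓢(Config n, ℂ) :=
  (normSeminorm ℂ (Hilb n)).comp (hilbCLM n).toLinearMap

theorem l2Seminorm_apply (f : 𝓢(Config n, ℂ)) : l2Seminorm n f = ‖toHilb f‖ := rfl

theorem continuous_l2Seminorm (n : ℕ) : Continuous (l2Seminorm n) :=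
  continuous_norm.comp (hilbCLM n).continuous

/-! ### Formal adjoints and the number operators. -/

theorem inner_toHilb (f g : 𝓢(Config n, ℂ)) :
    ⟪toHilb f, toHilb g⟫_ℂ = ∫ q, (starRingEnd ℂ) (f q) * g q := by
  refine (SchwartzMap.inner_toL2_toL2_eq f g volume).trans ?_
  refine integral_congr_ae (Filter.Eventually.of_forall fun q => ?_)
  simp only [RCLike.inner_apply]
  exact mul_comm _ _

theorem hermiteBounded_l2Seminorm : HermiteBounded (l2Seminorm n) 1 :=
  ⟨1, zero_le_one, 0, fun α => by
    rw [one_apply_eq_self, l2Seminorm_apply, toHilb_numberSchwartz, norm_numberVec, pow_zero,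
      mul_one]⟩

/-- `A'` is a formal adjoint of `A` on Schwartz functions. -/
def FormalAdjoint (A A' : 𝓢(Config n, ℂ) →L[ℂ] 𝓢(Config n, ℂ)) : Prop :=
  ∀ f g, ⟪toHilb (A f), toHilb g⟫_ℂ = ⟪toHilb f, toHilb (A' g)⟫_ℂ

theorem FormalAdjoint.symm {A A' : 𝓢(Config n, ℂ) →L[ℂ] 𝓢(Config n, ℂ)} (h : FormalAdjoint A A') :
    FormalAdjoint A' A := fun f g => by
  rw [← inner_conj_symm, ← h, inner_conj_symm]

theorem formalAdjoint_posOp (i : Fin n) : FormalAdjoint (posOp i) (posOp i) := fun f g => by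
  rw [inner_toHilb, inner_toHilb]
  refine integral_congr_ae (Filter.Eventually.of_forall fun q => ?_)
  simp only [posOp_apply, map_mul, Complex.conj_ofReal]
  ring

theorem formalAdjoint_momOp (i : Fin n) : FormalAdjoint (momOp i) (momOp i) := fun f g => by
  set v : Config n := EuclideanSpace.single i (1 : ℝ) with hv
  have h := integral_bilinear_lineDerivOp_right_eq_neg_left (μ := (volume : Measure (Config n))) f g
    ((ContinuousLinearMap.mul ℝ ℂ).comp (Complex.conjCLE : ℂ →L[ℝ] ℂ)) v
  have h1 : ∀ f : 𝓢(Config n, ℂ), ∀ q, momOp i f q = -Complex.I * (∂_{v} f) q := fun f q => rfl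
  rw [inner_toHilb, inner_toHilb]
  simp only [h1, map_mul, map_neg, Complex.conj_I, neg_neg]
  have h2 : ∫ q, (starRingEnd ℂ) (f q) * (∂_{v} g) q =
      -∫ q, (starRingEnd ℂ) ((∂_{v} f) q) * g q := h
  have e1 : ∀ q, Complex.I * (starRingEnd ℂ) ((∂_{v} f) q) * g q =
      Complex.I * ((starRingEnd ℂ) ((∂_{v} f) q) * g q) := fun q => mul_assoc _ _ _
  have e2 : ∀ q, (starRingEnd ℂ) (f q) * (-Complex.I * (∂_{v} g) q) =
      -Complex.I * ((starRingEnd ℂ) (f q) * (∂_{v} g) q) := fun q => by ring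
  simp only [e1, e2, integral_const_mul, h2]
  ring

theorem exists_formalAdjoint {A : 𝓢(Config n, ℂ) →L[ℂ] 𝓢(Config n, ℂ)} (hA : A ∈ pqAlg n) :
    ∃ A' ∈ pqAlg n, FormalAdjoint A A' := by
  induction hA using Algebra.adjoin_induction with
  | mem A hA =>
    rcases hA with ⟨i, rfl⟩ | ⟨i, rfl⟩
    · exact ⟨_, posOp_mem_pqAlg i, formalAdjoint_posOp i⟩
    · exact ⟨_, momOp_mem_pqAlg i, formalAdjoint_momOp i⟩
  | algebraMap c =>
    refine ⟨algebraMap ℂ _ ((starRingEnd ℂ) c), Subalgebra.algebraMap_mem _ _, fun f g => ?_⟩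
    simp only [Algebra.algebraMap_eq_smul_one, smul_apply, one_apply_eq_self, ← hilbCLM_apply,
      map_smul, inner_smul_left, inner_smul_right]
  | add A₁ A₂ _ _ h₁ h₂ =>
    obtain ⟨B₁, hB₁, h₁⟩ := h₁
    obtain ⟨B₂, hB₂, h₂⟩ := h₂
    refine ⟨B₁ + B₂, add_mem hB₁ hB₂, fun f g => ?_⟩
    have h₁ := h₁ f g
    have h₂ := h₂ f g
    simp only [← hilbCLM_apply] at h₁ h₂ ⊢
    simp only [add_apply, map_add, inner_add_left, inner_add_right, h₁, h₂]
  | mul A₁ A₂ _ _ h₁ h₂ =>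
    obtain ⟨B₁, hB₁, h₁⟩ := h₁
    obtain ⟨B₂, hB₂, h₂⟩ := h₂
    exact ⟨B₂ * B₁, mul_mem hB₂ hB₁, fun f g => by
      rw [mul_apply_eq_comp, mul_apply_eq_comp, h₁, h₂]⟩

/-- The operator `(Q_i² + P_i² + 1) / 2`, with eigenvalue `α_i + 1` at `|α⟩`. -/
def shiftedNumberOp (i : Fin n) : 𝓢(Config n, ℂ) →L[ℂ] 𝓢(Config n, ℂ) :=
  (2⁻¹ : ℂ) • (posOp i * posOp i + momOp i * momOp i + 1)

theorem shiftedNumberOp_mem_pqAlg (i : Fin n) : shiftedNumberOp i ∈ pqAlg n :=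
  Subalgebra.smul_mem _ (add_mem (add_mem (mul_mem (posOp_mem_pqAlg i) (posOp_mem_pqAlg i))
    (mul_mem (momOp_mem_pqAlg i) (momOp_mem_pqAlg i))) (one_mem _)) _

theorem raiseIdx_lowerIdx {i : Fin n} {α : Fin n → ℕ} (h : α i ≠ 0) :
    raiseIdx i (lowerIdx i α) = α := by
  rw [raiseIdx, lowerIdx, Function.update_self, Function.update_idem, Nat.sub_add_cancel (by omega),
    Function.update_eq_self]

theorem lowerIdx_raiseIdx (i : Fin n) (α : Fin n → ℕ) : lowerIdx i (raiseIdx i α) = α := by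
  rw [raiseIdx, lowerIdx, Function.update_self, Function.update_idem, Nat.add_sub_cancel,
    Function.update_eq_self]

theorem momOp_numberSchwartz (i : Fin n) (α : Fin n → ℕ) :
    momOp i (numberSchwartz α) = (-Complex.I) •
      ((((Real.sqrt 2)⁻¹ * Real.sqrt (α i) : ℝ) : ℂ) • numberSchwartz (lowerIdx i α) -
      (((Real.sqrt 2)⁻¹ * Real.sqrt (α i + 1) : ℝ) : ℂ) • numberSchwartz (raiseIdx i α)) := by
  rw [momOp, smul_apply, LineDeriv.lineDerivOpCLM_apply, lineDeriv_numberSchwartz]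

theorem shiftedNumberOp_numberSchwartz (i : Fin n) (α : Fin n → ℕ) :
    shiftedNumberOp i (numberSchwartz α) = ((α i : ℂ) + 1) • numberSchwartz α := by
  have h2 : ((Real.sqrt 2)⁻¹ : ℂ) ^ 2 = 2⁻¹ := by
    rw [inv_pow, ← Complex.ofReal_pow, Real.sq_sqrt (by norm_num)]; norm_num
  have h3 : ((Real.sqrt ((α i : ℝ) + 1) : ℝ) : ℂ) ^ 2 = (α i : ℂ) + 1 := by
    rw [← Complex.ofReal_pow, Real.sq_sqrt (by positivity)]; push_cast; rfl
  have h4 : ((Real.sqrt (α i : ℝ) : ℝ) : ℂ) ^ 2 = (α i : ℂ) := by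
    rw [← Complex.ofReal_pow, Real.sq_sqrt (by positivity)]; push_cast; rfl
  have r1 : raiseIdx i α i = α i + 1 := by simp [raiseIdx]
  -- At `α i = 0` raising does not undo lowering, but the lowering term is absent. In both cases the
  -- double raising and double lowering terms of `Q_i²` and `P_i²` cancel.
  rcases eq_or_ne (α i) 0 with h0 | h0
  · simp only [shiftedNumberOp, smul_apply, add_apply, mul_apply_eq_comp, one_apply_eq_self,
      posOp_numberSchwartz, momOp_numberSchwartz, map_smul, map_add, map_sub, h0, Nat.cast_zero,
      Real.sqrt_zero, mul_zero, Complex.ofReal_zero, zero_smul, map_zero, r1, lowerIdx_raiseIdx]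
    ext q
    simp only [smul_apply, add_apply, sub_apply, smul_eq_mul, zero_apply]
    push_cast
    simp only [zero_add, Real.sqrt_one, Complex.ofReal_one]
    linear_combination numberSchwartz α q * (h2 - 2⁻¹ * (Real.sqrt 2 : ℂ)⁻¹ ^ 2 * Complex.I_sq) +
      (Real.sqrt 2 : ℂ)⁻¹ ^ 2 * (Real.sqrt (1 + 1) : ℂ) *
        numberSchwartz (raiseIdx i (raiseIdx i α)) q * 2⁻¹ * Complex.I_sq
  · have l1 : ((lowerIdx i α i : ℕ) : ℝ) + 1 = α i := by
      simp only [lowerIdx, Function.update_self]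
      rw [Nat.cast_sub (by omega)]; simp
    simp only [shiftedNumberOp, smul_apply, add_apply, mul_apply_eq_comp, one_apply_eq_self,
      posOp_numberSchwartz, momOp_numberSchwartz, map_smul, map_add, map_sub, r1,
      lowerIdx_raiseIdx, raiseIdx_lowerIdx h0, l1, Nat.cast_add, Nat.cast_one]
    ext q
    simp only [smul_apply, add_apply, sub_apply, smul_eq_mul]
    push_cast
    linear_combination ((Real.sqrt 2 : ℂ)⁻¹ ^ 2 * 2⁻¹ *
        (Real.sqrt (α i) * Real.sqrt (lowerIdx i α i) * numberSchwartz (lowerIdx i (lowerIdx i α)) q +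
        Real.sqrt (α i + 1) * Real.sqrt (α i + 1 + 1) * numberSchwartz (raiseIdx i (raiseIdx i α)) q -
        numberSchwartz α q * ((Real.sqrt (α i) : ℂ) ^ 2 + (Real.sqrt (α i + 1) : ℂ) ^ 2))) *
          Complex.I_sq + (Real.sqrt 2 : ℂ)⁻¹ ^ 2 * numberSchwartz α q * (h3 + h4) +
      numberSchwartz α q * (2 * (α i : ℂ) + 1) * h2

theorem exists_pqAlg_idxWeight (n : ℕ) (r : ℕ) : ∃ A ∈ pqAlg n, ∀ α : Fin n → ℕ,
    A (numberSchwartz α) = ((idxWeight α ^ r : ℝ) : ℂ) • numberSchwartz α := by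
  classical
  have h1 : ∀ s : Finset (Fin n), ∃ A ∈ pqAlg n, ∀ α : Fin n → ℕ,
      A (numberSchwartz α) = ((∏ i ∈ s, ((α i : ℝ) + 1) : ℝ) : ℂ) • numberSchwartz α := by
    intro s
    induction s using Finset.induction_on with
    | empty => exact ⟨1, one_mem _, fun α => by simp⟩
    | insert i s hi ih =>
      obtain ⟨A, hA, h⟩ := ih
      refine ⟨A * shiftedNumberOp i, mul_mem hA (shiftedNumberOp_mem_pqAlg i), fun α => ?_⟩
      rw [mul_apply_eq_comp, shiftedNumberOp_numberSchwartz, map_smul, h, smul_smul,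
        Finset.prod_insert hi]
      push_cast
      rfl
  obtain ⟨A, hA, h⟩ := h1 Finset.univ
  induction r with
  | zero => exact ⟨1, one_mem _, fun α => by simp⟩
  | succ r ih =>
    obtain ⟨B, hB, h'⟩ := ih
    refine ⟨B * A, mul_mem hB hA, fun α => ?_⟩
    rw [mul_apply_eq_comp, h, map_smul, h', smul_smul, pow_succ', idxWeight]
    push_cast
    rfl

/-! ### Hermite expansion of Schwartz functions -/

/-- The Hermite coefficients of a Schwartz function. -/
def hermiteCoeff : 𝓢(Config n, ℂ) →ₗ[ℂ] ((Fin n → ℕ) → ℂ) where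
  toFun f := fun γ => ⟪numberVec γ, toHilb f⟫_ℂ
  map_add' f g := by
    funext γ
    simp only [← hilbCLM_apply, map_add, inner_add_right, Pi.add_apply]
  map_smul' c f := by
    funext γ
    simp only [← hilbCLM_apply, map_smul, inner_smul_right, Pi.smul_apply, smul_eq_mul,
      RingHom.id_apply]

theorem hermiteCoeff_apply (f : 𝓢(Config n, ℂ)) (γ : Fin n → ℕ) :
    hermiteCoeff f γ = ⟪numberVec γ, toHilb f⟫_ℂ := rfl

/-- The weight is an eigenvalue of `A` at `|γ⟩`. Moving `A` to `f` by its formal adjoint,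
Cauchy-Schwarz leaves the `L²` norm of `A' f`, a continuous seminorm. -/
theorem exists_hermiteCoeff_bound (n r : ℕ) : ∃ p : Seminorm ℂ 𝓢(Config n, ℂ), Continuous p ∧
    ∀ f γ, idxWeight γ ^ r * ‖hermiteCoeff f γ‖ ≤ p f := by
  obtain ⟨A, hA, h⟩ := exists_pqAlg_idxWeight n r
  obtain ⟨A', -, hA'⟩ := exists_formalAdjoint hA
  refine ⟨(l2Seminorm n).comp A'.toLinearMap, (continuous_l2Seminorm n).comp A'.continuous,
    fun f γ => ?_⟩
  have h1 := hA' (numberSchwartz γ) f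
  rw [h, ← hilbCLM_apply (_ • _), map_smul, hilbCLM_apply, toHilb_numberSchwartz, inner_smul_left,
    Complex.conj_ofReal] at h1
  have h2 := congrArg norm h1
  rw [norm_mul, Complex.norm_real, Real.norm_of_nonneg (by have := idxWeight_pos γ; positivity)]
    at h2
  rw [hermiteCoeff_apply, h2]
  refine (norm_inner_le_norm _ _).trans ?_
  rw [norm_numberVec, one_mul]
  exact le_rfl

/-- The Hermite coefficients of a Schwartz function as a Schwartz multisequence. -/
def hermiteAnalysis (n : ℕ) : 𝓢(Config n, ℂ) →ₗ[ℂ] SchwartzSeq n :=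
  hermiteCoeff.codRestrict (schwartzSeqSubmodule n) fun f => mem_schwartzSeqSubmodule fun r => by
    obtain ⟨p, -, hp⟩ := exists_hermiteCoeff_bound n r
    exact ⟨p f, hp f⟩

theorem hermiteAnalysis_coeff (f : 𝓢(Config n, ℂ)) (γ : Fin n → ℕ) :
    (hermiteAnalysis n f).coeff γ = ⟪numberVec γ, toHilb f⟫_ℂ := rfl

theorem continuous_hermiteAnalysis (n : ℕ) : Continuous (hermiteAnalysis n) :=
  continuous_to_schwartzSeq _ fun r => exists_hermiteCoeff_bound n r

theorem summable_seminorm_hermite (a : SchwartzSeq n) (k m : ℕ) :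
    Summable fun γ => SchwartzMap.seminorm ℂ k m (a.coeff γ • numberSchwartz γ) := by
  obtain ⟨C, hC, r, h⟩ := hermiteBounded_seminorm (n := n) k m
  refine ((summable_idxWeight_pow_mul_norm_coeff a r).mul_left C).of_nonneg_of_le
    (fun γ => apply_nonneg _ _) fun γ => ?_
  rw [map_smul_eq_mul]
  calc _ ≤ ‖a.coeff γ‖ * (C * idxWeight γ ^ r) := by gcongr; exact h γ
    _ = _ := by ring

/-- The Schwartz function with given Hermite coefficients. -/
def hermiteSynthesis (n : ℕ) : SchwartzSeq n →ₗ[ℂ] 𝓢(Config n, ℂ) where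
  toFun a := schwartzTsum (fun γ => a.coeff γ • numberSchwartz γ) (summable_seminorm_hermite a)
  map_add' a b := by
    ext q
    rw [add_apply, schwartzTsum_apply, schwartzTsum_apply, schwartzTsum_apply,
      ← (summable_schwartz_apply (summable_seminorm_hermite a) q).tsum_add
        (summable_schwartz_apply (summable_seminorm_hermite b) q)]
    exact tsum_congr fun γ => by simp [add_mul]
  map_smul' c a := by
    ext q
    rw [RingHom.id_apply, smul_apply, schwartzTsum_apply, schwartzTsum_apply,
      ← tsum_const_smul'' c]
    exact tsum_congr fun γ => by simp [mul_assoc]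

theorem hasSum_hermiteSynthesis (a : SchwartzSeq n) :
    HasSum (fun γ => a.coeff γ • numberSchwartz γ) (hermiteSynthesis n a) :=
  hasSum_schwartzTsum (summable_seminorm_hermite a)

theorem continuous_hermiteSynthesis (n : ℕ) : Continuous (hermiteSynthesis n) := by
  refine WithSeminorms.continuous_of_continuous_comp (schwartz_withSeminorms ℂ (Config n) ℂ) _ ?_
  rintro ⟨k, m⟩
  obtain ⟨C, hC, r, h⟩ := hermiteBounded_seminorm (n := n) k m
  let c : NNReal := ⟨C * weightSum n, mul_nonneg hC (weightSum_nonneg n)⟩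
  have := (schwartzSeq_withSeminorms n).topologicalAddGroup
  have hcont : Continuous (c • schwartzSeqSeminorm n (fun _ => r + 2) : Seminorm ℂ (SchwartzSeq n)) := by
    have h := (schwartzSeq_withSeminorms n).continuous_seminorm (fun _ => r + 2)
    change Continuous fun x => (c : ℝ) * schwartzSeqSeminorm n (fun _ => r + 2) x
    fun_prop
  refine Seminorm.continuous_of_le hcont fun a => ?_
  refine (seminorm_schwartzTsum_le (summable_seminorm_hermite a) k m).trans ?_
  change _ ≤ C * weightSum n * schwartzSeqSeminorm n (fun _ => r + 2) a
  calc _ ≤ ∑' γ, C * (idxWeight γ ^ r * ‖a.coeff γ‖) :=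
        (summable_seminorm_hermite a k m).tsum_le_tsum (fun γ => by
          rw [map_smul_eq_mul]
          calc _ ≤ ‖a.coeff γ‖ * (C * idxWeight γ ^ r) := by gcongr; exact h γ
            _ = _ := by ring) ((summable_idxWeight_pow_mul_norm_coeff a r).mul_left C)
    _ ≤ _ := by
        rw [tsum_mul_left, mul_assoc]
        gcongr
        exact tsum_idxWeight_pow_mul_norm_coeff_le a r

theorem hermiteAnalysis_synthesis (a : SchwartzSeq n) :
    hermiteAnalysis n (hermiteSynthesis n a) = a := by
  classical
  refine SchwartzSeq.ext fun γ => ?_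
  have h := (((hasSum_hermiteSynthesis a).mapL (hilbCLM n)).mapL (innerSL ℂ (numberVec γ)))
  have e : ∀ δ, innerSL ℂ (numberVec γ) (hilbCLM n (a.coeff δ • numberSchwartz δ)) =
      if δ = γ then a.coeff γ else 0 := fun δ => by
    rw [map_smul, hilbCLM_apply, toHilb_numberSchwartz, innerSL_apply_apply, inner_smul_right,
      inner_numberVec]
    by_cases hδ : γ = δ
    · simp [hδ]
    · simp [hδ, Ne.symm hδ]
  simp only [e] at h
  exact h.unique (hasSum_ite_eq γ (a.coeff γ))

theorem eq_of_hermiteAnalysis_eq {f g : 𝓢(Config n, ℂ)}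
    (h : hermiteAnalysis n f = hermiteAnalysis n g) : f = g := by
  rw [← sub_eq_zero, ← map_sub] at h
  have h1 : toHilb (f - g) = 0 := eq_zero_of_inner_numberVec_eq_zero fun γ => by
    rw [← hermiteAnalysis_coeff, h]; rfl
  have h2 : toHilb (f - g) = toHilb 0 := by
    rw [h1, ← hilbCLM_apply, map_zero]
  exact sub_eq_zero.1 (SchwartzMap.injective_toLp 2 volume h2)

/-- The Hermite expansion isomorphism `𝓢(ℝⁿ) ≅ 𝔰_n`. -/
def hermiteEquiv (n : ℕ) : 𝓢(Config n, ℂ) ≃L[ℂ] SchwartzSeq n where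
  toLinearEquiv := LinearEquiv.ofLinearMap (hermiteAnalysis n) (hermiteSynthesis n)
    (LinearMap.ext hermiteAnalysis_synthesis)
    -- Synthesis is a right inverse of analysis, and analysis is injective, so it is a two-sided
    -- inverse.
    (LinearMap.ext fun _ => eq_of_hermiteAnalysis_eq (hermiteAnalysis_synthesis _))
  continuous_toFun := continuous_hermiteAnalysis n
  continuous_invFun := continuous_hermiteSynthesis n

theorem hasSum_hermiteEquiv_symm (a : SchwartzSeq n) :
    HasSum (fun γ => a.coeff γ • numberSchwartz γ) ((hermiteEquiv n).symm a) :=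
  hasSum_hermiteSynthesis a

end

end QuantumSchwartz

namespace QuantumSchwartz

noncomputable section

variable {n : ℕ}

/-! ### Normal ordering -/

theorem mul_prod_ofFn_pow {M : Type*} [Monoid M] {n : ℕ} (x : Fin n → M)
    (hx : ∀ i j, Commute (x i) (x j)) (β : Fin n → ℕ) (i : Fin n) :
    x i * (List.ofFn fun j => x j ^ β j).prod =
      (List.ofFn fun j => x j ^ raiseIdx i β j).prod := by
  induction n with
  | zero => exact i.elim0
  | succ n ih =>
    rw [List.ofFn_succ, List.ofFn_succ, List.prod_cons, List.prod_cons]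
    cases i using Fin.cases with
    | zero =>
      have h : ∀ j : Fin n, raiseIdx 0 β j.succ = β j.succ := fun j => by simp [raiseIdx]
      simp only [h]
      rw [← mul_assoc, ← pow_succ']
      simp [raiseIdx]
    | succ i =>
      have h : ∀ j : Fin n, raiseIdx i.succ β j.succ = raiseIdx i (fun j => β j.succ) j := fun j => by
        rcases eq_or_ne j i with rfl | hj
        · simp [raiseIdx]
        · simp [raiseIdx, hj]
      have h0 : raiseIdx i.succ β 0 = β 0 := by simp [raiseIdx, (Fin.succ_ne_zero i).symm]
      simp only [h, h0]
      rw [← ih (fun j => x j.succ) (fun _ _ => hx _ _), ← mul_assoc,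
        ((hx i.succ 0).pow_right (β 0)).eq, mul_assoc]

theorem lineDeriv_lineDeriv_comm (v w : Config n) (f : 𝓢(Config n, ℂ)) :
    ∂_{v} (∂_{w} f) = ∂_{w} (∂_{v} f) := by
  have key : ∀ (v w : Config n) (x : Config n),
      (∂_{v} (∂_{w} f)) x = fderiv ℝ (fderiv ℝ f) x v w := fun v w x => by
    have h : (⇑(∂_{w} f : 𝓢(Config n, ℂ)) : Config n → ℂ) = fun x => fderiv ℝ f x w :=
      funext fun x => lineDerivOp_apply_eq_fderiv w f x
    have hd : DifferentiableAt ℝ (fderiv ℝ f) x :=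
      ((f.smooth 2).fderiv_right (m := 1) (by norm_num)).differentiable (by norm_num) x
    rw [lineDerivOp_apply_eq_fderiv, h, fderiv_clm_apply hd (differentiableAt_const w)]
    simp
  ext x
  rw [key, key]
  exact ((f.contDiffAt 2).isSymmSndFDerivAt (by simp)).eq v w

theorem momOp_commute (i j : Fin n) : Commute (momOp i : 𝓢(Config n, ℂ) →L[ℂ] 𝓢(Config n, ℂ)) (momOp j) := by
  ext1 f
  simp only [momOp, mul_apply_eq_comp, smul_apply, map_smul, LineDeriv.lineDerivOpCLM_apply]
  rw [lineDeriv_lineDeriv_comm]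

theorem posOp_commute (i j : Fin n) : Commute (posOp i : 𝓢(Config n, ℂ) →L[ℂ] 𝓢(Config n, ℂ)) (posOp j) := by
  ext f q
  simp only [mul_apply_eq_comp, posOp_apply]
  ring

/-- The canonical commutation relation, from the product rule. -/
theorem posOp_mul_momOp (i j : Fin n) :
    posOp i * momOp j = momOp j * posOp i +
      (if i = j then Complex.I else 0) • (1 : 𝓢(Config n, ℂ) →L[ℂ] 𝓢(Config n, ℂ)) := by
  ext f q
  have hc : HasFDerivAt (fun q : Config n => ((q i : ℝ) : ℂ))
      (Complex.ofRealCLM.comp (EuclideanSpace.proj i : Config n →L[ℝ] ℝ)) q :=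
    (Complex.ofRealCLM.comp (EuclideanSpace.proj i : Config n →L[ℝ] ℝ)).hasFDerivAt
  have hf : HasFDerivAt f (fderiv ℝ f q) q := f.hasFDerivAt q
  have h : (⇑(posOp i f) : Config n → ℂ) = (fun q : Config n => ((q i : ℝ) : ℂ)) * f :=
    funext fun q => posOp_apply i f q
  simp only [mul_apply_eq_comp, add_apply, smul_apply, one_apply_eq_self, posOp_apply, momOp,
    LineDeriv.lineDerivOpCLM_apply, lineDerivOp_apply_eq_fderiv, h, (hc.mul hf).fderiv, smul_eq_mul]
  by_cases hij : i = j
  · simp [hij]; ring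
  · simp [hij]; ring

/-- The span of the normally ordered monomials `P^β Q^α`. -/
def normalSpan (n : ℕ) : Submodule ℂ (𝓢(Config n, ℂ) →L[ℂ] 𝓢(Config n, ℂ)) :=
  Submodule.span ℂ (Set.range fun k : (Fin n → ℕ) × (Fin n → ℕ) => momPow k.2 * posPow k.1)

theorem momPow_mul_posPow_mem (α β : Fin n → ℕ) : momPow β * posPow α ∈ normalSpan n :=
  Submodule.subset_span ⟨(α, β), rfl⟩

theorem momOp_mul_momPow (i : Fin n) (β : Fin n → ℕ) :
    momOp i * momPow β = momPow (raiseIdx i β) :=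
  mul_prod_ofFn_pow _ momOp_commute β i

theorem posOp_mul_posPow (i : Fin n) (α : Fin n → ℕ) :
    posOp i * posPow α = posPow (raiseIdx i α) :=
  mul_prod_ofFn_pow _ posOp_commute α i

theorem momPow_zero : momPow (0 : Fin n → ℕ) = 1 := by
  simp [momPow]

theorem posPow_zero : posPow (0 : Fin n → ℕ) = 1 := by
  simp [posPow]

theorem mul_mem_normalSpan_of_monomials {A : 𝓢(Config n, ℂ) →L[ℂ] 𝓢(Config n, ℂ)}
    (hA : ∀ α β : Fin n → ℕ, A * (momPow β * posPow α) ∈ normalSpan n)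
    {v : 𝓢(Config n, ℂ) →L[ℂ] 𝓢(Config n, ℂ)} (hv : v ∈ normalSpan n) :
    A * v ∈ normalSpan n := by
  induction hv using Submodule.span_induction with
  | mem v hv =>
    obtain ⟨k, rfl⟩ := hv
    exact hA _ _
  | zero => rw [mul_zero]; exact zero_mem _
  | add v w _ _ hv hw => rw [mul_add]; exact add_mem hv hw
  | smul c v _ hv => rw [mul_smul_comm]; exact Submodule.smul_mem _ c hv

theorem momOp_mul_mem_normalSpan (i : Fin n) {v : 𝓢(Config n, ℂ) →L[ℂ] 𝓢(Config n, ℂ)}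
    (hv : v ∈ normalSpan n) : momOp i * v ∈ normalSpan n :=
  mul_mem_normalSpan_of_monomials (fun α β => by
    rw [← mul_assoc, momOp_mul_momPow]
    exact momPow_mul_posPow_mem _ _) hv

/-- Move `Q_i` to the right past one `P_j` at a time. The commutator term is already normally
ordered, and the other term has a shorter momentum word, so induction on `|β|` finishes. -/
theorem posOp_mul_mem_normalSpan (i : Fin n) {v : 𝓢(Config n, ℂ) →L[ℂ] 𝓢(Config n, ℂ)}
    (hv : v ∈ normalSpan n) : posOp i * v ∈ normalSpan n := by
  refine mul_mem_normalSpan_of_monomials (fun α β => ?_) hv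
  induction hm : ∑ j, β j using Nat.strong_induction_on generalizing β with
  | _ m ih =>
    by_cases h0 : β = 0
    · rw [h0, momPow_zero, one_mul, posOp_mul_posPow, ← one_mul (posPow _), ← momPow_zero]
      exact momPow_mul_posPow_mem _ _
    · obtain ⟨j, hj⟩ : ∃ j, β j ≠ 0 := by
        by_contra! h
        exact h0 (funext h)
      have hlt : ∑ k, lowerIdx j β k < m := by
        rw [← hm]
        refine Finset.sum_lt_sum (fun k _ => ?_) ⟨j, Finset.mem_univ j, ?_⟩
        · rcases eq_or_ne k j with rfl | hk
          · simp [lowerIdx]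
          · simp [lowerIdx, hk]
        · simp only [lowerIdx, Function.update_self]; omega
      have hsplit : momPow β = momOp j * momPow (lowerIdx j β) := by
        rw [momOp_mul_momPow, raiseIdx_lowerIdx hj]
      have e : posOp i * (momPow β * posPow α) =
          momOp j * (posOp i * (momPow (lowerIdx j β) * posPow α)) +
          (if i = j then Complex.I else 0) • (momPow (lowerIdx j β) * posPow α) := by
        rw [hsplit, mul_assoc (momOp j), ← mul_assoc (posOp i), posOp_mul_momOp, add_mul, mul_assoc,
          smul_mul_assoc, one_mul]
      rw [e]
      exact add_mem (momOp_mul_mem_normalSpan j (ih _ hlt _ rfl))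
        (Submodule.smul_mem _ _ (momPow_mul_posPow_mem _ _))

theorem mem_normalSpan_of_mem_pqAlg {A : 𝓢(Config n, ℂ) →L[ℂ] 𝓢(Config n, ℂ)} (hA : A ∈ pqAlg n) :
    A ∈ normalSpan n := by
  -- Invariance under left multiplication passes through sums and products of generators; membership
  -- of `A` follows by applying it to `1`.
  have key : ∀ v ∈ normalSpan n, A * v ∈ normalSpan n := by
    induction hA using Algebra.adjoin_induction with
    | mem A hA =>
      rcases hA with ⟨i, rfl⟩ | ⟨i, rfl⟩
      · exact fun v hv => posOp_mul_mem_normalSpan i hv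
      · exact fun v hv => momOp_mul_mem_normalSpan i hv
    | algebraMap c =>
      intro v hv
      rw [Algebra.algebraMap_eq_smul_one, smul_mul_assoc, one_mul]
      exact Submodule.smul_mem _ c hv
    | add A B _ _ hA hB =>
      intro v hv
      rw [add_mul]
      exact add_mem (hA v hv) (hB v hv)
    | mul A B _ _ hA hB =>
      intro v hv
      rw [mul_assoc]
      exact hA _ (hB v hv)
  have h1 : (1 : 𝓢(Config n, ℂ) →L[ℂ] 𝓢(Config n, ℂ)) ∈ normalSpan n := by
    have := momPow_mul_posPow_mem (0 : Fin n → ℕ) 0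
    rwa [momPow_zero, posPow_zero, one_mul] at this
  simpa using key 1 h1

end

end QuantumSchwartz

namespace QuantumSchwartz

noncomputable section

variable {N : ℕ}

/-! ### The matrix isomorphism -/

/-- The first half of a double multi-index. -/
def leftIdx (γ : Fin (N + N) → ℕ) : Fin N → ℕ := fun i => γ (Fin.castAdd N i)

/-- The second half of a double multi-index. -/
def rightIdx (γ : Fin (N + N) → ℕ) : Fin N → ℕ := fun i => γ (Fin.natAdd N i)

theorem append_leftIdx_rightIdx (γ : Fin (N + N) → ℕ) :
    Fin.append (leftIdx γ) (rightIdx γ) = γ := Fin.append_castAdd_natAdd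

theorem leftIdx_append (α α' : Fin N → ℕ) : leftIdx (Fin.append α α') = α := by
  funext i; simp [leftIdx]

theorem rightIdx_append (α α' : Fin N → ℕ) : rightIdx (Fin.append α α') = α' := by
  funext i; exact Fin.append_right α α' i

theorem eq_of_leftIdx_rightIdx {γ δ : Fin (N + N) → ℕ} (h1 : leftIdx γ = leftIdx δ)
    (h2 : rightIdx γ = rightIdx δ) : γ = δ := by
  rw [← append_leftIdx_rightIdx γ, h1, h2, append_leftIdx_rightIdx]

theorem idxWeight_eq_mul (γ : Fin (N + N) → ℕ) :
    idxWeight γ = idxWeight (leftIdx γ) * idxWeight (rightIdx γ) := Fin.prod_univ_add _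

theorem idxWeight_leftIdx_le (γ : Fin (N + N) → ℕ) : idxWeight (leftIdx γ) ≤ idxWeight γ := by
  rw [idxWeight_eq_mul]
  exact le_mul_of_one_le_right (idxWeight_pos _).le (one_le_idxWeight _)

theorem idxWeight_rightIdx_le (γ : Fin (N + N) → ℕ) : idxWeight (rightIdx γ) ≤ idxWeight γ := by
  rw [idxWeight_eq_mul]
  exact le_mul_of_one_le_left (idxWeight_pos _).le (one_le_idxWeight _)

instance (N : ℕ) : IsTopologicalAddGroup (SchwartzOperator N) :=
  (schwartzOperator_withSeminorms N).topologicalAddGroup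

instance (N : ℕ) : ContinuousSMul ℂ (SchwartzOperator N) :=
  (schwartzOperator_withSeminorms N).continuousSMul

/-- The forms `⟨A f | T A' g⟩` are bounded on unit vectors by a continuous seminorm of `T`. -/
def FormBounded (A A' : 𝓢(Config N, ℂ) →L[ℂ] 𝓢(Config N, ℂ)) : Prop :=
  ∃ p : Seminorm ℂ (SchwartzOperator N), Continuous p ∧ ∀ (T : SchwartzOperator N)
    (f g : 𝓢(Config N, ℂ)), ‖toHilb f‖ ≤ 1 → ‖toHilb g‖ ≤ 1 →
    ‖⟪toHilb (A f), T.op (toHilb (A' g))⟫_ℂ‖ ≤ p T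

theorem continuous_nnreal_smul_seminorm {E : Type*} [AddCommGroup E] [Module ℂ E]
    [TopologicalSpace E] {p : Seminorm ℂ E} (hp : Continuous p) (c : NNReal) :
    Continuous (c • p : Seminorm ℂ E) := by
  change Continuous fun x => (c : ℝ) * p x
  fun_prop

theorem continuous_add_seminorm {E : Type*} [AddCommGroup E] [Module ℂ E]
    [TopologicalSpace E] {p q : Seminorm ℂ E} (hp : Continuous p) (hq : Continuous q) :
    Continuous (p + q : Seminorm ℂ E) := by
  change Continuous fun x => p x + q x
  fun_prop

theorem FormBounded.of_mem_left {A A' : 𝓢(Config N, ℂ) →L[ℂ] 𝓢(Config N, ℂ)}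
    (h : ∀ α β : Fin N → ℕ, FormBounded (momPow β * posPow α) A') (hA : A ∈ normalSpan N) :
    FormBounded A A' := by
  induction hA using Submodule.span_induction with
  | mem A hA =>
    obtain ⟨k, rfl⟩ := hA
    exact h _ _
  | zero =>
    refine ⟨0, continuous_const, fun T f g _ _ => ?_⟩
    rw [zero_apply, ← hilbCLM_apply 0, map_zero, inner_zero_left, norm_zero]
    exact le_rfl
  | add A B _ _ hA hB =>
    obtain ⟨p, hp, hA⟩ := hA
    obtain ⟨q, hq, hB⟩ := hB
    refine ⟨p + q, continuous_add_seminorm hp hq, fun T f g hf hg => ?_⟩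
    rw [add_apply, ← hilbCLM_apply (_ + _), map_add, inner_add_left]
    exact (norm_add_le _ _).trans (add_le_add (hA T f g hf hg) (hB T f g hf hg))
  | smul c A _ hA =>
    obtain ⟨p, hp, hA⟩ := hA
    refine ⟨‖c‖₊ • p, continuous_nnreal_smul_seminorm hp _, fun T f g hf hg => ?_⟩
    rw [smul_apply, ← hilbCLM_apply (_ • _), map_smul, inner_smul_left, norm_mul, RCLike.norm_conj]
    exact mul_le_mul_of_nonneg_left (hA T f g hf hg) (norm_nonneg c)

theorem FormBounded.of_mem_right {A A' : 𝓢(Config N, ℂ) →L[ℂ] 𝓢(Config N, ℂ)}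
    (h : ∀ α β : Fin N → ℕ, FormBounded A (momPow β * posPow α)) (hA : A' ∈ normalSpan N) :
    FormBounded A A' := by
  induction hA using Submodule.span_induction with
  | mem A hA =>
    obtain ⟨k, rfl⟩ := hA
    exact h _ _
  | zero =>
    refine ⟨0, continuous_const, fun T f g _ _ => ?_⟩
    rw [zero_apply, ← hilbCLM_apply 0, map_zero, map_zero, inner_zero_right, norm_zero]
    exact le_rfl
  | add A B _ _ hA hB =>
    obtain ⟨p, hp, hA⟩ := hA
    obtain ⟨q, hq, hB⟩ := hB
    refine ⟨p + q, continuous_add_seminorm hp hq, fun T f g hf hg => ?_⟩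
    rw [add_apply, ← hilbCLM_apply (_ + _), map_add, map_add, inner_add_right]
    exact (norm_add_le _ _).trans (add_le_add (hA T f g hf hg) (hB T f g hf hg))
  | smul c A _ hA =>
    obtain ⟨p, hp, hA⟩ := hA
    refine ⟨‖c‖₊ • p, continuous_nnreal_smul_seminorm hp _, fun T f g hf hg => ?_⟩
    rw [smul_apply, ← hilbCLM_apply (_ • _), map_smul, map_smul, inner_smul_right, norm_mul]
    exact mul_le_mul_of_nonneg_left (hA T f g hf hg) (norm_nonneg c)

/-- The defining seminorms only test normally ordered monomials; normal ordering and (anti)linearity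
in each slot extend their control to all polynomials in `Q` and `P`. -/
theorem formBounded_of_mem_pqAlg {A A' : 𝓢(Config N, ℂ) →L[ℂ] 𝓢(Config N, ℂ)}
    (hA : A ∈ pqAlg N) (hA' : A' ∈ pqAlg N) : FormBounded A A' := by
  refine FormBounded.of_mem_left (fun α β => FormBounded.of_mem_right (fun α' β' => ?_)
    (mem_normalSpan_of_mem_pqAlg hA')) (mem_normalSpan_of_mem_pqAlg hA)
  refine ⟨schwartzOperatorSeminorm N (α, α', β, β'),
    (schwartzOperator_withSeminorms N).continuous_seminorm _, fun T f g hf hg => ?_⟩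
  exact le_csSup (T.isSchwartz (α, α', β, β')) ⟨f, g, hf, hg, rfl⟩

/-- The matrix of a Schwartz operator, as a function of the double multi-index. -/
def matrixCoeff : SchwartzOperator N →ₗ[ℂ] ((Fin (N + N) → ℕ) → ℂ) where
  toFun T := fun γ => matrixElem T.op (leftIdx γ) (rightIdx γ)
  map_add' S T := by
    funext γ
    simp only [matrixElem, map_add, add_apply, inner_add_right, Pi.add_apply]
  map_smul' c T := by
    funext γ
    simp only [matrixElem, map_smul, smul_apply, inner_smul_right, Pi.smul_apply, smul_eq_mul,
      RingHom.id_apply]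

/-- The weight operator is placed on both sides of `T`; its two eigenvalues multiply to the weight
of the double index. -/
theorem exists_matrixCoeff_bound (N r : ℕ) : ∃ p : Seminorm ℂ (SchwartzOperator N), Continuous p ∧
    ∀ T γ, idxWeight γ ^ r * ‖matrixCoeff T γ‖ ≤ p T := by
  obtain ⟨A, hA, h⟩ := exists_pqAlg_idxWeight N r
  obtain ⟨p, hp, hb⟩ := formBounded_of_mem_pqAlg hA hA
  refine ⟨p, hp, fun T γ => ?_⟩
  have hn : ∀ α : Fin N → ℕ, ‖toHilb (numberSchwartz α)‖ ≤ 1 := fun α => by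
    rw [toHilb_numberSchwartz, norm_numberVec]
  have h1 := hb T (numberSchwartz (leftIdx γ)) (numberSchwartz (rightIdx γ)) (hn _) (hn _)
  have w1 := idxWeight_pos (leftIdx γ)
  have w2 := idxWeight_pos (rightIdx γ)
  rw [h, h, ← hilbCLM_apply (_ • _), ← hilbCLM_apply (_ • _), map_smul, map_smul, map_smul,
    hilbCLM_apply, hilbCLM_apply, toHilb_numberSchwartz, toHilb_numberSchwartz, inner_smul_left,
    inner_smul_right, Complex.conj_ofReal, norm_mul, norm_mul, Complex.norm_real, Complex.norm_real,
    Real.norm_of_nonneg (by positivity), Real.norm_of_nonneg (by positivity), ← mul_assoc,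
    ← mul_pow, ← idxWeight_eq_mul] at h1
  exact h1

/-- The matrix of a Schwartz operator as a Schwartz multisequence. -/
def matrixSeq (N : ℕ) : SchwartzOperator N →ₗ[ℂ] SchwartzSeq (N + N) :=
  matrixCoeff.codRestrict (schwartzSeqSubmodule (N + N)) fun T =>
    mem_schwartzSeqSubmodule fun r => by
      obtain ⟨p, -, hp⟩ := exists_matrixCoeff_bound N r
      exact ⟨p T, hp T⟩

theorem matrixSeq_coeff (T : SchwartzOperator N) (γ : Fin (N + N) → ℕ) :
    (matrixSeq N T).coeff γ = matrixElem T.op (leftIdx γ) (rightIdx γ) := rfl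

theorem continuous_matrixSeq (N : ℕ) : Continuous (matrixSeq N) :=
  continuous_to_schwartzSeq _ fun r => exists_matrixCoeff_bound N r

/-! ### From multisequences back to operators. -/

/-- The rank one operators `|α⟩⟨α'|`. -/
def rankOneOp (γ : Fin (N + N) → ℕ) : Hilb N →L[ℂ] Hilb N :=
  InnerProductSpace.rankOne ℂ (numberVec (leftIdx γ)) (numberVec (rightIdx γ))

theorem inner_rankOneOp (γ : Fin (N + N) → ℕ) (ψ φ : Hilb N) :
    ⟪ψ, rankOneOp γ φ⟫_ℂ = ⟪ψ, numberVec (leftIdx γ)⟫_ℂ * ⟪numberVec (rightIdx γ), φ⟫_ℂ := by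
  rw [rankOneOp, InnerProductSpace.rankOne_apply, inner_smul_right, mul_comm]

theorem summable_rankOneOp (a : SchwartzSeq (N + N)) :
    Summable fun γ => a.coeff γ • rankOneOp γ := by
  refine Summable.of_norm_bounded (summable_norm_coeff a) fun γ => ?_
  rw [norm_smul, rankOneOp, InnerProductSpace.norm_rankOne, norm_numberVec, norm_numberVec,
    mul_one, mul_one]

/-- The bounded operator with a given Schwartz multisequence as its matrix. -/
def opOfSeq (a : SchwartzSeq (N + N)) : Hilb N →L[ℂ] Hilb N := ∑' γ, a.coeff γ • rankOneOp γ

theorem hasSum_opOfSeq (a : SchwartzSeq (N + N)) :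
    HasSum (fun γ => a.coeff γ • rankOneOp γ) (opOfSeq a) := (summable_rankOneOp a).hasSum

theorem hasSum_inner_opOfSeq (a : SchwartzSeq (N + N)) (ψ φ : Hilb N) :
    HasSum (fun γ => a.coeff γ * (⟪ψ, numberVec (leftIdx γ)⟫_ℂ * ⟪numberVec (rightIdx γ), φ⟫_ℂ))
      ⟪ψ, opOfSeq a φ⟫_ℂ := by
  have h := ((hasSum_opOfSeq a).mapL (ContinuousLinearMap.apply ℂ (Hilb N) φ)).mapL (innerSL ℂ ψ)
  refine h.congr_fun fun γ => ?_
  rw [ContinuousLinearMap.apply_apply, smul_apply, innerSL_apply_apply, inner_smul_right,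
    inner_rankOneOp]

/-- Formal adjoints move `A` and `A'` onto the Hermite vectors, where they grow polynomially, so `f`
and `g` enter only through their `L²` norms. The decay of `a` beats the growth; the `+ 2` pays for
summability. -/
theorem exists_opOfSeq_bound {A A' : 𝓢(Config N, ℂ) →L[ℂ] 𝓢(Config N, ℂ)}
    (hA : A ∈ pqAlg N) (hA' : A' ∈ pqAlg N) : ∃ C : ℝ, 0 ≤ C ∧ ∃ r : ℕ,
    ∀ (a : SchwartzSeq (N + N)) (f g : 𝓢(Config N, ℂ)), ‖toHilb f‖ ≤ 1 → ‖toHilb g‖ ≤ 1 →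
      ‖⟪toHilb (A f), opOfSeq a (toHilb (A' g))⟫_ℂ‖ ≤
        C * schwartzSeqSeminorm (N + N) (fun _ => r) a := by
  obtain ⟨B, hB, hAB⟩ := exists_formalAdjoint hA
  obtain ⟨B', hB', hAB'⟩ := exists_formalAdjoint hA'
  obtain ⟨C, hC, r, hb⟩ := hermiteBounded_l2Seminorm.mul_of_mem_pqAlg hB
  obtain ⟨C', hC', r', hb'⟩ := hermiteBounded_l2Seminorm.mul_of_mem_pqAlg hB'
  simp only [one_mul, l2Seminorm_apply] at hb hb'
  refine ⟨C * C' * weightSum (N + N), by have := weightSum_nonneg (N + N); positivity, r + r' + 2,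
    fun a f g hf hg => ?_⟩
  have h := hasSum_inner_opOfSeq a (toHilb (A f)) (toHilb (A' g))
  have hbd : ∀ γ, ‖a.coeff γ * (⟪toHilb (A f), numberVec (leftIdx γ)⟫_ℂ *
      ⟪numberVec (rightIdx γ), toHilb (A' g)⟫_ℂ)‖ ≤
        C * C' * (idxWeight γ ^ (r + r') * ‖a.coeff γ‖) := fun γ => by
    have w1 := idxWeight_pos (leftIdx γ)
    have w2 := idxWeight_pos (rightIdx γ)
    have b1 : ‖⟪toHilb (A f), numberVec (leftIdx γ)⟫_ℂ‖ ≤ C * idxWeight γ ^ r := by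
      rw [← toHilb_numberSchwartz, hAB]
      refine (norm_inner_le_norm _ _).trans ((mul_le_of_le_one_left (norm_nonneg _) hf).trans
        ((hb _).trans ?_))
      gcongr
      exact idxWeight_leftIdx_le γ
    have b2 : ‖⟪numberVec (rightIdx γ), toHilb (A' g)⟫_ℂ‖ ≤ C' * idxWeight γ ^ r' := by
      rw [← toHilb_numberSchwartz, ← hAB'.symm]
      refine (norm_inner_le_norm _ _).trans ((mul_le_of_le_one_right (norm_nonneg _) hg).trans
        ((hb' _).trans ?_))
      gcongr
      exact idxWeight_rightIdx_le γ
    have w := idxWeight_pos γ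
    rw [norm_mul, norm_mul]
    calc _ ≤ ‖a.coeff γ‖ * ((C * idxWeight γ ^ r) * (C' * idxWeight γ ^ r')) := by gcongr
      _ = _ := by ring
  have hs := (summable_idxWeight_pow_mul_norm_coeff a (r + r')).mul_left (C * C')
  rw [← h.tsum_eq]
  refine (tsum_of_norm_bounded hs.hasSum hbd).trans ?_
  rw [tsum_mul_left, mul_assoc (C * C') (weightSum _)]
  exact mul_le_mul_of_nonneg_left (tsum_idxWeight_pow_mul_norm_coeff_le a _) (by positivity)

theorem isSchwartzOperator_opOfSeq (a : SchwartzSeq (N + N)) : IsSchwartzOperator (opOfSeq a) := by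
  intro k
  obtain ⟨C, -, r, h⟩ := exists_opOfSeq_bound
    (mul_mem (momPow_mem_pqAlg k.2.2.1) (posPow_mem_pqAlg k.1))
    (mul_mem (momPow_mem_pqAlg k.2.2.2) (posPow_mem_pqAlg k.2.1))
  refine ⟨C * schwartzSeqSeminorm (N + N) (fun _ => r) a, ?_⟩
  rintro x ⟨ψ, φ, hψ, hφ, rfl⟩
  exact h a ψ φ hψ hφ

/-- The Schwartz operator with a given Schwartz multisequence as its matrix. -/
def seqOperator (N : ℕ) : SchwartzSeq (N + N) →ₗ[ℂ] SchwartzOperator N :=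
  LinearMap.codRestrict (schwartzOperatorSubmodule N)
    { toFun := opOfSeq
      map_add' := fun a b => by
        refine ((hasSum_opOfSeq (a + b)).unique ?_)
        simpa only [map_add, Pi.add_apply, add_smul] using (hasSum_opOfSeq a).add (hasSum_opOfSeq b)
      map_smul' := fun c a => by
        refine ((hasSum_opOfSeq (c • a)).unique ?_)
        simpa only [map_smul, Pi.smul_apply, smul_assoc, RingHom.id_apply] using (hasSum_opOfSeq a).const_smul c }
    isSchwartzOperator_opOfSeq

theorem seqOperator_op (a : SchwartzSeq (N + N)) : (seqOperator N a).op = opOfSeq a := rfl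

theorem continuous_seqOperator (N : ℕ) : Continuous (seqOperator N) := by
  refine WithSeminorms.continuous_of_continuous_comp (schwartzOperator_withSeminorms N) _ fun k => ?_
  obtain ⟨C, hC, r, h⟩ := exists_opOfSeq_bound
    (mul_mem (momPow_mem_pqAlg k.2.2.1) (posPow_mem_pqAlg k.1))
    (mul_mem (momPow_mem_pqAlg k.2.2.2) (posPow_mem_pqAlg k.2.1))
  have := (schwartzSeq_withSeminorms (N + N)).topologicalAddGroup
  refine Seminorm.continuous_of_le (continuous_nnreal_smul_seminorm
    ((schwartzSeq_withSeminorms (N + N)).continuous_seminorm (fun _ => r)) ⟨C, hC⟩) fun a => ?_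
  refine csSup_le (formValues_nonempty k _) ?_
  rintro x ⟨ψ, φ, hψ, hφ, rfl⟩
  exact h a ψ φ hψ hφ

theorem matrixSeq_seqOperator (a : SchwartzSeq (N + N)) : matrixSeq N (seqOperator N a) = a := by
  classical
  refine SchwartzSeq.ext fun γ => ?_
  rw [matrixSeq_coeff, seqOperator_op, matrixElem]
  refine (hasSum_inner_opOfSeq a _ _).unique ?_
  refine (hasSum_ite_eq γ (a.coeff γ)).congr_fun fun δ => ?_
  rw [inner_numberVec, inner_numberVec]
  by_cases h : δ = γ
  · subst h
    simp
  · rw [if_neg h]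
    split_ifs with h1 h2
    · exact absurd (eq_of_leftIdx_rightIdx h1.symm h2) h
    all_goals simp

theorem op_ext {S T : Hilb N →L[ℂ] Hilb N} (h : ∀ α α', matrixElem S α α' = matrixElem T α α') :
    S = T := by
  refine ContinuousLinearMap.ext_on (s := Set.range (numberBasis N)) ?_ ?_
  · rw [Submodule.dense_iff_topologicalClosure_eq_top]
    exact (numberBasis N).dense_span
  · rintro _ ⟨α', rfl⟩
    rw [numberBasis_apply, ← sub_eq_zero]
    refine eq_zero_of_inner_numberVec_eq_zero fun α => ?_
    rw [inner_sub_right, sub_eq_zero]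
    exact h α α'

theorem eq_of_matrixSeq_eq {S T : SchwartzOperator N} (h : matrixSeq N S = matrixSeq N T) :
    S = T := by
  refine Subtype.ext (op_ext fun α α' => ?_)
  have h1 := congrArg (fun a => SchwartzSeq.coeff a (Fin.append α α')) h
  simp only [matrixSeq_coeff, leftIdx_append, rightIdx_append] at h1
  exact h1

/-- The matrix isomorphism `𝔖(H) ≅ 𝔰_{2N}`. -/
def matrixEquiv (N : ℕ) : SchwartzOperator N ≃L[ℂ] SchwartzSeq (N + N) where
  toLinearEquiv := LinearEquiv.ofLinearMap (matrixSeq N) (seqOperator N)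
    (LinearMap.ext matrixSeq_seqOperator)
    (LinearMap.ext fun _ => eq_of_matrixSeq_eq (matrixSeq_seqOperator _))
  continuous_toFun := continuous_matrixSeq N
  continuous_invFun := continuous_seqOperator N

theorem matrixEquiv_coeff (T : SchwartzOperator N) (γ : Fin (N + N) → ℕ) :
    (matrixEquiv N T).coeff γ = matrixElem T.op (leftIdx γ) (rightIdx γ) := rfl

theorem opOfSeq_matrixEquiv (T : SchwartzOperator N) : opOfSeq (matrixEquiv N T) = T.op := by
  rw [← seqOperator_op]
  exact congrArg SchwartzOperator.op ((matrixEquiv N).symm_apply_apply T)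

theorem hasSum_inner_op (T : SchwartzOperator N) (ψ φ : Hilb N) :
    HasSum (fun γ => (matrixEquiv N T).coeff γ *
      (⟪ψ, numberVec (leftIdx γ)⟫_ℂ * ⟪numberVec (rightIdx γ), φ⟫_ℂ)) ⟪ψ, T.op φ⟫_ℂ := by
  have := hasSum_inner_opOfSeq (matrixEquiv N T) ψ φ
  rwa [opOfSeq_matrixEquiv] at this

end

end QuantumSchwartz

namespace QuantumSchwartz

noncomputable section

variable {N : ℕ}

/-! ### Schwartz functions of two variables and the kernel isomorphism -/

/-- Composition with a linear isomorphism, as an isomorphism of Schwartz spaces. -/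
def schwartzComp {D E : Type*} [NormedAddCommGroup D] [NormedSpace ℝ D] [NormedAddCommGroup E]
    [NormedSpace ℝ E] (g : D ≃L[ℝ] E) : 𝓢(E, ℂ) ≃L[ℂ] 𝓢(D, ℂ) where
  toLinearEquiv := LinearEquiv.ofLinearMap (compCLMOfContinuousLinearEquiv ℂ g).toLinearMap
    (compCLMOfContinuousLinearEquiv ℂ g.symm).toLinearMap
    (LinearMap.ext fun f => SchwartzMap.ext fun x => congrArg f (g.symm_apply_apply x))
    (LinearMap.ext fun f => SchwartzMap.ext fun x => congrArg f (g.apply_symm_apply x))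
  continuous_toFun := (compCLMOfContinuousLinearEquiv ℂ g).continuous
  continuous_invFun := (compCLMOfContinuousLinearEquiv ℂ g.symm).continuous

theorem schwartzComp_apply {D E : Type*} [NormedAddCommGroup D] [NormedSpace ℝ D]
    [NormedAddCommGroup E] [NormedSpace ℝ E] (g : D ≃L[ℝ] E) (f : 𝓢(E, ℂ)) (x : D) :
    schwartzComp g f x = f (g x) := rfl

theorem hasSum_schwartz_apply {ι E : Type*} [NormedAddCommGroup E] [NormedSpace ℝ E]
    {F : ι → 𝓢(E, ℂ)} {f : 𝓢(E, ℂ)} (h : HasSum F f) (x : E) : HasSum (fun i => F i x) (f x) :=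
  h.mapL ((BoundedContinuousFunction.evalCLM ℂ x).comp (toBoundedContinuousFunctionCLM ℂ E ℂ))

/-- The identification `ℝ^N × ℝ^N = ℝ^{N+N}`. -/
def phaseSplit (N : ℕ) : Phase N ≃L[ℝ] Config (N + N) :=
  (EuclideanSpace.finAddEquivProd (𝕜 := ℝ) (n := N) (m := N)).symm

theorem finAddEquivProd_symm_natAdd {n m : ℕ} (z : Config n × Config m) (i : Fin m) :
    (EuclideanSpace.finAddEquivProd (𝕜 := ℝ)).symm z (Fin.natAdd n i) = z.2 i := by
  simp

theorem finAddEquivProd_symm_castAdd {n m : ℕ} (z : Config n × Config m) (i : Fin n) :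
    (EuclideanSpace.finAddEquivProd (𝕜 := ℝ)).symm z (Fin.castAdd m i) = z.1 i := by
  simp

theorem numberFun_phaseSplit (γ : Fin (N + N) → ℕ) (z : Phase N) :
    numberFun γ (phaseSplit N z) = numberFun (leftIdx γ) z.1 * numberFun (rightIdx γ) z.2 := by
  rw [numberFun, Fin.prod_univ_add]
  refine congrArg₂ (· * ·) (Finset.prod_congr rfl fun i _ => ?_)
    (Finset.prod_congr rfl fun i _ => ?_)
  · rw [phaseSplit, finAddEquivProd_symm_castAdd, leftIdx]
  · rw [phaseSplit, finAddEquivProd_symm_natAdd, rightIdx]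

/-- The isomorphism `𝔖(ℝ^{2N}) ≅ 𝔰_{2N}` given by the Hermite coefficients. -/
def phaseSeq (N : ℕ) : 𝓢(Phase N, ℂ) ≃L[ℂ] SchwartzSeq (N + N) :=
  (schwartzComp (phaseSplit N)).symm.trans (hermiteEquiv (N + N))

theorem hasSum_phaseSeq_symm (a : SchwartzSeq (N + N)) (z : Phase N) :
    HasSum (fun γ => a.coeff γ * (numberFun (leftIdx γ) z.1 * numberFun (rightIdx γ) z.2))
      ((phaseSeq N).symm a z) := by
  refine (hasSum_schwartz_apply (hasSum_hermiteEquiv_symm a) (phaseSplit N z)).congr_fun fun γ => ?_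
  rw [smul_apply, numberSchwartz_apply, numberFun_phaseSplit, smul_eq_mul]

theorem hasSum_phaseSeq (f : 𝓢(Phase N, ℂ)) (z : Phase N) :
    HasSum (fun γ => (phaseSeq N f).coeff γ *
      (numberFun (leftIdx γ) z.1 * numberFun (rightIdx γ) z.2)) (f z) := by
  have := hasSum_phaseSeq_symm (phaseSeq N f) z
  rwa [ContinuousLinearEquiv.symm_apply_apply] at this

/-- The kernel isomorphism `T ↦ K^T`. -/
def kernelEquiv (N : ℕ) : SchwartzOperator N ≃L[ℂ] 𝓢(Config N × Config N, ℂ) :=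
  (matrixEquiv N).trans (phaseSeq N).symm

theorem hasSum_kernel (T : SchwartzOperator N) (z : Phase N) :
    HasSum (fun γ => (matrixEquiv N T).coeff γ *
      (numberFun (leftIdx γ) z.1 * numberFun (rightIdx γ) z.2)) (kernelEquiv N T z) :=
  hasSum_phaseSeq_symm _ z

theorem integral_norm_mul_norm_le {α : Type*} {m : MeasurableSpace α} {μ : Measure α}
    {f g : α → ℂ} (hf : MemLp f 2 μ) (hg : MemLp g 2 μ) :
    ∫ x, ‖f x‖ * ‖g x‖ ∂μ ≤ (eLpNorm f 2 μ).toReal * (eLpNorm g 2 μ).toReal := by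
  have h2 : ENNReal.ofReal 2 = 2 := by norm_num
  have h := integral_mul_norm_le_Lp_mul_Lq (f := f) (g := g) Real.HolderConjugate.two_two
    (by rwa [h2]) (by rwa [h2])
  rw [hf.eLpNorm_eq_integral_rpow_norm two_ne_zero ENNReal.ofNat_ne_top,
    hg.eLpNorm_eq_integral_rpow_norm two_ne_zero ENNReal.ofNat_ne_top,
    ENNReal.toReal_ofReal (by positivity), ENNReal.toReal_ofReal (by positivity)]
  simpa using h

theorem eLpNorm_numberFun (α : Fin N → ℕ) : (eLpNorm (numberFun α) 2 volume).toReal = 1 := by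
  rw [← norm_numberVec α, numberVec, Lp.norm_toLp]

theorem integrable_mul_of_memLp_two {α : Type*} {m : MeasurableSpace α} {μ : Measure α}
    {f g : α → ℂ} (hf : MemLp f 2 μ) (hg : MemLp g 2 μ) : Integrable (fun x => f x * g x) μ :=
  hf.integrable_mul hg

theorem memLp_conj (ψ : Hilb N) :
    MemLp (fun q => (starRingEnd ℂ) (ψ q)) 2 (volume : Measure (Config N)) :=
  (Lp.memLp ψ).star

theorem integral_norm_conj_mul_numberFun_le (ψ : Hilb N) (α : Fin N → ℕ) :
    ∫ q, ‖(starRingEnd ℂ) (ψ q) * numberFun α q‖ ≤ ‖ψ‖ := by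
  have h := integral_norm_mul_norm_le (Lp.memLp ψ) (memLp_numberFun α)
  rw [eLpNorm_numberFun, mul_one, ← Lp.norm_def] at h
  simpa only [norm_mul, RCLike.norm_conj] using h

theorem integral_norm_numberFun_mul_le (φ : Hilb N) (α : Fin N → ℕ) :
    ∫ q, ‖numberFun α q * φ q‖ ≤ ‖φ‖ := by
  have h := integral_norm_mul_norm_le (memLp_numberFun α) (Lp.memLp φ)
  rw [eLpNorm_numberFun, one_mul, ← Lp.norm_def] at h
  simpa only [norm_mul] using h

theorem inner_numberVec_right_eq_integral (α : Fin N → ℕ) (ψ : Hilb N) :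
    ⟪ψ, numberVec α⟫_ℂ = ∫ q, (starRingEnd ℂ) (ψ q) * numberFun α q := by
  rw [← inner_conj_symm, inner_numberVec_eq_integral, ← integral_conj]
  refine integral_congr_ae (Filter.Eventually.of_forall fun q => ?_)
  simp only [map_mul, conj_numberFun]
  exact mul_comm _ _

/-- For a single `|α⟩⟨α'|` the double integral factors. The `γ`-th term has `L¹` norm at most `‖a_γ‖
‖ψ‖ ‖φ‖`, and `a` is absolutely summable, so sum and integral may be exchanged. -/
theorem isKernel_kernelEquiv (T : SchwartzOperator N) : IsKernel T.op (kernelEquiv N T) := by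
  intro ψ φ
  set a := matrixEquiv N T with ha
  set F : (Fin (N + N) → ℕ) → Phase N → ℂ := fun γ z =>
    a.coeff γ * (((starRingEnd ℂ) (ψ z.1) * numberFun (leftIdx γ) z.1) *
      (numberFun (rightIdx γ) z.2 * φ z.2)) with hF
  have i1 : ∀ γ : Fin (N + N) → ℕ,
      Integrable fun q => (starRingEnd ℂ) (ψ q) * numberFun (leftIdx γ) q := fun γ =>
    integrable_mul_of_memLp_two (memLp_conj ψ) (memLp_numberFun _)
  have i2 : ∀ γ : Fin (N + N) → ℕ, Integrable fun q => numberFun (rightIdx γ) q * φ q := fun γ =>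
    integrable_mul_of_memLp_two (memLp_numberFun _) (Lp.memLp φ)
  have hint : ∀ γ, Integrable (F γ) volume := fun γ =>
    ((i1 γ).mul_prod (i2 γ)).const_mul (a.coeff γ)
  have hval : ∀ γ, ∫ z, F γ z =
      a.coeff γ * (⟪ψ, numberVec (leftIdx γ)⟫_ℂ * ⟪numberVec (rightIdx γ), φ⟫_ℂ) := fun γ => by
    rw [hF, integral_const_mul, inner_numberVec_right_eq_integral, inner_numberVec_eq_integral]
    exact congrArg _ (integral_prod_mul (fun q => (starRingEnd ℂ) (ψ q) * numberFun (leftIdx γ) q)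
      (fun q => numberFun (rightIdx γ) q * φ q))
  have hnorm : ∀ γ, ∫ z, ‖F γ z‖ ≤ ‖a.coeff γ‖ * (‖ψ‖ * ‖φ‖) := fun γ => by
    have e : ∀ z, ‖F γ z‖ = ‖a.coeff γ‖ * (‖(starRingEnd ℂ) (ψ z.1) * numberFun (leftIdx γ) z.1‖ *
      ‖numberFun (rightIdx γ) z.2 * φ z.2‖) := fun z => by
        rw [hF, norm_mul, norm_mul (_ * _) (_ * _)]
    simp only [e]
    rw [integral_const_mul]
    refine mul_le_mul_of_nonneg_left ?_ (norm_nonneg _)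
    refine (integral_prod_mul (fun q => ‖(starRingEnd ℂ) (ψ q) * numberFun (leftIdx γ) q‖)
      (fun q => ‖numberFun (rightIdx γ) q * φ q‖)).trans_le ?_
    exact mul_le_mul (integral_norm_conj_mul_numberFun_le _ _)
      (integral_norm_numberFun_mul_le _ _) (integral_nonneg fun _ => norm_nonneg _) (norm_nonneg _)
  have hsum : Summable fun γ => ∫ z, ‖F γ z‖ :=
    Summable.of_nonneg_of_le (fun γ => integral_nonneg fun _ => norm_nonneg _) hnorm
      ((summable_norm_coeff a).mul_right _)
  have h := hasSum_integral_of_summable_integral_norm hint hsum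
  simp only [hval] at h
  rw [(hasSum_inner_op T ψ φ).unique h]
  refine integral_congr_ae (Filter.Eventually.of_forall fun z => ?_)
  have hz := ((hasSum_kernel T z).mul_left ((starRingEnd ℂ) (ψ z.1))).mul_right (φ z.2)
  refine (HasSum.congr_fun hz fun γ => ?_).tsum_eq
  rw [hF, ← ha]
  ring

end

end QuantumSchwartz

namespace QuantumSchwartz

noncomputable section

variable {N : ℕ}

/-! ### The partial Fourier transform -/

/-- Multiplication of a Schwartz multisequence by unimodular factors. -/
def phaseSeqMul {n : ℕ} (d : (Fin n → ℕ) → ℂ) (hd : ∀ γ, ‖d γ‖ = 1) :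
    SchwartzSeq n →ₗ[ℂ] SchwartzSeq n :=
  LinearMap.codRestrict (schwartzSeqSubmodule n)
    { toFun := fun a γ => d γ * a.coeff γ
      map_add' := fun a b => by
        funext γ
        simp only [map_add, Pi.add_apply, mul_add]
      map_smul' := fun c a => by
        funext γ
        simp only [map_smul, Pi.smul_apply, smul_eq_mul, RingHom.id_apply, mul_left_comm] }
    fun a => mem_schwartzSeqSubmodule fun r => ⟨schwartzSeqSeminorm n (fun _ => r) a, fun γ => by
      change idxWeight γ ^ r * ‖d γ * a.coeff γ‖ ≤ _
      rw [norm_mul, hd, one_mul]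
      exact idxWeight_pow_mul_norm_coeff_le a r γ⟩

theorem phaseSeqMul_coeff {n : ℕ} (d : (Fin n → ℕ) → ℂ) (hd : ∀ γ, ‖d γ‖ = 1) (a : SchwartzSeq n)
    (γ : Fin n → ℕ) : (phaseSeqMul d hd a).coeff γ = d γ * a.coeff γ := rfl

theorem continuous_phaseSeqMul {n : ℕ} (d : (Fin n → ℕ) → ℂ) (hd : ∀ γ, ‖d γ‖ = 1) :
    Continuous (phaseSeqMul d hd) := by
  have := (schwartzSeq_withSeminorms n).topologicalAddGroup
  have := (schwartzSeq_withSeminorms n).continuousSMul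
  refine continuous_to_schwartzSeq _ fun r => ⟨schwartzSeqSeminorm n (fun _ => r),
    (schwartzSeq_withSeminorms n).continuous_seminorm _, fun a γ => ?_⟩
  rw [phaseSeqMul_coeff, norm_mul, hd, one_mul]
  exact idxWeight_pow_mul_norm_coeff_le a r γ

/-- The eigenvalue `(± i)^{|α'|}` of the partial Fourier transform. -/
def fourierFactor (s : ℝ) (γ : Fin (N + N) → ℕ) : ℂ := (s * Complex.I) ^ ∑ i, rightIdx γ i

theorem norm_fourierFactor {s : ℝ} (hs : s ^ 2 = 1) (γ : Fin (N + N) → ℕ) :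
    ‖fourierFactor s γ‖ = 1 := by
  have h : |s| = 1 := by
    rw [← sq_abs] at hs
    exact (pow_eq_one_iff_of_nonneg (abs_nonneg s) two_ne_zero).mp hs
  rw [fourierFactor, norm_pow, norm_mul, Complex.norm_I, mul_one, Complex.norm_real,
    Real.norm_eq_abs, h, one_pow]

/-- Opposite signs are encoded by `s * t = -1`, and then `(s i)(t i) = 1`. -/
theorem fourierFactor_mul {s t : ℝ} (h : s * t = -1) (γ : Fin (N + N) → ℕ) :
    fourierFactor s γ * fourierFactor t γ = 1 := by
  have h' : (s : ℂ) * t = -1 := by exact_mod_cast h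
  rw [fourierFactor, fourierFactor, ← mul_pow, mul_mul_mul_comm, h', Complex.I_mul_I,
    neg_mul_neg, one_mul, one_pow]

theorem phaseSeqMul_fourierFactor {s t : ℝ} (hs : s ^ 2 = 1) (ht : t ^ 2 = 1) (h : s * t = -1)
    (a : SchwartzSeq (N + N)) :
    phaseSeqMul (fourierFactor s) (norm_fourierFactor hs)
      (phaseSeqMul (fourierFactor t) (norm_fourierFactor ht) a) = a :=
  SchwartzSeq.ext fun γ => by
    rw [phaseSeqMul_coeff, phaseSeqMul_coeff, ← mul_assoc, fourierFactor_mul h, one_mul]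

/-- The partial Fourier transform with sign `s = ± 1` on Hermite coefficients. -/
def fourierFactorEquiv (N : ℕ) {s t : ℝ} (hs : s ^ 2 = 1) (ht : t ^ 2 = 1) (h : s * t = -1) :
    SchwartzSeq (N + N) ≃L[ℂ] SchwartzSeq (N + N) where
  toLinearEquiv := LinearEquiv.ofLinearMap
    (phaseSeqMul (fourierFactor s) (norm_fourierFactor hs))
    (phaseSeqMul (fourierFactor t) (norm_fourierFactor ht))
    (LinearMap.ext (phaseSeqMul_fourierFactor hs ht h))
    (LinearMap.ext (phaseSeqMul_fourierFactor ht hs (by rwa [mul_comm])))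
  continuous_toFun := continuous_phaseSeqMul _ (norm_fourierFactor hs)
  continuous_invFun := continuous_phaseSeqMul _ (norm_fourierFactor ht)

theorem fourierFactorEquiv_coeff {s t : ℝ} (hs : s ^ 2 = 1) (ht : t ^ 2 = 1) (h : s * t = -1)
    (a : SchwartzSeq (N + N)) (γ : Fin (N + N) → ℕ) :
    (fourierFactorEquiv N hs ht h a).coeff γ = fourierFactor s γ * a.coeff γ := rfl

/-- The Fourier transform with sign `s = ± 1` in the second variable; its inverse has the opposite
sign `t`. -/
def partialFourier (N : ℕ) {s t : ℝ} (hs : s ^ 2 = 1) (ht : t ^ 2 = 1) (h : s * t = -1) :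
    𝓢(Phase N, ℂ) ≃L[ℂ] 𝓢(Phase N, ℂ) :=
  ((phaseSeq N).trans (fourierFactorEquiv N hs ht h)).trans (phaseSeq N).symm

theorem partialFourier_symm {s t : ℝ} (hs : s ^ 2 = 1) (ht : t ^ 2 = 1) (h : s * t = -1) :
    (partialFourier N hs ht h).symm = partialFourier N ht hs (by rwa [mul_comm]) := rfl

theorem integral_exp_mul_numberFun {s : ℝ} (hs : s ^ 2 = 1) (α : Fin N → ℕ) (p : Config N) :
    ∫ u, Complex.exp (Complex.I * (s * ⟪p, u⟫_ℝ : ℝ)) * numberFun α u =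
      (Real.sqrt (2 * Real.pi) : ℂ) ^ N * (s * Complex.I) ^ (∑ i, α i) * numberFun α p := by
  have e : ∀ u : Config N, Complex.exp (Complex.I * (s * ⟪p, u⟫_ℝ : ℝ)) * numberFun α u =
      ∏ i, (Complex.exp (Complex.I * (s * p i : ℝ) * (u i : ℝ)) * (hermiteFun (α i) (u i) : ℂ)) :=
    fun u => by
      rw [Finset.prod_mul_distrib, ← Complex.exp_sum, numberFun]
      congr 2
      rw [PiLp.inner_apply, Finset.mul_sum, Complex.ofReal_sum, Finset.mul_sum]
      refine Finset.sum_congr rfl fun i _ => ?_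
      simp only [RCLike.inner_apply, conj_trivial]
      push_cast
      ring
  simp only [e]
  rw [integral_config_prod fun i t => Complex.exp (Complex.I * (s * p i : ℝ) * (t : ℝ)) *
    (hermiteFun (α i) t : ℂ)]
  have e2 : ∀ i, ∫ t : ℝ, Complex.exp (Complex.I * (s * p i : ℝ) * (t : ℝ)) *
      (hermiteFun (α i) t : ℂ) =
        Real.sqrt (2 * Real.pi) * (s * Complex.I) ^ α i * hermiteFun (α i) (p i) := fun i =>
    hermiteFourier_eq hs (α i) (p i)
  simp only [e2]
  rw [Finset.prod_mul_distrib, Finset.prod_mul_distrib, Finset.prod_const, Finset.card_univ,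
    Fintype.card_fin, Finset.prod_pow_eq_pow_sum, numberFun]

/-- An integrable power of `1 + ‖x‖` bounds the `L¹` norm by two Schwartz seminorms, both
polynomially bounded along the Hermite functions. -/
theorem exists_integral_norm_numberFun_le (N : ℕ) : ∃ C : ℝ, 0 ≤ C ∧ ∃ r : ℕ, ∀ α : Fin N → ℕ,
    ∫ u, ‖numberFun α u‖ ≤ C * idxWeight α ^ r := by
  set k := (volume : Measure (Config N)).integrablePower
  set D := 2 ^ k * ∫ x : Config N, (1 + ‖x‖) ^ (-(k : ℝ))
  have hD : 0 ≤ D := by positivity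
  obtain ⟨C, hC, r, h⟩ := hermiteBounded_seminorm (n := N) 0 0
  obtain ⟨C', hC', r', h'⟩ := hermiteBounded_seminorm (n := N) (0 + k) 0
  refine ⟨D * (C + C'), by positivity, r + r', fun α => ?_⟩
  have h1 := integral_pow_mul_iteratedFDeriv_le ℂ volume (numberSchwartz α) 0 0
  simp only [pow_zero, one_mul, norm_iteratedFDeriv_zero, numberSchwartz_apply] at h1
  have w := one_le_idxWeight α
  have h2 := h α
  have h3 := h' α
  rw [one_apply_eq_self] at h2 h3
  calc _ ≤ _ := h1
    _ ≤ D * (C * idxWeight α ^ (r + r') + C' * idxWeight α ^ (r + r')) := by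
        refine mul_le_mul_of_nonneg_left (add_le_add (h2.trans ?_) (h3.trans ?_)) hD
        · exact mul_le_mul_of_nonneg_left (pow_le_pow_right₀ w (by omega)) (by assumption)
        · exact mul_le_mul_of_nonneg_left (pow_le_pow_right₀ w (by omega)) (by assumption)
    _ = _ := by ring

theorem exists_norm_numberFun_le (N : ℕ) : ∃ C : ℝ, 0 ≤ C ∧ ∃ r : ℕ, ∀ (α : Fin N → ℕ) (q : Config N),
    ‖numberFun α q‖ ≤ C * idxWeight α ^ r := by
  obtain ⟨C, hC, r, h⟩ := hermiteBounded_seminorm (n := N) 0 0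
  refine ⟨C, hC, r, fun α q => ?_⟩
  rw [← numberSchwartz_apply]
  exact (SchwartzMap.norm_le_seminorm ℂ _ q).trans (h α)

theorem norm_exp_I_mul (x : ℝ) : ‖Complex.exp (Complex.I * x)‖ = 1 := by
  rw [mul_comm, Complex.norm_exp_ofReal_mul_I]

theorem integrable_numberFun (α : Fin N → ℕ) : Integrable (numberFun α) := by
  refine (numberSchwartz α).integrable.congr (Filter.Eventually.of_forall fun q => ?_)
  exact numberSchwartz_apply α q

theorem integral_exp_mul_eq_tsum {s : ℝ} (hs : s ^ 2 = 1) (f : 𝓢(Phase N, ℂ)) (q p : Config N) :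
    HasSum (fun γ => (Real.sqrt (2 * Real.pi) : ℂ) ^ N * (fourierFactor s γ * (phaseSeq N f).coeff γ *
        (numberFun (leftIdx γ) q * numberFun (rightIdx γ) p)))
      (∫ u, Complex.exp (Complex.I * (s * ⟪p, u⟫_ℝ : ℝ)) * f (q, u)) := by
  set a := phaseSeq N f with ha
  set F : (Fin (N + N) → ℕ) → Config N → ℂ := fun γ u => a.coeff γ * numberFun (leftIdx γ) q *
    (Complex.exp (Complex.I * (s * ⟪p, u⟫_ℝ : ℝ)) * numberFun (rightIdx γ) u) with hF
  have hn : ∀ γ u, ‖F γ u‖ =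
      ‖a.coeff γ‖ * ‖numberFun (leftIdx γ) q‖ * ‖numberFun (rightIdx γ) u‖ := fun γ u => by
    rw [hF, norm_mul, norm_mul, norm_mul, norm_exp_I_mul, one_mul]
  have hint : ∀ γ, Integrable (F γ) volume := fun γ => by
    refine Integrable.const_mul ?_ _
    exact (integrable_numberFun _).bdd_mul (c := 1) (by fun_prop)
      (Filter.Eventually.of_forall fun u => (norm_exp_I_mul _).le)
  obtain ⟨C, hC, r, hb⟩ := exists_norm_numberFun_le N
  obtain ⟨C', hC', r', hb'⟩ := exists_integral_norm_numberFun_le N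
  have hsum : Summable fun γ => ∫ u, ‖F γ u‖ := by
    refine Summable.of_nonneg_of_le (fun γ => integral_nonneg fun _ => norm_nonneg _) (fun γ => ?_)
      ((summable_idxWeight_pow_mul_norm_coeff a (r + r')).mul_left (C * C'))
    simp only [hn]
    rw [integral_const_mul]
    have w := idxWeight_pos γ
    have w1 := idxWeight_pos (leftIdx γ)
    have w2 := idxWeight_pos (rightIdx γ)
    calc _ ≤ ‖a.coeff γ‖ * (C * idxWeight γ ^ r) * (C' * idxWeight γ ^ r') := by
          gcongr
          · refine (hb _ _).trans ?_
            gcongr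
            exact idxWeight_leftIdx_le γ
          · refine (hb' _).trans ?_
            gcongr
            exact idxWeight_rightIdx_le γ
      _ = _ := by ring
  have h := hasSum_integral_of_summable_integral_norm hint hsum
  have hval : ∀ u, ∑' γ, F γ u = Complex.exp (Complex.I * (s * ⟪p, u⟫_ℝ : ℝ)) * f (q, u) :=
    fun u => by
      refine (HasSum.congr_fun ((hasSum_phaseSeq f (q, u)).mul_left
        (Complex.exp (Complex.I * (s * ⟪p, u⟫_ℝ : ℝ)))) fun γ => ?_).tsum_eq
      rw [hF, ← ha]
      ring
  simp only [hval] at h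
  refine HasSum.congr_fun h fun γ => ?_
  rw [hF, integral_const_mul, integral_exp_mul_numberFun hs, fourierFactor]
  ring

/-- Since the coefficient factors are unimodular, `partialFourier` is the unitarily normalised
transform; this accounts for the constant on the left. -/
theorem partialFourier_apply {s t : ℝ} (hs : s ^ 2 = 1) (ht : t ^ 2 = 1) (h : s * t = -1)
    (f : 𝓢(Phase N, ℂ)) (q p : Config N) :
    (Real.sqrt (2 * Real.pi) : ℂ) ^ N * partialFourier N hs ht h f (q, p) =
      ∫ u, Complex.exp (Complex.I * (s * ⟪p, u⟫_ℝ : ℝ)) * f (q, u) := by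
  refine (HasSum.congr_fun ((hasSum_phaseSeq_symm (fourierFactorEquiv N hs ht h (phaseSeq N f))
    (q, p)).mul_left _) fun γ => ?_).unique (integral_exp_mul_eq_tsum hs f q p)
  rw [fourierFactorEquiv_coeff]

end

end QuantumSchwartz

namespace QuantumSchwartz

noncomputable section

variable {N : ℕ}

/-! ### The Weyl transform -/

/-- Multiplication by a nonzero constant as an isomorphism. -/
def scaleEquiv {E : Type*} [AddCommGroup E] [Module ℂ E] [TopologicalSpace E]
    [ContinuousConstSMul ℂ E] (c : ℂ) (hc : c ≠ 0) : E ≃L[ℂ] E where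
  toLinearEquiv := LinearEquiv.smulOfNeZero ℂ E c hc
  continuous_toFun := continuous_const_smul c
  continuous_invFun := continuous_const_smul c⁻¹

/-- The change of variables `(q, u) ↦ (u - q/2, u + q/2)`. -/
def weylCoord (N : ℕ) : Phase N ≃L[ℝ] Phase N :=
  ContinuousLinearEquiv.equivOfInverse
    ((ContinuousLinearMap.snd ℝ (Config N) (Config N) -
        (1 / 2 : ℝ) • ContinuousLinearMap.fst ℝ (Config N) (Config N)).prod
      (ContinuousLinearMap.snd ℝ (Config N) (Config N) +
        (1 / 2 : ℝ) • ContinuousLinearMap.fst ℝ (Config N) (Config N)))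
    ((ContinuousLinearMap.snd ℝ (Config N) (Config N) -
        ContinuousLinearMap.fst ℝ (Config N) (Config N)).prod
      ((1 / 2 : ℝ) • (ContinuousLinearMap.fst ℝ (Config N) (Config N) +
        ContinuousLinearMap.snd ℝ (Config N) (Config N))))
    (fun z => by
      ext i
      · simp
        ring
      · simp
        ring)
    (fun z => by
      ext i
      · simp
        ring
      · simp
        ring)

theorem weylCoord_apply (q u : Config N) :
    weylCoord N (q, u) = (u - (1 / 2 : ℝ) • q, u + (1 / 2 : ℝ) • q) := rfl

theorem sqrt_two_pi_pow_ne_zero (N : ℕ) : (Real.sqrt (2 * Real.pi) : ℂ) ^ N ≠ 0 := by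
  refine pow_ne_zero _ (Complex.ofReal_ne_zero.mpr ?_)
  have := Real.pi_pos
  positivity

/-- The Weyl transform `𝔖(H) ≅ 𝔖(X)`. -/
def weylEquiv (N : ℕ) : SchwartzOperator N ≃L[ℂ] 𝓢(Phase N, ℂ) :=
  ((kernelEquiv N).trans (schwartzComp (weylCoord N))).trans
    ((partialFourier N (s := 1) (t := -1) (by norm_num) (by norm_num) (by norm_num)).trans
      (scaleEquiv _ (sqrt_two_pi_pow_ne_zero N)))

theorem weylEquiv_apply (T : SchwartzOperator N) (q p : Config N) :
    weylEquiv N T (q, p) = ∫ u, Complex.exp (Complex.I * (⟪p, u⟫_ℝ : ℝ)) *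
      kernelEquiv N T (u - (1 / 2 : ℝ) • q, u + (1 / 2 : ℝ) • q) := by
  have h := partialFourier_apply (s := 1) (t := -1) (by norm_num) (by norm_num) (by norm_num)
    (schwartzComp (weylCoord N) (kernelEquiv N T)) q p
  refine Eq.trans ?_ (h.trans ?_)
  · rfl
  · simp only [one_mul, schwartzComp_apply, weylCoord_apply]

/-! ### Traces of absolutely convergent series of rank-one operators. -/

section

variable {E ι κ : Type*} [NormedAddCommGroup E] [InnerProductSpace ℂ E]

/-- The arithmetic-geometric mean inequality followed by Bessel's inequality for each vector. -/
theorem summable_norm_inner_mul_inner (b : HilbertBasis ι ℂ E) {x y : E}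
    (hx : ‖x‖ ≤ 1) (hy : ‖y‖ ≤ 1) :
    (Summable fun i => ‖⟪x, b i⟫_ℂ * ⟪b i, y⟫_ℂ‖) ∧ ∑' i, ‖⟪x, b i⟫_ℂ * ⟪b i, y⟫_ℂ‖ ≤ 1 := by
  have sx := b.orthonormal.inner_products_summable (x := x)
  have sy := b.orthonormal.inner_products_summable (x := y)
  have s := (sx.add sy).mul_left (1 / 2)
  have hle : ∀ i, ‖⟪x, b i⟫_ℂ * ⟪b i, y⟫_ℂ‖ ≤
      1 / 2 * (‖⟪b i, x⟫_ℂ‖ ^ 2 + ‖⟪b i, y⟫_ℂ‖ ^ 2) := fun i => by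
    rw [norm_mul, norm_inner_symm]
    linarith [two_mul_le_add_sq ‖⟪b i, x⟫_ℂ‖ ‖⟪b i, y⟫_ℂ‖]
  have hs := s.of_nonneg_of_le (fun _ => norm_nonneg _) hle
  refine ⟨hs, (hs.tsum_le_tsum hle s).trans ?_⟩
  rw [tsum_mul_left, sx.tsum_add sy]
  have h1 := (b.orthonormal.tsum_inner_products_le (x := x)).trans (pow_le_one₀ (norm_nonneg x) hx)
  have h2 := (b.orthonormal.tsum_inner_products_le (x := y)).trans (pow_le_one₀ (norm_nonneg y) hy)
  linarith

/-- The trace of an absolutely convergent series `∑ a_k |l_k⟩⟨r_k|`. -/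
theorem hasSum_trace_of_hasSum (b : HilbertBasis ι ℂ E) {A : E → E} {a : κ → ℂ} {l r : κ → E}
    (ha : Summable fun k => ‖a k‖) (hl : ∀ k, ‖l k‖ ≤ 1) (hr : ∀ k, ‖r k‖ ≤ 1)
    (hA : ∀ x, HasSum (fun k => a k * (⟪x, l k⟫_ℂ * ⟪r k, x⟫_ℂ)) ⟪x, A x⟫_ℂ) {c : ℂ}
    (hc : HasSum (fun k => a k * ⟪r k, l k⟫_ℂ) c) : HasSum (fun i => ⟪b i, A (b i)⟫_ℂ) c := by
  let G : κ × ι → ℂ := fun k => a k.1 * (⟪r k.1, b k.2⟫_ℂ * ⟪b k.2, l k.1⟫_ℂ)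
  have hb := fun k => summable_norm_inner_mul_inner b (hr k) (hl k)
  -- Absolute summability over pairs allows both orders of summation. Summing over the basis first
  -- gives `⟪r k, l k⟫` by Parseval; summing over `k` first gives the diagonal elements of `A`.
  have hsum : Summable G := by
    refine Summable.of_norm ((summable_prod_of_nonneg fun _ => norm_nonneg _).mpr
      ⟨fun k => ?_, ?_⟩)
    · simp only [G, norm_mul (a _)]
      exact (hb k).1.mul_left _
    · simp only [G, norm_mul (a _), tsum_mul_left]
      exact ha.of_nonneg_of_le
        (fun k => mul_nonneg (norm_nonneg _) (tsum_nonneg fun _ => norm_nonneg _))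
        fun k => mul_le_of_le_one_right (norm_nonneg _) (hb k).2
  have h1 : HasSum (fun k => a k * ⟪r k, l k⟫_ℂ) (∑' k, G k) :=
    hsum.hasSum.prod_fiberwise fun k => (b.hasSum_inner_mul_inner _ _).mul_left _
  rw [hc.unique h1]
  refine ((Equiv.prodComm ι κ).hasSum_iff.mpr hsum.hasSum).prod_fiberwise fun i => ?_
  refine (hA (b i)).congr_fun fun k => ?_
  change G (k, i) = _
  simp only [G]
  rw [mul_comm ⟪b i, _⟫_ℂ]

end

/-- Here `l` is `W|α⟩` and `r` is `|α'⟩`; the isometry keeps the norms at one, and its adjoint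
reduces the expansion of `W T` to that of `T`. -/
theorem hasTrace_comp (T : SchwartzOperator N) (W : Hilb N →ₗᵢ[ℂ] Hilb N)
    {c : ℂ} (hc : HasSum (fun γ => (matrixEquiv N T).coeff γ *
      ⟪numberVec (rightIdx γ), W (numberVec (leftIdx γ))⟫_ℂ) c) :
    HasTrace (W.toContinuousLinearMap.comp T.op) c := fun ι b => by
  refine hasSum_trace_of_hasSum (A := fun ψ => W (T.op ψ)) b (summable_norm_coeff _)
    (fun γ => ((W.norm_map _).trans (norm_numberVec _)).le) (fun γ => (norm_numberVec _).le)
    (fun ψ => ?_) hc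
  have h := hasSum_inner_op T (ContinuousLinearMap.adjoint W.toContinuousLinearMap ψ) ψ
  simp only [ContinuousLinearMap.adjoint_inner_left] at h
  exact h

theorem weylFun_congr {x : Phase N} {ψ φ : Config N → ℂ} (h : ψ =ᵐ[volume] φ) :
    weylFun x ψ =ᵐ[volume] weylFun x φ := by
  filter_upwards [(measurePreserving_sub_right volume x.1).quasiMeasurePreserving.ae_eq_comp h]
    with s hs
  simp only [Function.comp_apply] at hs
  simp only [weylFun, hs]

theorem coeFn_weylOp (x : Phase N) (ψ : Hilb N) : weylOp x ψ =ᵐ[volume] weylFun x ψ :=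
  (memLp_weylFun x ψ).coeFn_toLp

theorem inner_weylOp_numberVec (x : Phase N) (α α' : Fin N → ℕ) :
    ⟪numberVec α', weylOp x (numberVec α)⟫_ℂ =
      ∫ s, numberFun α' s * weylFun x (numberFun α) s := by
  rw [inner_numberVec_eq_integral]
  refine integral_congr_ae ?_
  filter_upwards [coeFn_weylOp x (numberVec α), weylFun_congr (x := x)
    (memLp_numberFun α).coeFn_toLp] with s h1 h2
  rw [h1]
  exact congrArg _ h2

/-- The multiplier `e^{-i q·p/2} e^{i p·s}` of the Weyl operator `W(q, p)`. -/
def weylPhase (x : Phase N) (s : Config N) : ℂ :=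
  Complex.exp (-(Complex.I / 2) * (⟪x.1, x.2⟫_ℝ : ℝ)) * Complex.exp (Complex.I * (⟪x.2, s⟫_ℝ : ℝ))

theorem weylFun_eq (x : Phase N) (ψ : Config N → ℂ) (s : Config N) :
    weylFun x ψ s = weylPhase x s * ψ (s - x.1) := rfl

theorem norm_weylPhase (x : Phase N) (s : Config N) : ‖weylPhase x s‖ = 1 := by
  have h := norm_weylFun x (fun _ => 1) s
  rwa [weylFun_eq, mul_one, norm_one] at h

theorem continuous_weylPhase_right (x : Phase N) : Continuous (weylPhase x) := by
  unfold weylPhase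
  fun_prop

theorem hasSum_coeff_mul_integral {n : ℕ} {α : Type*} {m : MeasurableSpace α} {μ : Measure α}
    (a : SchwartzSeq n) {G : (Fin n → ℕ) → α → ℂ} (hint : ∀ γ, Integrable (G γ) μ) {C : ℝ} {r : ℕ}
    (hb : ∀ γ, ∫ x, ‖G γ x‖ ∂μ ≤ C * idxWeight γ ^ r) {g : α → ℂ}
    (hg : ∀ x, HasSum (fun γ => a.coeff γ * G γ x) (g x)) :
    HasSum (fun γ => a.coeff γ * ∫ x, G γ x ∂μ) (∫ x, g x ∂μ) := by
  have hsum : Summable fun γ => ∫ x, ‖a.coeff γ * G γ x‖ ∂μ := by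
    refine Summable.of_nonneg_of_le (fun γ => integral_nonneg fun _ => norm_nonneg _) (fun γ => ?_)
      ((summable_idxWeight_pow_mul_norm_coeff a r).mul_left C)
    simp only [norm_mul]
    rw [integral_const_mul]
    exact (mul_le_mul_of_nonneg_left (hb γ) (norm_nonneg _)).trans_eq (by ring)
  have h := hasSum_integral_of_summable_integral_norm (fun γ => (hint γ).const_mul _) hsum
  simp only [integral_const_mul, fun x => (hg x).tsum_eq] at h
  exact h

/-- The Weyl operator acts on the first variable of the kernel, and the trace integrates over the
diagonal, whence the argument `(s - q, s)`. -/
theorem hasSum_weyl_trace (T : SchwartzOperator N) (x : Phase N) :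
    HasSum (fun γ => (matrixEquiv N T).coeff γ *
      ⟪numberVec (rightIdx γ), weylOp x (numberVec (leftIdx γ))⟫_ℂ)
      (∫ s, weylPhase x s * kernelEquiv N T (s - x.1, s)) := by
  obtain ⟨C, hC, r, hb⟩ := exists_norm_numberFun_le N
  obtain ⟨C', hC', r', hb'⟩ := exists_integral_norm_numberFun_le N
  have hbd : ∀ (γ : Fin (N + N) → ℕ) s,
      ‖weylPhase x s * numberFun (leftIdx γ) (s - x.1)‖ ≤ C * idxWeight γ ^ r := fun γ s => by
    have w1 := idxWeight_pos (leftIdx γ)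
    rw [norm_mul, norm_weylPhase, one_mul]
    refine (hb _ _).trans ?_
    gcongr
    exact idxWeight_leftIdx_le γ
  have hint : ∀ γ : Fin (N + N) → ℕ, Integrable fun s =>
      (weylPhase x s * numberFun (leftIdx γ) (s - x.1)) * numberFun (rightIdx γ) s := fun γ => by
    refine (integrable_numberFun _).bdd_mul (Continuous.aestronglyMeasurable ?_)
      (Filter.Eventually.of_forall (hbd γ))
    exact (continuous_weylPhase_right x).mul
      ((continuous_numberFun _).comp (continuous_id.sub continuous_const))
  have h := hasSum_coeff_mul_integral (matrixEquiv N T) hint (C := C * C') (r := r + r')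
    (g := fun s => weylPhase x s * kernelEquiv N T (s - x.1, s)) (fun γ => ?_) (fun s => ?_)
  · refine h.congr_fun fun γ => ?_
    rw [inner_weylOp_numberVec]
    refine congrArg _ (integral_congr_ae (Filter.Eventually.of_forall fun s => ?_))
    simp only [weylFun_eq]
    exact mul_comm _ _
  · have w := idxWeight_pos γ
    have w2 := idxWeight_pos (rightIdx γ)
    refine (integral_mono (hint γ).norm ((integrable_numberFun (rightIdx γ)).norm.const_mul
      (C * idxWeight γ ^ r)) fun s => ?_).trans ?_
    · rw [norm_mul]
      exact mul_le_mul_of_nonneg_right (hbd γ s) (norm_nonneg _)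
    · rw [integral_const_mul]
      calc _ ≤ C * idxWeight γ ^ r * (C' * idxWeight γ ^ r') := by
            gcongr
            refine (hb' _).trans ?_
            gcongr
            exact idxWeight_rightIdx_le γ
        _ = _ := by ring
  · refine ((hasSum_kernel T (s - x.1, s)).mul_left (weylPhase x s)).congr_fun fun γ => ?_
    ring

/-- Substituting `s = u + q/2` symmetrises the arguments, and the phase `e^{-i q·p/2} e^{i p·s}`
becomes `e^{i p·u}`. -/
theorem weylEquiv_apply_eq_integral (T : SchwartzOperator N) (x : Phase N) :
    weylEquiv N T x = ∫ s, weylPhase x s * kernelEquiv N T (s - x.1, s) := by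
  obtain ⟨q, p⟩ := x
  rw [weylEquiv_apply]
  refine Eq.trans ?_ (integral_add_right_eq_self
    (fun s => weylPhase (q, p) s * kernelEquiv N T (s - q, s)) ((1 / 2 : ℝ) • q))
  refine integral_congr_ae (Filter.Eventually.of_forall fun u => ?_)
  have h1 : u + (1 / 2 : ℝ) • q - q = u - (1 / 2 : ℝ) • q := by
    module
  simp only [h1]
  congr 1
  rw [weylPhase, ← Complex.exp_add, inner_add_right, inner_smul_right, real_inner_comm p q]
  congr 1
  push_cast
  ring

theorem isWeylTransform_weylEquiv (T : SchwartzOperator N) :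
    IsWeylTransform T.op (weylEquiv N T) := fun x => by
  rw [weylEquiv_apply_eq_integral]
  exact hasTrace_comp T (weylOp x) (hasSum_weyl_trace T x)

end

end QuantumSchwartz

namespace QuantumSchwartz

noncomputable section

variable {N : ℕ}

/-! ### The inverse Weyl transform -/

/-- Partial Fourier inversion. One constant comes from the normalisation of `partialFourier`, the
other from the scalar in `weylEquiv`. -/
theorem integral_exp_mul_weylEquiv (T : SchwartzOperator N) (q v : Config N) :
    ∫ p, Complex.exp (Complex.I * (-1 * ⟪v, p⟫_ℝ : ℝ)) * weylEquiv N T (q, p) =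
      (Real.sqrt (2 * Real.pi) : ℂ) ^ N * ((Real.sqrt (2 * Real.pi) : ℂ) ^ N *
        kernelEquiv N T (v - (1 / 2 : ℝ) • q, v + (1 / 2 : ℝ) • q)) := by
  rw [← partialFourier_apply (s := -1) (t := 1) (by norm_num) (by norm_num) (by norm_num)]
  have h : partialFourier N (s := -1) (t := 1) (by norm_num) (by norm_num) (by norm_num)
      (weylEquiv N T) = (Real.sqrt (2 * Real.pi) : ℂ) ^ N •
        schwartzComp (weylCoord N) (kernelEquiv N T) := by
    rw [← partialFourier_symm (by norm_num) (by norm_num) (by norm_num),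
      ContinuousLinearEquiv.symm_apply_eq, map_smul]
    rfl
  rw [h]
  rfl

theorem two_pi_pow_inv_mul (N : ℕ) (z : ℂ) : (((2 * Real.pi) ^ N)⁻¹ : ℝ) •
    ((Real.sqrt (2 * Real.pi) : ℂ) ^ N * ((Real.sqrt (2 * Real.pi) : ℂ) ^ N * z)) = z := by
  have hpi := Real.pi_pos
  have h : (Real.sqrt (2 * Real.pi) : ℂ) * (Real.sqrt (2 * Real.pi) : ℂ) = (2 * Real.pi : ℝ) := by
    rw [← Complex.ofReal_mul, Real.mul_self_sqrt (by positivity)]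
  have h0 : ((2 * Real.pi : ℝ) : ℂ) ≠ 0 := Complex.ofReal_ne_zero.mpr (by positivity)
  rw [← mul_assoc, ← mul_pow, h, Complex.real_smul, Complex.ofReal_inv, Complex.ofReal_pow,
    inv_mul_cancel_left₀ (pow_ne_zero _ h0)]

theorem integral_phaseMeasure (f : Phase N → ℂ) :
    ∫ x, f x ∂(phaseMeasure N) = (((2 * Real.pi) ^ N)⁻¹ : ℝ) • ∫ x, f x := by
  have hpi := Real.pi_pos
  rw [phaseMeasure, integral_smul_measure, ENNReal.toReal_ofReal (by positivity)]

instance (N : ℕ) : (volume : Measure (Phase N)).IsAddHaarMeasure :=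
  inferInstanceAs ((volume : Measure (Config N)).prod volume).IsAddHaarMeasure

theorem integrable_kernel_mul (ψ φ : Hilb N) (K : 𝓢(Phase N, ℂ)) :
    Integrable (fun z : Phase N => (starRingEnd ℂ) (ψ z.1) * K z * φ z.2) volume := by
  have h1 : MemLp (fun z : Phase N => (starRingEnd ℂ) (ψ z.1) * φ z.2) 2 volume := by
    have hm : AEStronglyMeasurable (fun z : Phase N => (starRingEnd ℂ) (ψ z.1) * φ z.2) volume :=
      ((RCLike.continuous_conj.comp_stronglyMeasurable (Lp.stronglyMeasurable ψ)).comp_measurable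
        measurable_fst).mul ((Lp.stronglyMeasurable φ).comp_measurable measurable_snd)
        |>.aestronglyMeasurable
    rw [memLp_two_iff_integrable_sq_norm hm]
    have i1 := (memLp_two_iff_integrable_sq_norm (Lp.aestronglyMeasurable ψ)).mp (Lp.memLp ψ)
    have i2 := (memLp_two_iff_integrable_sq_norm (Lp.aestronglyMeasurable φ)).mp (Lp.memLp φ)
    refine (i1.mul_prod i2).congr (Filter.Eventually.of_forall fun z => ?_)
    simp only [norm_mul, RCLike.norm_conj, mul_pow]
  refine (integrable_mul_of_memLp_two h1 (K.memLp 2 volume)).congr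
    (Filter.Eventually.of_forall fun z => ?_)
  ring

theorem inner_weylOp_eq_integral (x : Phase N) (ψ φ : Hilb N) :
    ⟪ψ, weylOp x φ⟫_ℂ = ∫ s, weylPhase x s * ((starRingEnd ℂ) (ψ s) * φ (s - x.1)) := by
  rw [L2.inner_def]
  refine integral_congr_ae ?_
  filter_upwards [coeFn_weylOp x φ] with s hs
  rw [RCLike.inner_apply, hs, weylFun_eq]
  ring

theorem weylPhase_neg (q p s : Config N) : weylPhase (-(q, p)) s =
    Complex.exp (Complex.I * (-1 * ⟪s + (1 / 2 : ℝ) • q, p⟫_ℝ : ℝ)) := by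
  rw [weylPhase, ← Complex.exp_add]
  simp only [Prod.fst_neg, Prod.snd_neg, inner_neg_right, inner_neg_left, inner_add_left,
    inner_smul_left, real_inner_comm s p]
  congr 1
  push_cast
  simp only [conj_trivial]
  push_cast
  ring

theorem stronglyMeasurable_weyl_integrand (ψ φ : Hilb N) :
    StronglyMeasurable fun z : Phase N × Config N =>
      weylPhase (-z.1) z.2 * ((starRingEnd ℂ) (ψ z.2) * φ (z.2 - (-z.1).1)) := by
  have h : Continuous fun z : Phase N × Config N => weylPhase (-z.1) z.2 := by
    unfold weylPhase
    fun_prop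
  refine h.stronglyMeasurable.mul (((RCLike.continuous_conj.comp_stronglyMeasurable
    (Lp.stronglyMeasurable ψ)).comp_measurable measurable_snd).mul
    ((Lp.stronglyMeasurable φ).comp_measurable ?_))
  exact measurable_snd.sub measurable_fst.neg.fst

theorem integrable_mul_inner_weylOp (f : 𝓢(Phase N, ℂ)) (ψ φ : Hilb N) :
    Integrable (fun y : Phase N => f y * ⟪ψ, weylOp (-y) φ⟫_ℂ) volume := by
  refine f.integrable.mul_bdd (c := ‖ψ‖ * ‖φ‖) ?_ (Filter.Eventually.of_forall fun y => ?_)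
  · simp only [inner_weylOp_eq_integral]
    exact (stronglyMeasurable_weyl_integrand ψ φ).integral_prod_right'.aestronglyMeasurable
  · exact (norm_inner_le_norm _ _).trans_eq (by rw [(weylOp (-y)).norm_map])

theorem integrable_slice (f : 𝓢(Phase N, ℂ)) (q : Config N) :
    Integrable (fun p => f (q, p)) volume := by
  have hg : Function.HasTemperateGrowth fun p : Config N => ((q, p) : Phase N) := by
    have h := (Function.HasTemperateGrowth.const ((q, 0) : Phase N)).add
      (ContinuousLinearMap.inr ℝ (Config N) (Config N)).hasTemperateGrowth
    have e : (fun p : Config N => ((q, p) : Phase N)) = (fun _ => ((q, 0) : Phase N)) +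
        ⇑(ContinuousLinearMap.inr ℝ (Config N) (Config N)) := by
      funext p
      simp
    rwa [e]
  have hl : AntilipschitzWith 1 fun p : Config N => ((q, p) : Phase N) :=
    (Isometry.of_dist_eq fun p p' => by simp [Prod.dist_eq]).antilipschitz
  exact (compCLMOfAntilipschitz ℂ hg hl f).integrable

/-- By Fubini the `p` integral is done first. The phase of `W(-(q,p))` involves the midpoint `v = s
+ q/2`, and `v - q/2`, `v + q/2` are `s` and `s + q`. -/
theorem integral_snd_weyl (T : SchwartzOperator N) (ψ φ : Hilb N) (q : Config N) :
    ∫ p, weylEquiv N T (q, p) * ⟪ψ, weylOp (-(q, p)) φ⟫_ℂ =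
      (Real.sqrt (2 * Real.pi) : ℂ) ^ N * ((Real.sqrt (2 * Real.pi) : ℂ) ^ N *
        ∫ s, (starRingEnd ℂ) (ψ s) * kernelEquiv N T (s, s + q) * φ (s + q)) := by
  have hsub : ∀ s p : Config N, s - (-(q, p) : Phase N).1 = s + q := fun s p => by
    rw [Prod.fst_neg, sub_neg_eq_add]
  simp only [inner_weylOp_eq_integral, ← integral_const_mul, hsub]
  rw [integral_integral_swap]
  · refine integral_congr_ae (Filter.Eventually.of_forall fun s => ?_)
    have h := integral_exp_mul_weylEquiv T q (s + (1 / 2 : ℝ) • q)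
    have e1 : s + (1 / 2 : ℝ) • q - (1 / 2 : ℝ) • q = s := add_sub_cancel_right _ _
    have e2 : s + (1 / 2 : ℝ) • q + (1 / 2 : ℝ) • q = s + q := by module
    rw [e1, e2] at h
    simp only [weylPhase_neg]
    have e3 : ∀ p, weylEquiv N T (q, p) * (Complex.exp (Complex.I *
        (-1 * ⟪s + (1 / 2 : ℝ) • q, p⟫_ℝ : ℝ)) * ((starRingEnd ℂ) (ψ s) * φ (s + q))) =
        (Complex.exp (Complex.I * (-1 * ⟪s + (1 / 2 : ℝ) • q, p⟫_ℝ : ℝ)) *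
          weylEquiv N T (q, p)) * ((starRingEnd ℂ) (ψ s) * φ (s + q)) := fun p => by ring
    simp only [e3]
    rw [integral_mul_const, h]
    ring
  · have hφ : MemLp (fun s => φ (s + q)) 2 (volume : Measure (Config N)) :=
      (Lp.memLp φ).comp_measurePreserving (measurePreserving_add_right volume q)
    have h1 := (integrable_slice (weylEquiv N T) q).mul_prod
      (integrable_mul_of_memLp_two (memLp_conj ψ) hφ)
    have hc : Continuous fun z : Config N × Config N => weylPhase (-(q, z.1)) z.2 := by
      unfold weylPhase
      fun_prop
    refine (h1.bdd_mul (c := 1) hc.aestronglyMeasurable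
      (Filter.Eventually.of_forall fun z => (norm_weylPhase _ _).le)).congr
      (Filter.Eventually.of_forall fun z => ?_)
    simp only [Function.uncurry]
    ring

/-- The shear `(s, q) ↦ (s, s + q)` preserves the measure; this also provides the integrability for
Fubini. -/
theorem integral_kernel_shift (K : 𝓢(Phase N, ℂ)) (ψ φ : Hilb N) :
    ∫ q, ∫ s, (starRingEnd ℂ) (ψ s) * K (s, s + q) * φ (s + q) =
      ∫ z : Phase N, (starRingEnd ℂ) (ψ z.1) * K z * φ z.2 := by
  have hM := integrable_kernel_mul ψ φ K
  have hS := (measurePreserving_prod_add (volume : Measure (Config N)) volume).integrable_comp_of_integrable hM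
  rw [integral_integral_swap]
  · refine Eq.trans ?_ (integral_prod _ hM).symm
    refine integral_congr_ae (Filter.Eventually.of_forall fun s => ?_)
    exact integral_add_left_eq_self (fun q => (starRingEnd ℂ) (ψ s) * K (s, q) * φ q) s
  · exact hS.swap

theorem isInverseWeylTransform_weylEquiv (T : SchwartzOperator N) :
    IsInverseWeylTransform (weylEquiv N T) T.op := fun ψ φ => by
  rw [integral_phaseMeasure, isKernel_kernelEquiv T ψ φ, ← integral_kernel_shift]
  have h := integral_prod _ (integrable_mul_inner_weylOp (weylEquiv N T) ψ φ)
  simp only [integral_snd_weyl] at h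
  rw [integral_const_mul, integral_const_mul] at h
  refine Eq.trans ?_ (congrArg _ h.symm)
  exact (two_pi_pow_inv_mul N _).symm

end

end QuantumSchwartz

namespace QuantumSchwartz

noncomputable section

variable {N : ℕ}

/-! ### The symplectic Fourier transform -/

/-- The symplectic Fourier transform `𝔖(X) ≅ 𝔖(X)`. -/
def symplecticFourierEquiv (N : ℕ) : 𝓢(Phase N, ℂ) ≃L[ℂ] 𝓢(Phase N, ℂ) :=
  ((partialFourier N (s := 1) (t := -1) (by norm_num) (by norm_num) (by norm_num)).trans
    (schwartzComp (ContinuousLinearEquiv.prodComm ℝ (Config N) (Config N)))).trans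
      (partialFourier N (s := -1) (t := 1) (by norm_num) (by norm_num) (by norm_num))

/-- With `y = (q', p')` the exponent is `i q·p' - i p·q'`: transform in `p'` with sign `+`, swap,
then transform in `q'` with sign `-`. The two constants cancel against the normalised measure. -/
theorem symplecticFourierEquiv_apply (f : 𝓢(Phase N, ℂ)) (x : Phase N) :
    symplecticFourierEquiv N f x = symplecticFourier f x := by
  obtain ⟨q, p⟩ := x
  rw [symplecticFourier, integral_phaseMeasure]
  have hint : Integrable (fun y : Phase N =>
      Complex.exp (-Complex.I * (sympForm (q, p) y : ℝ)) * f y) volume := by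
    refine f.integrable.bdd_mul (c := 1) ?_ (Filter.Eventually.of_forall fun y => ?_)
    · refine Continuous.aestronglyMeasurable ?_
      unfold sympForm
      fun_prop
    · rw [neg_mul, ← mul_neg, ← Complex.ofReal_neg, norm_exp_I_mul]
  have h : ∫ y : Phase N, Complex.exp (-Complex.I * (sympForm (q, p) y : ℝ)) * f y =
      (Real.sqrt (2 * Real.pi) : ℂ) ^ N * ((Real.sqrt (2 * Real.pi) : ℂ) ^ N *
        symplecticFourierEquiv N f (q, p)) := by
    rw [symplecticFourierEquiv, ContinuousLinearEquiv.trans_apply, partialFourier_apply,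
      ← integral_const_mul]
    refine (integral_prod _ hint).trans ?_
    refine integral_congr_ae (Filter.Eventually.of_forall fun q' => ?_)
    beta_reduce
    rw [ContinuousLinearEquiv.trans_apply, schwartzComp_apply, mul_left_comm]
    have h1 := partialFourier_apply (s := 1) (t := -1) (by norm_num) (by norm_num) (by norm_num)
      f q' q
    refine Eq.trans ?_ (congrArg _ h1.symm)
    rw [← integral_const_mul]
    refine integral_congr_ae (Filter.Eventually.of_forall fun p' => ?_)
    simp only
    rw [← mul_assoc, ← Complex.exp_add, sympForm, real_inner_comm q' p]
    congr 2
    push_cast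
    ring
  rw [h, two_pi_pow_inv_mul]

/-! ### Distributions -/

/-- The transpose of an isomorphism, as an isomorphism of the weak-* duals. -/
def dualEquiv {E F : Type*} [AddCommGroup E] [Module ℂ E] [TopologicalSpace E] [AddCommGroup F]
    [Module ℂ F] [TopologicalSpace F] (e : E ≃L[ℂ] F) : (F →Lₚₜ[ℂ] ℂ) ≃L[ℂ] (E →Lₚₜ[ℂ] ℂ) where
  toLinearEquiv := LinearEquiv.ofLinearMap
    (PointwiseConvergenceCLM.precomp ℂ (e : E →L[ℂ] F)).toLinearMap
    (PointwiseConvergenceCLM.precomp ℂ (e.symm : F →L[ℂ] E)).toLinearMap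
    (LinearMap.ext fun φ => DFunLike.ext _ _ fun x => congrArg φ (e.symm_apply_apply x))
    (LinearMap.ext fun φ => DFunLike.ext _ _ fun x => congrArg φ (e.apply_symm_apply x))
  continuous_toFun := (PointwiseConvergenceCLM.precomp ℂ (e : E →L[ℂ] F)).continuous
  continuous_invFun := (PointwiseConvergenceCLM.precomp ℂ (e.symm : F →L[ℂ] E)).continuous

/-- Parity on `𝔖(X)` as an isomorphism. -/
def parityEquiv (N : ℕ) : 𝓢(Phase N, ℂ) ≃L[ℂ] 𝓢(Phase N, ℂ) :=
  schwartzComp (ContinuousLinearEquiv.neg ℝ)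

end

end QuantumSchwartz

theorem mainTheorem7 (N : ℕ) :
    ∃ (kern : SchwartzOperator N ≃L[ℂ] 𝓢(Config N × Config N, ℂ))
      (matr : SchwartzOperator N ≃L[ℂ] SchwartzSeq (N + N))
      (four : 𝓢(Phase N, ℂ) ≃L[ℂ] 𝓢(Phase N, ℂ))
      (weyl : SchwartzOperator N ≃L[ℂ] 𝓢(Phase N, ℂ)),
      -- the kernel, matrix, symplectic Fourier and Weyl isomorphisms on test objects
      (∀ T, IsKernel T.op (kern T)) ∧
      (∀ T α α', (matr T).coeff (Fin.append α α') = matrixElem T.op α α') ∧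
      (∀ f x, four f x = symplecticFourier f x) ∧
      (∀ T, IsWeylTransform T.op (weyl T)) ∧
      (∀ f : 𝓢(Phase N, ℂ), IsInverseWeylTransform f (weyl.symm f).op) ∧
      -- the transposes of the kernel and matrix isomorphisms are isomorphisms of the duals
      (∃ kernD : 𝓢'(Config N × Config N, ℂ) ≃L[ℂ] OperatorDistribution N,
        ∀ φ T, kernD φ T = φ (kern T)) ∧
      (∃ matrD : SeqDistribution (N + N) ≃L[ℂ] OperatorDistribution N,
        ∀ a T, matrD a T = a (matr T)) ∧
      -- Fourier transform, Weyl transform and Weyl quantisation of distributions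
      ∃ (fourD : 𝓢'(Phase N, ℂ) ≃L[ℂ] 𝓢'(Phase N, ℂ))
        (weylD : OperatorDistribution N ≃L[ℂ] 𝓢'(Phase N, ℂ))
        (quantD : 𝓢'(Phase N, ℂ) ≃L[ℂ] OperatorDistribution N),
        (∀ φ f, fourD φ f = φ (parity (four f))) ∧
        (∀ Φ f, weylD Φ f = Φ (weyl.symm (parity f))) ∧
        (∀ φ T, weylD.symm φ T = φ (parity (weyl T))) ∧
        (∀ φ, quantD φ = weylD.symm (parityDist (fourD φ))) := by
  refine ⟨kernelEquiv N, matrixEquiv N, symplecticFourierEquiv N, weylEquiv N,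
    isKernel_kernelEquiv, fun T α α' => ?_, symplecticFourierEquiv_apply,
    isWeylTransform_weylEquiv, fun f => ?_, ⟨dualEquiv (kernelEquiv N), fun _ _ => rfl⟩,
    ⟨dualEquiv (matrixEquiv N), fun _ _ => rfl⟩,
    -- Transposition reverses composition, so parity follows the transform on test functions. The
    -- identities below hold by `rfl`, the inverse of parity reducing to parity itself.
    dualEquiv ((symplecticFourierEquiv N).trans (parityEquiv N)),
    dualEquiv ((parityEquiv N).trans (weylEquiv N).symm),
    ((dualEquiv ((symplecticFourierEquiv N).trans (parityEquiv N))).trans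
      (dualEquiv (parityEquiv N))).trans
      (dualEquiv ((parityEquiv N).trans (weylEquiv N).symm)).symm,
    fun _ _ => rfl, fun _ _ => rfl, fun _ _ => rfl, fun _ => rfl⟩
  · rw [matrixEquiv_coeff, leftIdx_append, rightIdx_append]
  · have h := isInverseWeylTransform_weylEquiv ((weylEquiv N).symm f)
    rwa [ContinuousLinearEquiv.apply_symm_apply] at h
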